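/- Let $M$ be a smooth $n$-manifold (Hausdorff, second countable) with smooth functions $x^1,\dots,x^n$ on $M$ that form a coordinate system near every point (such functions exist, for instance, on every contractible $M$ without boundary), and let $F=M\times\mathbb R^m\to M$ with fibre coordinates $u^a$. Let $J^\infty F$ be its infinite jet bundle, with coordinates $(x^i,u^a_I)$; smooth functions and differential forms on $J^\infty F$ involve finitely many of these coordinates. Let $D_i$ be the total derivatives, let $\Omega^{h,v}(F)$ denote the forms of horizontal degree $h$ and vertical degree $v$, and let $d=d_h+d_v$ be the splitting of the de Rham differential into its parts of bidegree $(1,0)$ and $(0,1)$ (the variational bicomplex; $\Omega^{h,v}(F)=0$ if $h<0$). Let $f=(f^1,\dots,f^r)$ be a regular equation form of order $k$ of a PDE system $\mathcal E=\{f=0\}\subset J^kF$: the $f^A$ are smooth functions on $J^kF$, and every smooth function on $J^kF$ that vanishes on $\mathcal E$ is a combination of the $f^A$ with smooth coefficients on $J^kF$. Let $\mathcal E^\infty=\{D_If^A=0 \text{ for all } I,A\}$ be its infinite prolongation, and assume that it is regular too: every smooth function on $J^\infty F$ that vanishes on $\mathcal E^\infty$ is a finite combination of the $D_If^A$ with smooth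 coefficients. Forms on $\mathcal E^\infty$ are forms on $J^\infty F$ modulo the ideal generated by the smooth functions vanishing on $\mathcal E^\infty$ and their differentials; write $\iota_\infty^*$ for the quotient map and $\Omega^{h,v}_{\mathcal E}(F)=\iota_\infty^*\Omega^{h,v}(F)$. The differentials $d,d_h,d_v$ descend to these forms. For any other tuple of smooth functions $e=(e_a)$ define $\mathcal E_e^\infty=\{D_Ie_a=0\}$ in the same way. Assume that the de Rham cohomology of $\mathcal E^\infty$ and of $J^\infty F$ vanishes in positive degrees, and let $\hat\omega\in\Omega^{n-1,2}_{\mathcal E}(F)$ be a presymplectic current density compatible with $\mathcal E$, that is, $d_h\hat\omega=0$ and $d_v\hat\omega=0$ on $\mathcal E^\infty$. Recall that for a Lagrangian density $L\in\Omega^{n,0}(F)$ one has a first variation formula $$d_vL=\mathrm{EL}_a\wedge d_vu^a-d_h\theta,\qquad \mathrm{EL}_a=e_a\,dx^1\wedge\cdots\wedge dx^n,\quad \theta\in\Omega^{n-1,1}(F),$$ in which $\mathrm{EL}_a$ is determined by $L$, and that the presymplectic current density of $L$ is the class of $d_v\theta$ in $\Omega^{n-1,2}(F)/d_h\Omega^{n-2,2}(F)$,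 the form $\theta$ being determined only up to $d_h$-closed terms. Theorem. There is a Lagrangian density $L\in\Omega^{n,0}(F)$, with a first variation formula as above, such that: 1. the presymplectic current density of $L$ has a representative $\omega=d_v\theta+d_h\sigma$, $\sigma\in\Omega^{n-2,2}(F)$, with $\iota_\infty^*\omega=\hat\omega$; moreover, if the vertical ($d_v$-) cohomology of $\mathcal E^\infty$ vanishes in all positive vertical degrees, then $L$ and $\theta$ can be chosen so that $\sigma=0$, i.e. $\iota_\infty^*d_v\theta=\hat\omega$; 2. the Euler–Lagrange system contains $\mathcal E$: $\mathcal E^\infty\subseteq\mathcal E^\infty_{\mathrm{EL}}=\{D_Ie_a=0\}$, and every smooth solution $\phi$ of $f(j^\infty\phi)=0$ on an open subset of $M$ also satisfies the Euler–Lagrange equations $e_a(j^\infty\phi)=0$ there. -/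

import Mathlib

open scoped Manifold ContDiff

noncomputable section

namespace JetPDE

/-! ## Jets

`M` is an `n`-dimensional manifold, `X : M → ℝⁿ` are its coordinates `x¹,…,xⁿ` (a local
diffeomorphism), and `F = M × ℝᵐ → M` has the fibre coordinates `u¹,…,uᵐ`. -/

/-- Labels `(I, a)` of the jet coordinates `u^a_I`; `I` is a multi-index. -/
abbrev JetIdx (n m : ℕ) : Type := (Fin n → ℕ) × Fin m

/-- The infinite jet bundle `J^∞F`: a point is `(x, (u^a_I))`. -/
abbrev Jet (M : Type*) (n m : ℕ) : Type _ := M × (JetIdx n m → ℝ)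

/-- Tangent vectors of `J^∞F` in the frame `∂/∂xⁱ, ∂/∂u^a_I`: the first component has the entries
`dxⁱ(w)`, the second one the entries `du^a_I(w)`. -/
abbrev Tan (n m : ℕ) : Type := EuclideanSpace ℝ (Fin n) × (JetIdx n m → ℝ)

/-- The index `(I, a)` with one more derivative in the direction `i`. -/
def JetIdx.succ {n m : ℕ} (c : JetIdx n m) (i : Fin n) : JetIdx n m := (c.1 + Pi.single i 1, c.2)

section Defs

variable {M : Type*} [TopologicalSpace M] {n m r : ℕ} [ChartedSpace (EuclideanSpace ℝ (Fin n)) M]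

/-- Smooth functions on `J^∞F`: pullbacks of smooth functions of finitely many jet coordinates. -/
def IsSmooth (g : Jet M n m → ℝ) : Prop :=
  ∃ (S : Finset (JetIdx n m)) (G : M × (S → ℝ) → ℝ),
    ContMDiff ((𝓡 n).prod 𝓘(ℝ, S → ℝ)) 𝓘(ℝ, ℝ) ∞ G ∧
      ∀ (x : M) (u : JetIdx n m → ℝ), g (x, u) = G (x, fun c => u c)

/-- `g` is (the pullback of) a function on `J^kF`. -/
def HasOrder (k : ℕ) (g : Jet M n m → ℝ) : Prop :=
  ∀ (x : M) (u u' : JetIdx n m → ℝ),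
    (∀ c : JetIdx n m, ∑ i, c.1 i ≤ k → u c = u' c) → g (x, u) = g (x, u')

/-- The derivative of `h : M → ℝ` at `x` along `∑ ξⁱ ∂/∂xⁱ`, where `∂/∂xⁱ` is the frame of `TM`
dual to `dx¹,…,dxⁿ`. -/
def baseDeriv (X : M → EuclideanSpace ℝ (Fin n)) (h : M → ℝ) (x : M)
    (ξ : EuclideanSpace ℝ (Fin n)) : ℝ :=
  mfderiv (𝓡 n) 𝓘(ℝ, ℝ) h x
    ((mfderiv (𝓡 n) 𝓘(ℝ, EuclideanSpace ℝ (Fin n)) X x).inverse ξ)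

/-- The derivative `dg(w)` of a function on `J^∞F` along a tangent vector `w` at `q`. -/
def dirDeriv (X : M → EuclideanSpace ℝ (Fin n)) (g : Jet M n m → ℝ) (q : Jet M n m)
    (w : Tan n m) : ℝ :=
  baseDeriv X (fun y => g (y, q.2)) q.1 w.1 + deriv (fun t : ℝ => g (q.1, q.2 + t • w.2)) 0

/-- The horizontal part `∑ dxⁱ(w) Dᵢ` of `w`, with
`Dᵢ = ∂/∂xⁱ + ∑ u^a_{I+i} ∂/∂u^a_I`. -/
def hor (q : Jet M n m) (w : Tan n m) : Tan n m :=
  (w.1, fun c => ∑ i, w.1 i * q.2 (c.succ i))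

/-- The vertical part of `w`; its components are `(d_v u^a_I)(w)`. -/
def vert (q : Jet M n m) (w : Tan n m) : Tan n m := w - hor q w

/-- The total derivative `Dᵢ g`. -/
def totalDeriv (X : M → EuclideanSpace ℝ (Fin n)) (i : Fin n) (g : Jet M n m → ℝ) :
    Jet M n m → ℝ :=
  fun q => dirDeriv X g q (EuclideanSpace.single i 1, fun c => q.2 (c.succ i))

/-- The iterated total derivative `D_{i₁} ⋯ D_{i_s} g`. -/
def iterTotalDeriv (X : M → EuclideanSpace ℝ (Fin n)) (l : List (Fin n)) (g : Jet M n m → ℝ) :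
    Jet M n m → ℝ :=
  l.foldr (totalDeriv X) g

/-- The partial derivative `∂φ/∂xⁱ` of a function on `M`. -/
def partialDeriv (X : M → EuclideanSpace ℝ (Fin n)) (i : Fin n) (h : M → ℝ) : M → ℝ :=
  fun x => baseDeriv X h x (EuclideanSpace.single i 1)

/-- The infinite jet `j^∞_x φ`, with the coordinates `u^a_I = ∂_I φ^a (x)`. -/
def jetProlong (X : M → EuclideanSpace ℝ (Fin n)) (φ : M → Fin m → ℝ) (x : M) : Jet M n m :=
  (x, fun c => (List.finRange n).foldr (fun i h => (partialDeriv X i)^[c.1 i] h)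
    (fun y => φ y c.2) x)

/-! ## Differential forms and the variational bicomplex -/

/-- Values of (not necessarily smooth or alternating) `p`-forms on `J^∞F`. -/
abbrev PreForm (M : Type*) (n m p : ℕ) : Type _ := Jet M n m → (Fin p → Tan n m) → ℝ

/-- Differential `p`-forms on `J^∞F`: alternating multilinear in the tangent vectors, involving only
finitely many of the `u^a_I` and `du^a_I`, with smooth coefficients. -/
def IsForm {p : ℕ} (α : PreForm M n m p) : Prop :=
  (∀ q, ∃ A : Tan n m [⋀^Fin p]→ₗ[ℝ] ℝ, ∀ w, α q w = A w) ∧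
  (∃ S : Finset (JetIdx n m), ∀ (x : M) (u u' : JetIdx n m → ℝ) (w w' : Fin p → Tan n m),
    (∀ c ∈ S, u c = u' c) →
    (∀ j, (w j).1 = (w' j).1 ∧ ∀ c ∈ S, (w j).2 c = (w' j).2 c) →
    α (x, u) w = α (x, u') w') ∧
  ∀ w, IsSmooth (fun q => α q w)

/-- The de Rham differential `d`. -/
def extD (X : M → EuclideanSpace ℝ (Fin n)) {p : ℕ} (α : PreForm M n m p) :
    PreForm M n m (p + 1) :=
  fun q w => ∑ i : Fin (p + 1),
    (-1) ^ (i : ℕ) * dirDeriv X (fun q' => α q' (fun j => w (i.succAbove j))) q (w i)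

/-- The wedge product `dg ∧ γ` of the differential of a function with a `p`-form. -/
def diffWedge (X : M → EuclideanSpace ℝ (Fin n)) {p : ℕ} (g : Jet M n m → ℝ)
    (γ : PreForm M n m p) : PreForm M n m (p + 1) :=
  fun q w => ∑ i : Fin (p + 1),
    (-1) ^ (i : ℕ) * (dirDeriv X g q (w i) * γ q (fun j => w (i.succAbove j)))

/-- The component of a `p`-form of vertical degree `v`, that is of bidegree `(p - v, v)`
(zero if `v > p`). -/
def vcomp {p : ℕ} (v : ℕ) (α : PreForm M n m p) : PreForm M n m p :=
  fun q w => ∑ s ∈ Finset.powersetCard v (Finset.univ : Finset (Fin p)),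
    α q (fun j => if j ∈ s then vert q (w j) else hor q (w j))

/-- `α ∈ Ω^{p-v,v}(F)` for a `p`-form `α`; for `v > p` only `α = 0` qualifies. -/
def IsBiform {p : ℕ} (v : ℕ) (α : PreForm M n m p) : Prop := IsForm α ∧ vcomp v α = α

/-- The horizontal differential, of bidegree `(1, 0)`. -/
def dH (X : M → EuclideanSpace ℝ (Fin n)) {p : ℕ} (α : PreForm M n m p) :
    PreForm M n m (p + 1) :=
  ∑ v ∈ Finset.range (p + 1), vcomp v (extD X (vcomp v α))

/-- The vertical differential, of bidegree `(0, 1)`. -/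
def dV (X : M → EuclideanSpace ℝ (Fin n)) {p : ℕ} (α : PreForm M n m p) :
    PreForm M n m (p + 1) :=
  ∑ v ∈ Finset.range (p + 1), vcomp (v + 1) (extD X (vcomp v α))

/-- The form `e_a dx¹ ∧ ⋯ ∧ dxⁿ ∧ d_v u^a` (summed over `a`). -/
def sourceForm (e : Fin m → Jet M n m → ℝ) : PreForm M n m (n + 1) :=
  fun q w => ∑ a, ∑ i : Fin (n + 1), (-1) ^ (n + (i : ℕ)) *
    (e a q * Matrix.det (Matrix.of fun j k : Fin n => (w (i.succAbove j)).1 k) *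
      (vert q (w i)).2 (0, a))

/-! ## PDE systems -/

/-- The equation form `f = (f^1,…,f^r)` has order `k` and is regular: a smooth function on `J^kF`
vanishing on `𝓔 = {f = 0} ⊂ J^kF` is a combination of the `f^A` with coefficients that are smooth
on `J^kF`. -/
def IsRegularSystem (k : ℕ) (f : Fin r → Jet M n m → ℝ) : Prop :=
  (∀ A, IsSmooth (f A) ∧ HasOrder k (f A)) ∧
  ∀ g : Jet M n m → ℝ, IsSmooth g → HasOrder k g →
    (∀ q, (∀ A, f A q = 0) → g q = 0) →
    ∃ c : Fin r → Jet M n m → ℝ, (∀ A, IsSmooth (c A) ∧ HasOrder k (c A)) ∧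
      ∀ q, g q = ∑ A, c A q * f A q

/-- The infinite prolongation: all total derivatives of all `f^A` vanish. -/
def infProlong (X : M → EuclideanSpace ℝ (Fin n)) (f : Fin r → Jet M n m → ℝ) :
    Set (Jet M n m) :=
  {q | ∀ (l : List (Fin n)) (A : Fin r), iterTotalDeriv X l (f A) q = 0}

/-- The infinite prolongation is regular: a smooth function on `J^∞F` vanishing on `𝓔^∞` is a finite
combination of the functions `D_I f^A` with smooth coefficients. -/
def IsRegularProlong (X : M → EuclideanSpace ℝ (Fin n)) (f : Fin r → Jet M n m → ℝ) : Prop :=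
  ∀ g : Jet M n m → ℝ, IsSmooth g → (∀ q ∈ infProlong X f, g q = 0) →
    ∃ (T : Finset (List (Fin n) × Fin r)) (c : List (Fin n) × Fin r → Jet M n m → ℝ),
      (∀ t, IsSmooth (c t)) ∧ ∀ q, g q = ∑ t ∈ T, c t q * iterTotalDeriv X t.1 (f t.2) q

/-- `PullbackZero X Z α` says `ι^* α = 0` for the inclusion `ι : Z ⊂ J^∞F`: the form lies in the
differential ideal generated by the smooth functions `g` that vanish on `Z` and by their
differentials. Forms on `Z` are forms on `J^∞F` modulo this ideal. -/
inductive PullbackZero (X : M → EuclideanSpace ℝ (Fin n)) (Z : Set (Jet M n m)) :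
    {p : ℕ} → PreForm M n m p → Prop
  | smul {p : ℕ} (g : Jet M n m → ℝ) (β : PreForm M n m p) (hg : IsSmooth g)
      (hZ : ∀ q ∈ Z, g q = 0) (hβ : IsForm β) : PullbackZero X Z (fun q w => g q * β q w)
  | diff {p : ℕ} (g : Jet M n m → ℝ) (γ : PreForm M n m p) (hg : IsSmooth g)
      (hZ : ∀ q ∈ Z, g q = 0) (hγ : IsForm γ) : PullbackZero X Z (diffWedge X g γ)
  | add {p : ℕ} (α β : PreForm M n m p) (hα : PullbackZero X Z α) (hβ : PullbackZero X Z β) :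
      PullbackZero X Z (α + β)

/-- `ι^* α = ι^* β` for the inclusion `ι : Z ⊂ J^∞F`. -/
def PullbackEq (X : M → EuclideanSpace ℝ (Fin n)) (Z : Set (Jet M n m)) {p : ℕ}
    (α β : PreForm M n m p) : Prop :=
  PullbackZero X Z (α - β)

/-- The de Rham cohomology of `Z ⊂ J^∞F` vanishes in all positive degrees. -/
def DeRhamTrivial (X : M → EuclideanSpace ℝ (Fin n)) (Z : Set (Jet M n m)) : Prop :=
  ∀ (p : ℕ) (α : PreForm M n m (p + 1)), IsForm α → PullbackZero X Z (extD X α) →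
    ∃ β : PreForm M n m p, IsForm β ∧ PullbackEq X Z α (extD X β)

/-- The vertical cohomology of `Z ⊂ J^∞F` vanishes in all positive vertical degrees. -/
def VerticallyTrivial (X : M → EuclideanSpace ℝ (Fin n)) (Z : Set (Jet M n m)) : Prop :=
  ∀ (p v : ℕ) (α : PreForm M n m (p + 1)), IsBiform (v + 1) α → PullbackZero X Z (dV X α) →
    ∃ β : PreForm M n m p, IsBiform v β ∧ PullbackEq X Z α (dV X β)

/-- A presymplectic current density on `𝓔^∞ = Z`, given by a representative
`w ∈ Ω^{n-1,2}(F)`: its pullback to `Z` is horizontally and vertically closed. -/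
def IsPresymplecticCurrent (X : M → EuclideanSpace ℝ (Fin n)) (Z : Set (Jet M n m))
    (w : PreForm M n m (n + 1)) : Prop :=
  IsBiform 2 w ∧ PullbackZero X Z (dH X w) ∧ PullbackZero X Z (dV X w)

/-- First variation of a Lagrangian density `L ∈ Ω^{n,0}(F)`: the functions `e_a` are its
Euler-Lagrange expressions and `θ ∈ Ω^{n-1,1}(F)` is a presymplectic potential current density,
`d_v L = e_a dx¹ ∧ ⋯ ∧ dxⁿ ∧ d_v u^a - d_h θ`. -/
def IsFirstVariation (X : M → EuclideanSpace ℝ (Fin n)) (L : PreForm M n m n)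
    (e : Fin m → Jet M n m → ℝ) (θ : PreForm M n m n) : Prop :=
  IsBiform 0 L ∧ (∀ a, IsSmooth (e a)) ∧ IsBiform 1 θ ∧ dV X L = sourceForm e - dH X θ

end Defs

end JetPDE

end

noncomputable section

namespace JetPDE

section Calculus

variable {M : Type*} [TopologicalSpace M] {n m : ℕ} [ChartedSpace (EuclideanSpace ℝ (Fin n)) M]
  {X : M → EuclideanSpace ℝ (Fin n)}

/-! ## Smooth functions on the jet bundle -/

/-! Write `Z` for the infinite prolongation, `≈` for equality of forms on `Z`, and `β_v` for the
part of `β` of vertical degree `v`. The current is closed under `d = d_h + d_v` on `Z`, so the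
vanishing cohomology of `Z` gives an `n`-form `β` on the jet bundle with `ω̂ ≈ dβ`. As `d` raises
the vertical degree by zero or one (`splits_of_hasWeight`), comparing vertical degrees one and two
yields `d_v β_0 + d_h β_1 ≈ 0` and `d_v β_1 + d_h β_2 ≈ ω̂`. Thus `β_0` is almost a Lagrangian,
`β_1` almost its potential, and `β_2` is `σ`.

The first relation must become an exact identity on the jet bundle. Its left side is the `(n,1)`
part of an element of the ideal of `Z`, and `PullbackZero.hasSourceDecomp` writes such a part as
`d_v L' + e_a dx¹ ∧ ⋯ ∧ dxⁿ ∧ d_v u^a - d_h θ'` with `e_a` and `θ'` vanishing on `Z`. For a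
generator `g γ` this is repeated integration by parts, for `dg ∧ γ` it is the Leibniz rule `dg ∧ γ =
d(g γ) - g dγ`. Hence `L = β_0 - L'` and `θ = β_1 + θ'` satisfy the first variation formula, and
`d_v θ' ≈ 0` leaves the presymplectic current unchanged.

Two stability properties of the ideal carry this: it is closed under `d`, and also under taking
vertical components. The latter rests on `IsRegularProlong.isTotalDerivStable`: regularity of the
prolongation makes total derivatives preserve the functions vanishing on `Z`. The same stability
gives the inclusion of `Z` in the Euler–Lagrange prolongation. For solutions, the chain rule along
jet prolongations puts the jet of a solution in `Z`, where the `e_a` vanish.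

If the vertical cohomology of `Z` vanishes, the components of `β` of vertical degree at least two
are removed one after another from the top (`exists_primitive_of_verticallyTrivial`), so that `σ =
0`.

Technically, vertical components are handled through the rescalings `scale t` of the vertical
directions, which act by `t ^ v` in vertical degree `v`. Vandermonde inversion recovers each
component as a combination of rescalings. -/

/-- `Φ` is a local diffeomorphism between open sets that agrees with the coordinate map `X`. -/
structure CoordChart (X : M → EuclideanSpace ℝ (Fin n))
    (Φ : OpenPartialHomeomorph M (EuclideanSpace ℝ (Fin n))) : Prop where
  eqOn : Set.EqOn X Φ Φ.source
  smooth : ContMDiffOn (𝓡 n) 𝓘(ℝ, EuclideanSpace ℝ (Fin n)) ∞ Φ Φ.source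
  smooth_symm : ContMDiffOn 𝓘(ℝ, EuclideanSpace ℝ (Fin n)) (𝓡 n) ∞ Φ.symm Φ.target

theorem exists_coordChart
    (hX : IsLocalDiffeomorph (𝓡 n) 𝓘(ℝ, EuclideanSpace ℝ (Fin n)) ∞ X) (x : M) :
    ∃ Φ, CoordChart X Φ ∧ x ∈ Φ.source := by
  obtain ⟨Φ, hx, he⟩ := hX x
  exact ⟨Φ.toOpenPartialHomeomorph, ⟨he, Φ.contMDiffOn_toFun, Φ.contMDiffOn_invFun⟩, hx⟩

namespace CoordChart

variable {Φ : OpenPartialHomeomorph M (EuclideanSpace ℝ (Fin n))}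

theorem contMDiffAt (hΦ : CoordChart X Φ) {x : M} (hx : x ∈ Φ.source) :
    ContMDiffAt (𝓡 n) 𝓘(ℝ, EuclideanSpace ℝ (Fin n)) ∞ Φ x :=
  hΦ.smooth.contMDiffAt (Φ.open_source.mem_nhds hx)

theorem contMDiffAt_symm (hΦ : CoordChart X Φ) {z : EuclideanSpace ℝ (Fin n)}
    (hz : z ∈ Φ.target) : ContMDiffAt 𝓘(ℝ, EuclideanSpace ℝ (Fin n)) (𝓡 n) ∞ Φ.symm z :=
  hΦ.smooth_symm.contMDiffAt (Φ.open_target.mem_nhds hz)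

/-- `X` and `Φ` have the same germ at `x`, and differentiating the two compositions of `Φ` with its
inverse gives a two-sided inverse of the derivative. -/
theorem inverse_mfderiv (hΦ : CoordChart X Φ) {x : M} (hx : x ∈ Φ.source) :
    (mfderiv (𝓡 n) 𝓘(ℝ, EuclideanSpace ℝ (Fin n)) X x).inverse =
      mfderiv 𝓘(ℝ, EuclideanSpace ℝ (Fin n)) (𝓡 n) Φ.symm (Φ x) := by
  have e : mfderiv (𝓡 n) 𝓘(ℝ, EuclideanSpace ℝ (Fin n)) X x =
      mfderiv (𝓡 n) 𝓘(ℝ, EuclideanSpace ℝ (Fin n)) Φ x :=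
    Filter.EventuallyEq.mfderiv_eq
      (Filter.eventuallyEq_of_mem (Φ.open_source.mem_nhds hx) hΦ.eqOn)
  have d1 := (hΦ.contMDiffAt hx).mdifferentiableAt (by simp)
  have d2 := (hΦ.contMDiffAt_symm (Φ.map_source hx)).mdifferentiableAt (by simp)
  have d1' : MDifferentiableAt (𝓡 n) 𝓘(ℝ, EuclideanSpace ℝ (Fin n)) Φ (Φ.symm (Φ x)) := by
    rwa [Φ.left_inv hx]
  rw [e]
  apply ContinuousLinearMap.inverse_eq
  · have h := mfderiv_comp (Φ x) d1' d2
    rw [Filter.EventuallyEq.mfderiv_eq (f₁ := Φ ∘ Φ.symm) (f := id), mfderiv_id] at h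
    · rw [Φ.left_inv hx] at h
      exact h.symm
    · filter_upwards [Φ.open_target.mem_nhds (Φ.map_source hx)] with z hz
      exact Φ.right_inv hz
  · have h := mfderiv_comp x d2 d1
    rw [Filter.EventuallyEq.mfderiv_eq (f₁ := Φ.symm ∘ Φ) (f := id), mfderiv_id] at h
    · exact h.symm
    · filter_upwards [Φ.open_source.mem_nhds hx] with z hz
      exact Φ.left_inv hz

theorem baseDeriv_eq (hΦ : CoordChart X Φ) {x : M} (hx : x ∈ Φ.source) {h : M → ℝ}
    (hh : MDifferentiableAt (𝓡 n) 𝓘(ℝ, ℝ) h x) (ξ : EuclideanSpace ℝ (Fin n)) :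
    baseDeriv X h x ξ = fderiv ℝ (h ∘ Φ.symm) (Φ x) ξ := by
  have d2 := (hΦ.contMDiffAt_symm (Φ.map_source hx)).mdifferentiableAt (by simp)
  have hh' : MDifferentiableAt (𝓡 n) 𝓘(ℝ, ℝ) h (Φ.symm (Φ x)) := by rwa [Φ.left_inv hx]
  have e := mfderiv_comp (Φ x) hh' d2
  rw [mfderiv_eq_fderiv, Φ.left_inv hx] at e
  rw [baseDeriv, hΦ.inverse_mfderiv hx, e]
  rfl

end CoordChart

/-- A function of finitely many jet coordinates in a chart of the base. -/
def locRep {S : Finset (JetIdx n m)} (Φ : OpenPartialHomeomorph M (EuclideanSpace ℝ (Fin n)))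
    (G : M × (S → ℝ) → ℝ) : EuclideanSpace ℝ (Fin n) × (S → ℝ) → ℝ :=
  fun z => G (Φ.symm z.1, z.2)

theorem CoordChart.contDiffAt_locRep {Φ : OpenPartialHomeomorph M (EuclideanSpace ℝ (Fin n))}
    (hΦ : CoordChart X Φ) {S : Finset (JetIdx n m)} {G : M × (S → ℝ) → ℝ}
    (hG : ContMDiff ((𝓡 n).prod 𝓘(ℝ, S → ℝ)) 𝓘(ℝ, ℝ) ∞ G)
    {z : EuclideanSpace ℝ (Fin n) × (S → ℝ)} (hz : z.1 ∈ Φ.target) :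
    ContDiffAt ℝ ∞ (locRep Φ G) z := by
  rw [← contMDiffAt_iff_contDiffAt]
  have h1 : ContMDiffAt 𝓘(ℝ, EuclideanSpace ℝ (Fin n) × (S → ℝ))
      𝓘(ℝ, EuclideanSpace ℝ (Fin n)) ∞ Prod.fst z := contDiff_fst.contMDiff.contMDiffAt
  have h2 : ContMDiffAt 𝓘(ℝ, EuclideanSpace ℝ (Fin n) × (S → ℝ))
      𝓘(ℝ, S → ℝ) ∞ Prod.snd z := contDiff_snd.contMDiff.contMDiffAt
  exact (hG _).comp z (((hΦ.contMDiffAt_symm hz).comp z h1).prodMk h2)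

/-- Joint differentiability of the local representative merges the base and fibre derivatives into
one Fréchet derivative. Linearity, the Leibniz rule and the symmetry of second derivatives below are
all read off from this formula. -/
theorem CoordChart.dirDeriv_eq {Φ : OpenPartialHomeomorph M (EuclideanSpace ℝ (Fin n))}
    (hΦ : CoordChart X Φ) {S : Finset (JetIdx n m)} {G : M × (S → ℝ) → ℝ}
    (hG : ContMDiff ((𝓡 n).prod 𝓘(ℝ, S → ℝ)) 𝓘(ℝ, ℝ) ∞ G) {g : Jet M n m → ℝ}
    (hg : ∀ x u, g (x, u) = G (x, fun c => u c)) {x : M} (hx : x ∈ Φ.source)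
    (u : JetIdx n m → ℝ) (w : Tan n m) :
    dirDeriv X g (x, u) w =
      fderiv ℝ (locRep Φ G) (Φ x, fun c => u c) (w.1, fun c : S => w.2 c) := by
  have hL : HasFDerivAt (locRep Φ G) _ (Φ x, fun c : S => u c) :=
    ((hΦ.contDiffAt_locRep hG (z := (Φ x, fun c => u c)) (Φ.map_source hx)).differentiableAt
      (by simp)).hasFDerivAt
  have hsplit : ((w.1, fun c : S => w.2 c) : EuclideanSpace ℝ (Fin n) × (S → ℝ)) =
      (w.1, 0) + (0, fun c : S => w.2 c) := by simp
  rw [hsplit, map_add, dirDeriv]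
  congr 1
  · simp only [hg]
    have hm : MDifferentiableAt (𝓡 n) 𝓘(ℝ, ℝ) (fun y => G (y, fun c : S => u c)) x :=
      (((hG _).comp x ((contMDiffAt_id (I := 𝓡 n)).prodMk contMDiffAt_const)).mdifferentiableAt
        (by simp) :)
    rw [hΦ.baseDeriv_eq hx hm]
    have := hL.comp (Φ x) (hasFDerivAt_prodMk_left (𝕜 := ℝ) (Φ x) (fun c : S => u c))
    exact congrArg (fun l => l w.1) this.fderiv
  · have hline : HasDerivAt (fun t : ℝ => ((Φ x, (fun c : S => u c) + t • fun c : S => w.2 c) :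
        EuclideanSpace ℝ (Fin n) × (S → ℝ))) (0, fun c : S => w.2 c) 0 := by
      have h2 := ((hasDerivAt_id (0 : ℝ)).smul_const (fun c : S => w.2 c)).const_add
        (fun c : S => u c)
      simp only [one_smul] at h2
      exact (hasDerivAt_const (0 : ℝ) (Φ x)).prodMk h2
    have hL' : HasFDerivAt (locRep Φ G) (fderiv ℝ (locRep Φ G) (Φ x, fun c : S => u c))
        (Φ x, (fun c : S => u c) + (0 : ℝ) • fun c : S => w.2 c) := by simpa using hL
    have := (hL'.comp_hasDerivAt (0 : ℝ) hline).deriv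
    rw [← this]
    congr 1
    ext t
    simp only [hg, locRep, Function.comp, Φ.left_inv hx]
    rfl

/-- `g` is a smooth function of the point of `M` and of the jet coordinates in `S`. -/
def SmoothWith (S : Finset (JetIdx n m)) (g : Jet M n m → ℝ) : Prop :=
  ∃ G : M × (S → ℝ) → ℝ, ContMDiff ((𝓡 n).prod 𝓘(ℝ, S → ℝ)) 𝓘(ℝ, ℝ) ∞ G ∧
      ∀ (x : M) (u : JetIdx n m → ℝ), g (x, u) = G (x, fun c => u c)

theorem SmoothWith.mono {S T : Finset (JetIdx n m)} (hST : S ⊆ T) {g : Jet M n m → ℝ}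
    (h : SmoothWith S g) : SmoothWith T g := by
  obtain ⟨G, hG, hg⟩ := h
  refine ⟨fun z => G (z.1, fun c => z.2 ⟨c, hST c.2⟩), ?_, fun x u => hg x u⟩
  refine hG.comp (contMDiff_fst.prodMk ?_)
  have : ContMDiff 𝓘(ℝ, T → ℝ) 𝓘(ℝ, S → ℝ) ∞ (fun y : T → ℝ => fun c : S => y ⟨c, hST c.2⟩) := by
    rw [contMDiff_iff_contDiff]
    fun_prop
  exact this.comp contMDiff_snd

theorem SmoothWith.congr_of_eqOn {S : Finset (JetIdx n m)} {g : Jet M n m → ℝ}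
    (h : SmoothWith S g) {x : M} {u u' : JetIdx n m → ℝ} (hu : ∀ c ∈ S, u c = u' c) :
    g (x, u) = g (x, u') := by
  obtain ⟨G, -, hg⟩ := h
  rw [hg, hg]
  congr 2
  ext c
  exact hu c c.2

theorem IsSmooth.exists_common {f g : Jet M n m → ℝ} (hf : IsSmooth f) (hg : IsSmooth g) :
    ∃ S, SmoothWith S f ∧ SmoothWith S g := by
  classical
  obtain ⟨S, hS⟩ := hf
  obtain ⟨T, hT⟩ := hg
  exact ⟨S ∪ T, SmoothWith.mono Finset.subset_union_left hS,
    SmoothWith.mono Finset.subset_union_right hT⟩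

theorem isSmooth_const (a : ℝ) : IsSmooth (fun _ : Jet M n m => a) :=
  ⟨∅, fun _ => a, contMDiff_const, fun _ _ => rfl⟩

theorem isSmooth_coord (c : JetIdx n m) : IsSmooth (fun q : Jet M n m => q.2 c) := by
  refine ⟨{c}, fun z => z.2 ⟨c, by simp⟩, ?_, fun _ _ => rfl⟩
  have : ContMDiff 𝓘(ℝ, ({c} : Finset (JetIdx n m)) → ℝ) 𝓘(ℝ, ℝ) ∞
      (fun y : ({c} : Finset (JetIdx n m)) → ℝ => y ⟨c, by simp⟩) := by
    rw [contMDiff_iff_contDiff]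
    fun_prop
  exact this.comp contMDiff_snd

theorem IsSmooth.add {f g : Jet M n m → ℝ} (hf : IsSmooth f) (hg : IsSmooth g) :
    IsSmooth (fun q => f q + g q) := by
  obtain ⟨S, ⟨F, hF, hf⟩, G, hG, hg⟩ := hf.exists_common hg
  exact ⟨S, fun z => F z + G z, hF.add hG, fun x u => by simp only [hf, hg]⟩

theorem IsSmooth.mul {f g : Jet M n m → ℝ} (hf : IsSmooth f) (hg : IsSmooth g) :
    IsSmooth (fun q => f q * g q) := by
  obtain ⟨S, ⟨F, hF, hf⟩, G, hG, hg⟩ := hf.exists_common hg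
  exact ⟨S, fun z => F z * G z, hF.mul hG, fun x u => by simp only [hf, hg]⟩

theorem IsSmooth.const_mul (a : ℝ) {f : Jet M n m → ℝ} (hf : IsSmooth f) :
    IsSmooth (fun q => a * f q) := (isSmooth_const a).mul hf

theorem IsSmooth.neg {f : Jet M n m → ℝ} (hf : IsSmooth f) :
    IsSmooth (fun q => - f q) := by simpa using hf.const_mul (-1)

theorem isSmooth_sum {ι : Type*} (s : Finset ι) {f : ι → Jet M n m → ℝ}
    (hf : ∀ i ∈ s, IsSmooth (f i)) : IsSmooth (fun q => ∑ i ∈ s, f i q) := by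
  classical
  induction s using Finset.induction_on with
  | empty => simpa using isSmooth_const 0
  | insert a s ha ih =>
    simp only [Finset.sum_insert ha]
    exact (hf a (by simp)).add (ih fun i hi => hf i (by simp [hi]))

theorem isSmooth_prod {ι : Type*} (s : Finset ι) {f : ι → Jet M n m → ℝ}
    (hf : ∀ i ∈ s, IsSmooth (f i)) : IsSmooth (fun q => ∏ i ∈ s, f i q) := by
  classical
  induction s using Finset.induction_on with
  | empty => simpa using isSmooth_const 1
  | insert a s ha ih =>
    simp only [Finset.prod_insert ha]
    exact (hf a (by simp)).mul (ih fun i hi => hf i (by simp [hi]))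

variable (hX : IsLocalDiffeomorph (𝓡 n) 𝓘(ℝ, EuclideanSpace ℝ (Fin n)) ∞ X)
include hX

theorem isSmooth_base (i : Fin n) : IsSmooth (fun q : Jet M n m => X q.1 i) := by
  refine ⟨∅, fun z => X z.1 i, ?_, fun _ _ => rfl⟩
  have : ContMDiff 𝓘(ℝ, EuclideanSpace ℝ (Fin n)) 𝓘(ℝ, ℝ) ∞
      (fun y : EuclideanSpace ℝ (Fin n) => y i) := by
    rw [contMDiff_iff_contDiff]
    fun_prop
  exact this.comp (hX.contMDiff.comp contMDiff_fst)

theorem dirDeriv_add_right {g : Jet M n m → ℝ} (hg : IsSmooth g) (q : Jet M n m)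
    (v w : Tan n m) : dirDeriv X g q (v + w) = dirDeriv X g q v + dirDeriv X g q w := by
  obtain ⟨S, G, hG, hg⟩ := hg
  obtain ⟨Φ, hΦ, hx⟩ := exists_coordChart hX q.1
  obtain ⟨x, u⟩ := q
  rw [hΦ.dirDeriv_eq hG hg hx, hΦ.dirDeriv_eq hG hg hx, hΦ.dirDeriv_eq hG hg hx, ← map_add]
  rfl

theorem dirDeriv_smul_right {g : Jet M n m → ℝ} (hg : IsSmooth g) (q : Jet M n m) (a : ℝ)
    (w : Tan n m) : dirDeriv X g q (a • w) = a * dirDeriv X g q w := by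
  obtain ⟨S, G, hG, hg⟩ := hg
  obtain ⟨Φ, hΦ, hx⟩ := exists_coordChart hX q.1
  obtain ⟨x, u⟩ := q
  rw [hΦ.dirDeriv_eq hG hg hx, hΦ.dirDeriv_eq hG hg hx, ← smul_eq_mul, ← map_smul]
  rfl

theorem SmoothWith.dirDeriv_congr {S : Finset (JetIdx n m)} {g : Jet M n m → ℝ}
    (hg : SmoothWith S g) (x : M) {u u' : JetIdx n m → ℝ} {w w' : Tan n m}
    (hu : ∀ c ∈ S, u c = u' c) (hw : w.1 = w'.1) (hw' : ∀ c ∈ S, w.2 c = w'.2 c) :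
    dirDeriv X g (x, u) w = dirDeriv X g (x, u') w' := by
  obtain ⟨G, hG, hg⟩ := hg
  obtain ⟨Φ, hΦ, hx⟩ := exists_coordChart hX x
  have e1 : (fun c : S => u c) = fun c : S => u' c := funext fun c => hu c c.2
  have e2 : (fun c : S => w.2 c) = fun c : S => w'.2 c := funext fun c => hw' c c.2
  rw [hΦ.dirDeriv_eq hG hg hx, hΦ.dirDeriv_eq hG hg hx, hw, e1, e2]

theorem dirDeriv_add {f g : Jet M n m → ℝ} (hf : IsSmooth f) (hg : IsSmooth g)
    (q : Jet M n m) (w : Tan n m) :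
    dirDeriv X (fun q => f q + g q) q w = dirDeriv X f q w + dirDeriv X g q w := by
  obtain ⟨S, ⟨F, hF, hf⟩, G, hG, hg⟩ := hf.exists_common hg
  obtain ⟨Φ, hΦ, hx⟩ := exists_coordChart hX q.1
  obtain ⟨x, u⟩ := q
  rw [hΦ.dirDeriv_eq hF hf hx, hΦ.dirDeriv_eq hG hg hx,
    hΦ.dirDeriv_eq (hF.add hG) (fun x u => by simp only [hf, hg]; rfl) hx]
  have h1 := (hΦ.contDiffAt_locRep hF (z := (Φ x, fun c => u c))
    (Φ.map_source hx)).differentiableAt (by simp)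
  have h2 := (hΦ.contDiffAt_locRep hG (z := (Φ x, fun c => u c))
    (Φ.map_source hx)).differentiableAt (by simp)
  exact congrArg (fun l => l (w.1, fun c : S => w.2 c))
    (h1.hasFDerivAt.add h2.hasFDerivAt).fderiv

theorem dirDeriv_mul {f g : Jet M n m → ℝ} (hf : IsSmooth f) (hg : IsSmooth g)
    (q : Jet M n m) (w : Tan n m) :
    dirDeriv X (fun q => f q * g q) q w = f q * dirDeriv X g q w + dirDeriv X f q w * g q := by
  obtain ⟨S, ⟨F, hF, hf⟩, G, hG, hg⟩ := hf.exists_common hg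
  obtain ⟨Φ, hΦ, hx⟩ := exists_coordChart hX q.1
  obtain ⟨x, u⟩ := q
  rw [hΦ.dirDeriv_eq hF hf hx, hΦ.dirDeriv_eq hG hg hx,
    hΦ.dirDeriv_eq (hF.mul hG) (fun x u => by simp only [hf, hg]; rfl) hx]
  have h1 := (hΦ.contDiffAt_locRep hF (z := (Φ x, fun c => u c))
    (Φ.map_source hx)).differentiableAt (by simp)
  have h2 := (hΦ.contDiffAt_locRep hG (z := (Φ x, fun c => u c))
    (Φ.map_source hx)).differentiableAt (by simp)
  have := congrArg (fun l => l (w.1, fun c : S => w.2 c))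
    (h1.hasFDerivAt.mul h2.hasFDerivAt).fderiv
  refine Eq.trans this ?_
  simp only [add_apply, smul_apply, smul_eq_mul, locRep,
    Φ.left_inv hx, hf, hg]
  ring

theorem dirDeriv_const (a : ℝ) (q : Jet M n m) (w : Tan n m) :
    dirDeriv X (fun _ => a) q w = 0 := by
  obtain ⟨Φ, hΦ, hx⟩ := exists_coordChart hX q.1
  obtain ⟨x, u⟩ := q
  rw [hΦ.dirDeriv_eq (S := ∅) (G := fun _ => a) contMDiff_const (fun _ _ => rfl) hx]
  have : locRep (S := (∅ : Finset (JetIdx n m))) Φ (fun _ => a) = fun _ => a := rfl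
  rw [this]
  simp

theorem dirDeriv_const_mul (a : ℝ) {f : Jet M n m → ℝ} (hf : IsSmooth f)
    (q : Jet M n m) (w : Tan n m) :
    dirDeriv X (fun q => a * f q) q w = a * dirDeriv X f q w := by
  rw [dirDeriv_mul hX (isSmooth_const a) hf, dirDeriv_const hX]
  ring

theorem dirDeriv_sum {ι : Type*} (s : Finset ι) {f : ι → Jet M n m → ℝ}
    (hf : ∀ i ∈ s, IsSmooth (f i)) (q : Jet M n m) (w : Tan n m) :
    dirDeriv X (fun q => ∑ i ∈ s, f i q) q w = ∑ i ∈ s, dirDeriv X (f i) q w := by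
  classical
  induction s using Finset.induction_on with
  | empty => simpa using dirDeriv_const hX 0 q w
  | insert a s ha ih =>
    simp only [Finset.sum_insert ha]
    rw [dirDeriv_add hX (hf a (by simp)) (isSmooth_sum s fun i hi => hf i (by simp [hi])),
      ih fun i hi => hf i (by simp [hi])]

omit hX in
theorem dirDeriv_coord (c : JetIdx n m) (q : Jet M n m) (w : Tan n m) :
    dirDeriv X (fun q => q.2 c) q w = w.2 c := by
  have h : HasDerivAt (fun t : ℝ => q.2 c + t * w.2 c) (w.2 c) 0 := by
    simpa using ((hasDerivAt_id (0 : ℝ)).mul_const (w.2 c)).const_add (q.2 c)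
  simp only [dirDeriv, baseDeriv, mfderiv_const, Pi.add_apply, Pi.smul_apply, smul_eq_mul]
  rw [h.deriv]
  exact zero_add _

theorem dirDeriv_base (i : Fin n) (q : Jet M n m) (w : Tan n m) :
    dirDeriv X (fun q => X q.1 i) q w = w.1 i := by
  obtain ⟨Φ, hΦ, hx⟩ := exists_coordChart hX q.1
  have hm : MDifferentiableAt (𝓡 n) 𝓘(ℝ, ℝ) (fun y => X y i) q.1 := by
    have h1 : ContMDiff 𝓘(ℝ, EuclideanSpace ℝ (Fin n)) 𝓘(ℝ, ℝ) ∞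
        (fun y : EuclideanSpace ℝ (Fin n) => y i) := by
      rw [contMDiff_iff_contDiff]
      fun_prop
    exact (h1.comp hX.contMDiff).mdifferentiableAt (by simp)
  simp only [dirDeriv, deriv_const, add_zero]
  rw [hΦ.baseDeriv_eq hx hm]
  have e : (fun y => X y i) ∘ Φ.symm =ᶠ[nhds (Φ q.1)] fun z => z i := by
    filter_upwards [Φ.open_target.mem_nhds (Φ.map_source hx)] with z hz
    simp only [Function.comp]
    rw [hΦ.eqOn (Φ.map_target hz), Φ.right_inv hz]
  rw [e.fderiv_eq]
  have := (EuclideanSpace.proj i : EuclideanSpace ℝ (Fin n) →L[ℝ] ℝ).hasFDerivAt (x := Φ q.1)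
  exact congrArg (fun l => l w.1) this.fderiv

-- Near each point `G` is a smooth function composed with the chart of the base, so smoothness may
-- be tested in the coordinates given by `X`.
omit hX in
theorem contMDiff_of_coordChart {S : Finset (JetIdx n m)} {G : M × (S → ℝ) → ℝ}
    (h : ∀ z : M × (S → ℝ), ∃ Φ, CoordChart X Φ ∧ z.1 ∈ Φ.source ∧
      ∃ H : EuclideanSpace ℝ (Fin n) × (S → ℝ) → ℝ, ContDiffAt ℝ ∞ H (Φ z.1, z.2) ∧
        ∀ x ∈ Φ.source, ∀ y, G (x, y) = H (Φ x, y)) :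
    ContMDiff ((𝓡 n).prod 𝓘(ℝ, S → ℝ)) 𝓘(ℝ, ℝ) ∞ G := by
  intro z
  obtain ⟨Φ, hΦ, hz, H, hH, hGH⟩ := h z
  have h1 : ContMDiffAt ((𝓡 n).prod 𝓘(ℝ, S → ℝ)) 𝓘(ℝ, EuclideanSpace ℝ (Fin n)) ∞
      (fun z : M × (S → ℝ) => Φ z.1) z := (hΦ.contMDiffAt hz).comp z contMDiffAt_fst
  have h2 : ContMDiffAt ((𝓡 n).prod 𝓘(ℝ, S → ℝ)) 𝓘(ℝ, EuclideanSpace ℝ (Fin n) × (S → ℝ)) ∞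
      (fun z : M × (S → ℝ) => (Φ z.1, z.2)) z := h1.prodMk_space contMDiffAt_snd
  have h3 := (contMDiffAt_iff_contDiffAt.2 hH).comp z h2
  refine h3.congr_of_eventuallyEq ?_
  have : Prod.fst ⁻¹' Φ.source ∈ nhds z := continuous_fst.continuousAt.preimage_mem_nhds
    (Φ.open_source.mem_nhds hz)
  filter_upwards [this] with z' hz'
  exact hGH z'.1 hz' z'.2

/-- Extension by zero of a vector of finitely many jet coordinates. -/
def extendZero (S : Finset (JetIdx n m)) (y : S → ℝ) : JetIdx n m → ℝ := by
  classical
  exact fun c => if h : c ∈ S then y ⟨c, h⟩ else 0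

omit hX in
omit [TopologicalSpace M] [ChartedSpace (EuclideanSpace ℝ (Fin n)) M] in
theorem extendZero_apply {S : Finset (JetIdx n m)} (y : S → ℝ) (c : S) :
    extendZero S y c = y c := by
  simp [extendZero]

/-- The components of `w` are constant, so differentiation brings in no jet coordinates outside `S`.
Extension by zero only supplies some point of the jet bundle over the given finitely many
coordinates. -/
theorem SmoothWith.dirDeriv {S : Finset (JetIdx n m)} {g : Jet M n m → ℝ}
    (hg : SmoothWith S g) (w : Tan n m) : SmoothWith S (fun q => dirDeriv X g q w) := by
  refine ⟨fun z => JetPDE.dirDeriv X g (z.1, extendZero S z.2) w, ?_, fun x u =>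
    hg.dirDeriv_congr hX x (fun c hc => ?_) rfl (fun _ _ => rfl)⟩
  · obtain ⟨G, hG, hg⟩ := hg
    refine contMDiff_of_coordChart (X := X) fun z => ?_
    obtain ⟨Φ, hΦ, hx⟩ := exists_coordChart hX z.1
    refine ⟨Φ, hΦ, hx, fun y => fderiv ℝ (locRep Φ G) y (w.1, fun c : S => w.2 c), ?_, ?_⟩
    · exact ((hΦ.contDiffAt_locRep hG (z := (Φ z.1, z.2)) (Φ.map_source hx)).fderiv_right
        (m := ∞) (by simp)).clm_apply contDiffAt_const
    · intro x hx y
      simp only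
      rw [hΦ.dirDeriv_eq hG hg hx]
      simp only [extendZero_apply]
  · exact (extendZero_apply (fun c : S => u c) ⟨c, hc⟩).symm

theorem IsSmooth.dirDeriv {g : Jet M n m → ℝ} (hg : IsSmooth g) (w : Tan n m) :
    IsSmooth (fun q => dirDeriv X g q w) := by
  obtain ⟨S, hS⟩ := hg
  exact ⟨S, SmoothWith.dirDeriv hX hS w⟩

theorem dirDeriv_comm {g : Jet M n m → ℝ} (hg : IsSmooth g) (q : Jet M n m) (v w : Tan n m) :
    dirDeriv X (fun q => dirDeriv X g q v) q w = dirDeriv X (fun q => dirDeriv X g q w) q v := by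
  obtain ⟨S, hS⟩ := hg
  have key : ∀ v, SmoothWith S fun q => JetPDE.dirDeriv X g q v := SmoothWith.dirDeriv hX hS
  obtain ⟨G, hG, hg⟩ := hS
  obtain ⟨Φ, hΦ, hx⟩ := exists_coordChart hX q.1
  obtain ⟨x, u⟩ := q
  have hL := hΦ.contDiffAt_locRep hG (z := (Φ x, fun c => u c)) (Φ.map_source hx)
  have hd : DifferentiableAt ℝ (fderiv ℝ (locRep Φ G)) (Φ x, fun c => u c) :=
    (hL.fderiv_right (m := ∞) (by simp)).differentiableAt (by simp)
  have main : ∀ v w : Tan n m, dirDeriv X (fun q => dirDeriv X g q v) (x, u) w =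
      fderiv ℝ (fderiv ℝ (locRep Φ G)) (Φ x, fun c => u c) (w.1, fun c : S => w.2 c)
        (v.1, fun c : S => v.2 c) := by
    intro v w
    obtain ⟨H, hH, hgH⟩ := key v
    rw [hΦ.dirDeriv_eq hH hgH hx]
    -- The second derivative needs the first one as a germ: the chart formula for `dirDeriv` is used
    -- at all points over the target of `Φ`.
    have e : locRep Φ H =ᶠ[nhds (Φ x, fun c : S => u c)]
        fun y => fderiv ℝ (locRep Φ G) y (v.1, fun c : S => v.2 c) := by
      have : Prod.fst ⁻¹' Φ.target ∈ nhds ((Φ x, fun c : S => u c) :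
          EuclideanSpace ℝ (Fin n) × (S → ℝ)) :=
        continuous_fst.continuousAt.preimage_mem_nhds
          (Φ.open_target.mem_nhds (Φ.map_source hx))
      filter_upwards [this] with z hz
      have h1 := hgH (Φ.symm z.1) (extendZero S z.2)
      simp only at h1
      rw [hΦ.dirDeriv_eq hG hg (Φ.map_target hz), Φ.right_inv hz] at h1
      simp only [extendZero_apply] at h1
      exact h1.symm
    rw [e.fderiv_eq, fderiv_clm_apply hd (differentiableAt_const _)]
    simp
  rw [main, main]
  exact (hL.isSymmSndFDerivAt (by simpa using ENat.LEInfty.out)).eq _ _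

end Calculus

/-! ## Alternating functions -/

section Alternating

variable {V : Type*} [AddCommGroup V] [Module ℝ V] {p : ℕ}

/-- `f` is an alternating multilinear function of its arguments. -/
def IsAlt (f : (Fin p → V) → ℝ) : Prop := ∃ A : V [⋀^Fin p]→ₗ[ℝ] ℝ, ∀ w, f w = A w

theorem isAlt_zero : IsAlt (fun _ : Fin p → V => (0 : ℝ)) := ⟨0, fun _ => rfl⟩

theorem IsAlt.add {f g : (Fin p → V) → ℝ} (hf : IsAlt f) (hg : IsAlt g) :
    IsAlt (fun w => f w + g w) := by
  obtain ⟨A, hA⟩ := hf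
  obtain ⟨B, hB⟩ := hg
  exact ⟨A + B, fun w => by simp [hA, hB]⟩

theorem IsAlt.const_mul (a : ℝ) {f : (Fin p → V) → ℝ} (hf : IsAlt f) :
    IsAlt (fun w => a * f w) := by
  obtain ⟨A, hA⟩ := hf
  exact ⟨a • A, fun w => by simp [hA]⟩

theorem IsAlt.comp_linear {f : (Fin p → V) → ℝ} (hf : IsAlt f) (T : V →ₗ[ℝ] V) :
    IsAlt (fun w => f (fun j => T (w j))) := by
  obtain ⟨A, hA⟩ := hf
  exact ⟨A.compLinearMap T, fun w => hA _⟩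

theorem IsAlt.cons {f : (Fin (p + 1) → V) → ℝ} (hf : IsAlt f) (v : V) :
    IsAlt (fun w => f (Fin.cons v w)) := by
  obtain ⟨A, hA⟩ := hf
  exact ⟨A.curryLeft v, fun w => hA _⟩

/-- The alternating map underlying an alternating function. -/
def IsAlt.toMap {f : (Fin p → V) → ℝ} (hf : IsAlt f) : V [⋀^Fin p]→ₗ[ℝ] ℝ := hf.choose

theorem IsAlt.toMap_apply {f : (Fin p → V) → ℝ} (hf : IsAlt f) (w : Fin p → V) :
    hf.toMap w = f w := (hf.choose_spec w).symm

/-- The linear family of alternating maps given by a function of `1 + p` arguments. -/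
def curriedMap {F : V → (Fin p → V) → ℝ} (hA : ∀ x, IsAlt (F x))
    (hadd : ∀ x y w, F (x + y) w = F x w + F y w) (hsmul : ∀ (a : ℝ) x w, F (a • x) w = a * F x w) :
    V →ₗ[ℝ] V [⋀^Fin p]→ₗ[ℝ] ℝ where
  toFun x := (hA x).toMap
  map_add' x y := by ext w; simp [IsAlt.toMap_apply, hadd]
  map_smul' a x := by ext w; simp [IsAlt.toMap_apply, hsmul]

/-- The signed sum is `AlternatingMap.alternatizeUncurryFin` of the curried family. Both exterior
differentials and wedge products with covectors have this shape. -/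
theorem isAlt_alternatization {F : V → (Fin p → V) → ℝ} (hA : ∀ x, IsAlt (F x))
    (hadd : ∀ x y w, F (x + y) w = F x w + F y w) (hsmul : ∀ (a : ℝ) x w, F (a • x) w = a * F x w) :
    IsAlt (fun w : Fin (p + 1) → V =>
      ∑ i : Fin (p + 1), (-1) ^ (i : ℕ) * F (w i) (fun j => w (i.succAbove j))) := by
  refine ⟨AlternatingMap.alternatizeUncurryFin (curriedMap hA hadd hsmul), fun w => ?_⟩
  rw [AlternatingMap.alternatizeUncurryFin_apply]
  refine Finset.sum_congr rfl fun i _ => ?_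
  simp only [curriedMap, LinearMap.coe_mk, AddHom.coe_mk, IsAlt.toMap_apply, zsmul_eq_mul]
  push_cast
  rfl

/-- The double alternation of a function that is symmetric in its first two arguments vanishes. -/
theorem alternatization_symm_eq_zero {F : V → V → (Fin p → V) → ℝ} (hA : ∀ x y, IsAlt (F x y))
    (hadd : ∀ x x' y w, F (x + x') y w = F x y w + F x' y w)
    (hsmul : ∀ (a : ℝ) x y w, F (a • x) y w = a * F x y w)
    (hsymm : ∀ x y w, F x y w = F y x w) (w : Fin (p + 1 + 1) → V) :
    ∑ i : Fin (p + 1 + 1), (-1) ^ (i : ℕ) * ∑ j : Fin (p + 1), (-1) ^ (j : ℕ) *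
      F (w i) (w (i.succAbove j)) (fun k => w (i.succAbove (j.succAbove k))) = 0 := by
  -- Linearity in the second argument is inherited from the first one by symmetry.
  let f : V →ₗ[ℝ] V →ₗ[ℝ] V [⋀^Fin p]→ₗ[ℝ] ℝ := LinearMap.mk₂ ℝ (fun x y => (hA x y).toMap)
    (fun x x' y => by ext w; simp [IsAlt.toMap_apply, hadd])
    (fun a x y => by ext w; simp [IsAlt.toMap_apply, hsmul])
    (fun x y y' => by ext w; simp [IsAlt.toMap_apply, hsymm x, hadd])
    (fun a x y => by ext w; simp [IsAlt.toMap_apply, hsymm x, hsmul])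
  have hf : ∀ x y, f x y = f y x := fun x y => by
    ext w
    simp [f, LinearMap.mk₂_apply, IsAlt.toMap_apply, hsymm x y]
  have := congrArg (fun A => A w)
    (AlternatingMap.alternatizeUncurryFin_alternatizeUncurryFinLM_comp_of_symmetric hf)
  simp only [AlternatingMap.alternatizeUncurryFin_apply, AlternatingMap.zero_apply,
    LinearMap.comp_apply] at this
  rw [← this]
  refine Finset.sum_congr rfl fun i _ => ?_
  rw [zsmul_eq_mul]
  push_cast
  congr 1
  change _ = (AlternatingMap.alternatizeUncurryFin (f (w i))) (i.removeNth w)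
  rw [AlternatingMap.alternatizeUncurryFin_apply]
  refine Finset.sum_congr rfl fun j _ => ?_
  rw [zsmul_eq_mul]
  push_cast
  congr 1
  exact ((hA _ _).toMap_apply _).symm

/-- Moving `w i` from the first slot back to its place costs exactly the sign `(-1) ^ i`, so all `p
+ 1` summands are equal. -/
theorem alternatization_cons {f : (Fin (p + 1) → V) → ℝ} (hf : IsAlt f) (w : Fin (p + 1) → V) :
    ∑ i : Fin (p + 1), (-1) ^ (i : ℕ) * f (Fin.cons (w i) (fun j => w (i.succAbove j))) =
      (p + 1) * f w := by
  obtain ⟨A, hA⟩ := hf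
  have := congrArg (fun B => B w) (AlternatingMap.alternatizeUncurryFin_curryLeft A)
  simp only [AlternatingMap.alternatizeUncurryFin_apply] at this
  rw [hA]
  simp only [AlternatingMap.smul_apply, nsmul_eq_mul] at this
  push_cast at this
  rw [← this]
  refine Finset.sum_congr rfl fun i _ => ?_
  rw [zsmul_eq_mul, hA]
  push_cast
  rfl

end Alternating

/-! ## Interpolation of polynomials -/

/-- The coefficients are row `v` of the inverse Vandermonde matrix with nodes `1, …, N`. The nodes
avoid zero because polynomial identities in the scaling parameter will be known only for nonzero
parameters. -/
theorem exists_interpolation (N : ℕ) (v : ℕ) (hv : v < N) :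
    ∃ a : Fin N → ℝ, ∀ c : ℕ → ℝ,
      ∑ k : Fin N, a k * ∑ u ∈ Finset.range N, ((k : ℕ) + 1 : ℝ) ^ u * c u = c v := by
  let W : Matrix (Fin N) (Fin N) ℝ := Matrix.vandermonde fun k : Fin N => ((k : ℕ) + 1 : ℝ)
  have hW : IsUnit W.det := by
    rw [isUnit_iff_ne_zero, Matrix.det_vandermonde_ne_zero_iff]
    intro i j hij
    simp only [add_left_inj, Nat.cast_inj] at hij
    exact Fin.ext hij
  refine ⟨fun k => W⁻¹ ⟨v, hv⟩ k, fun c => ?_⟩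
  have h := congrFun (Matrix.mulVec_mulVec (fun u : Fin N => c u) W⁻¹ W) ⟨v, hv⟩
  rw [Matrix.nonsing_inv_mul _ hW, Matrix.one_mulVec] at h
  simp only [Matrix.mulVec, dotProduct] at h
  rw [← h]
  refine Finset.sum_congr rfl fun k _ => ?_
  rw [Finset.sum_range]
  rfl

theorem coeff_eq_of_forall_ne_zero {N : ℕ} {a b : ℕ → ℝ}
    (h : ∀ t : ℝ, t ≠ 0 → ∑ u ∈ Finset.range N, t ^ u * a u = ∑ u ∈ Finset.range N, t ^ u * b u)
    {v : ℕ} (hv : v < N) : a v = b v := by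
  obtain ⟨c, hc⟩ := exists_interpolation N v hv
  rw [← hc a, ← hc b]
  exact Finset.sum_congr rfl fun k _ => by rw [h _ (by positivity)]

/-! ## Forms on the jet bundle -/

section Forms

variable {M : Type*} {n m : ℕ}

/-- `F` depends on finitely many jet coordinates of the point and of the tangent vectors. -/
def FinDep {p : ℕ} {β : Type*} (F : Jet M n m → (Fin p → Tan n m) → β) : Prop :=
  ∃ S : Finset (JetIdx n m), ∀ (x : M) (u u' : JetIdx n m → ℝ) (w w' : Fin p → Tan n m),
    (∀ c ∈ S, u c = u' c) →
    (∀ j, (w j).1 = (w' j).1 ∧ ∀ c ∈ S, (w j).2 c = (w' j).2 c) →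
    F (x, u) w = F (x, u') w'

theorem FinDep.pi {p : ℕ} {ι : Type*} [Finite ι] {β : ι → Type*}
    {F : ∀ i, Jet M n m → (Fin p → Tan n m) → β i} (hF : ∀ i, FinDep (F i)) :
    FinDep (fun q w i => F i q w) := by
  classical
  cases nonempty_fintype ι
  choose S hS using hF
  refine ⟨Finset.univ.biUnion S, fun x u u' w w' hu hw => funext fun i => hS i _ _ _ _ _
    (fun c hc => hu c ?_) fun j => ⟨(hw j).1, fun c hc => (hw j).2 c ?_⟩⟩ <;>
  exact Finset.mem_biUnion.2 ⟨i, Finset.mem_univ i, hc⟩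

theorem FinDep.map {p : ℕ} {β γ : Type*} {F : Jet M n m → (Fin p → Tan n m) → β} (hF : FinDep F)
    (φ : β → γ) : FinDep (fun q w => φ (F q w)) := by
  obtain ⟨S, hS⟩ := hF
  exact ⟨S, fun x u u' w w' hu hw => congrArg φ (hS x u u' w w' hu hw)⟩

theorem FinDep.prodMk {p : ℕ} {β γ : Type*} {F : Jet M n m → (Fin p → Tan n m) → β}
    {G : Jet M n m → (Fin p → Tan n m) → γ} (hF : FinDep F) (hG : FinDep G) :
    FinDep (fun q w => (F q w, G q w)) := by
  classical
  obtain ⟨S, hS⟩ := hF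
  obtain ⟨T, hT⟩ := hG
  refine ⟨S ∪ T, fun x u u' w w' hu hw => Prod.ext ?_ ?_⟩
  · exact hS _ _ _ _ _ (fun c hc => hu c (by simp [hc]))
      fun j => ⟨(hw j).1, fun c hc => (hw j).2 c (by simp [hc])⟩
  · exact hT _ _ _ _ _ (fun c hc => hu c (by simp [hc]))
      fun j => ⟨(hw j).1, fun c hc => (hw j).2 c (by simp [hc])⟩

theorem FinDep.sum {p : ℕ} {ι : Type*} [Fintype ι] {F : ι → Jet M n m → (Fin p → Tan n m) → ℝ}
    (hF : ∀ i, FinDep (F i)) : FinDep (fun q w => ∑ i, F i q w) :=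
  (FinDep.pi hF).map fun f => ∑ i, f i

theorem FinDep.mul {p : ℕ} {F G : Jet M n m → (Fin p → Tan n m) → ℝ}
    (hF : FinDep F) (hG : FinDep G) : FinDep (fun q w => F q w * G q w) :=
  (hF.prodMk hG).map fun z => z.1 * z.2

theorem FinDep.add {p : ℕ} {F G : Jet M n m → (Fin p → Tan n m) → ℝ}
    (hF : FinDep F) (hG : FinDep G) : FinDep (fun q w => F q w + G q w) :=
  (hF.prodMk hG).map fun z => z.1 + z.2

theorem FinDep.reindex {p p' : ℕ} {β : Type*} {F : Jet M n m → (Fin p → Tan n m) → β}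
    (hF : FinDep F) (σ : Fin p → Fin p') : FinDep (fun q w => F q (fun j => w (σ j))) := by
  obtain ⟨S, hS⟩ := hF
  exact ⟨S, fun x u u' w w' hu hw => hS _ _ _ _ _ hu fun j => hw (σ j)⟩

theorem finDep_fst {p : ℕ} (j : Fin p) :
    FinDep (fun (_ : Jet M n m) (w : Fin p → Tan n m) => (w j).1) :=
  ⟨∅, fun _ _ _ _ _ _ hw => (hw j).1⟩

theorem finDep_snd {p : ℕ} (j : Fin p) (c : JetIdx n m) :
    FinDep (fun (_ : Jet M n m) (w : Fin p → Tan n m) => (w j).2 c) :=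
  ⟨{c}, fun _ _ _ _ _ _ hw => (hw j).2 c (by simp)⟩

theorem finDep_coord {p : ℕ} (c : JetIdx n m) :
    FinDep (fun (q : Jet M n m) (_ : Fin p → Tan n m) => q.2 c) :=
  ⟨{c}, fun _ _ _ _ _ hu _ => hu c (by simp)⟩

theorem finDep_const {p : ℕ} {β : Type*} (b : β) :
    FinDep (fun (_ : Jet M n m) (_ : Fin p → Tan n m) => b) :=
  ⟨∅, fun _ _ _ _ _ _ _ => rfl⟩

/-- Substitution of tangent vectors whose components depend on finitely many coordinates. -/
theorem FinDep.comp {p p' : ℕ} {β : Type*} {F : Jet M n m → (Fin p → Tan n m) → β}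
    (hF : FinDep F) {Y : Fin p → Jet M n m → (Fin p' → Tan n m) → Tan n m}
    (h1 : ∀ j, FinDep (fun q w => (Y j q w).1)) (h2 : ∀ j c, FinDep (fun q w => (Y j q w).2 c)) :
    FinDep (fun q w => F q (fun j => Y j q w)) := by
  classical
  obtain ⟨S, hS⟩ := hF
  obtain ⟨T, hT⟩ := FinDep.pi h1
  obtain ⟨T', hT'⟩ := FinDep.pi fun j => FinDep.pi fun c : S => h2 j c
  refine ⟨S ∪ T ∪ T', fun x u u' w w' hu hw => hS _ _ _ _ _ (fun c hc => hu c (by simp [hc]))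
    fun j => ⟨?_, fun c hc => ?_⟩⟩
  · exact congrFun (hT x u u' w w' (fun c hc => hu c (by simp [hc]))
      fun j => ⟨(hw j).1, fun c hc => (hw j).2 c (by simp [hc])⟩) j
  · exact congrFun (congrFun (hT' x u u' w w' (fun c hc => hu c (by simp [hc]))
      fun j => ⟨(hw j).1, fun c hc => (hw j).2 c (by simp [hc])⟩) j) ⟨c, hc⟩

/-- The frame `∂/∂xⁱ, ∂/∂u^a_I`. -/
def frame : Fin n ⊕ JetIdx n m → Tan n m := by
  classical
  exact Sum.elim (fun i => (EuclideanSpace.single i 1, 0)) (fun c => (0, Pi.single c 1))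

/-- The components of a tangent vector in the frame. -/
def comp (w : Tan n m) : Fin n ⊕ JetIdx n m → ℝ := Sum.elim (fun i => w.1 i) w.2

/-- The truncation of a tangent vector to finitely many components. -/
def trunc (S : Finset (JetIdx n m)) (w : Tan n m) : Tan n m :=
  ∑ b : Fin n ⊕ S, comp w (b.map id Subtype.val) • frame (b.map id Subtype.val)

theorem trunc_fst (S : Finset (JetIdx n m)) (w : Tan n m) : (trunc S w).1 = w.1 := by
  ext k
  simp [trunc, comp, frame, Prod.fst_sum, Fintype.sum_sum_type, Finset.sum_apply,
    Pi.single_apply]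

theorem trunc_snd {S : Finset (JetIdx n m)} (w : Tan n m) {c : JetIdx n m} (hc : c ∈ S) :
    (trunc S w).2 c = w.2 c := by
  simp only [trunc, comp, frame, Prod.snd_sum, Fintype.sum_sum_type, Sum.map_inl, Sum.map_inr,
    Sum.elim_inl, Sum.elim_inr, Prod.snd_add, Pi.add_apply, Finset.sum_apply, Prod.smul_snd,
    smul_zero, Pi.zero_apply, Finset.sum_const_zero, zero_add, Pi.smul_apply, smul_eq_mul]
  rw [Finset.sum_eq_single ⟨c, hc⟩]
  · simp
  · intro b _ hb
    rw [Pi.single_eq_of_ne, mul_zero]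
    intro h
    exact hb (Subtype.ext h.symm)
  · simp

end Forms

/-! ### Smooth forms, covector fields and contractions -/

section Forms

variable {M : Type*} [TopologicalSpace M] {n m : ℕ} [ChartedSpace (EuclideanSpace ℝ (Fin n)) M]

theorem IsForm.isAlt {p : ℕ} {α : PreForm M n m p} (h : IsForm α) (q : Jet M n m) :
    IsAlt (α q) := h.1 q

theorem IsForm.finDep {p : ℕ} {α : PreForm M n m p} (h : IsForm α) : FinDep α := h.2.1

theorem IsForm.isSmooth {p : ℕ} {α : PreForm M n m p} (h : IsForm α) (w : Fin p → Tan n m) :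
    IsSmooth (fun q => α q w) := h.2.2 w

/-- A form evaluated on smooth vector fields is a smooth function. -/
theorem IsForm.isSmooth_apply {p : ℕ} {α : PreForm M n m p} (hα : IsForm α)
    {Y : Fin p → Jet M n m → Tan n m} (h1 : ∀ j i, IsSmooth (fun q => (Y j q).1 i))
    (h2 : ∀ j c, IsSmooth (fun q => (Y j q).2 c)) : IsSmooth (fun q => α q (fun j => Y j q)) := by
  obtain ⟨S, hS⟩ := hα.finDep
  -- Truncating the arguments to the components that `α` sees makes the multilinear expansion in the
  -- constant frame a finite sum.
  have key : ∀ q, α q (fun j => Y j q) = ∑ r : Fin p → Fin n ⊕ S,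
      (∏ j, comp (Y j q) ((r j).map id Subtype.val)) *
        α q (fun j => frame ((r j).map id Subtype.val)) := by
    intro q
    have : α q (fun j => Y j q) = α q (fun j => trunc S (Y j q)) :=
      hS q.1 q.2 q.2 _ _ (fun _ _ => rfl)
        fun j => ⟨(trunc_fst S _).symm, fun c hc => (trunc_snd _ hc).symm⟩
    obtain ⟨A, hA⟩ := hα.isAlt q
    rw [this, hA]
    simp only [trunc]
    refine (A.toMultilinearMap.map_sum _).trans (Finset.sum_congr rfl fun r _ => ?_)
    rw [hA]
    exact A.toMultilinearMap.map_smul_univ _ _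
  simp only [key]
  refine isSmooth_sum _ fun r _ => (isSmooth_prod _ fun j _ => ?_).mul (hα.isSmooth _)
  rcases r j with i | c
  · exact h1 j i
  · exact h2 j c

theorem isForm_zero {p : ℕ} : IsForm (0 : PreForm M n m p) :=
  ⟨fun _ => isAlt_zero, finDep_const 0, fun _ => isSmooth_const 0⟩

theorem IsForm.add {p : ℕ} {α β : PreForm M n m p} (hα : IsForm α) (hβ : IsForm β) :
    IsForm (α + β) :=
  ⟨fun q => (hα.isAlt q).add (hβ.isAlt q), hα.finDep.add hβ.finDep,
    fun w => (hα.isSmooth w).add (hβ.isSmooth w)⟩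

theorem IsSmooth.finDep {g : Jet M n m → ℝ} (hg : IsSmooth g) {p : ℕ} :
    FinDep (fun q (_ : Fin p → Tan n m) => g q) := by
  obtain ⟨S, hS⟩ := hg
  exact ⟨S, fun x u u' _ _ hu _ => SmoothWith.congr_of_eqOn hS hu⟩

/-- The product of a function and a form. -/
def fmul {p : ℕ} (g : Jet M n m → ℝ) (α : PreForm M n m p) : PreForm M n m p :=
  fun q w => g q * α q w

theorem IsForm.fmul {p : ℕ} {g : Jet M n m → ℝ} (hg : IsSmooth g) {α : PreForm M n m p}
    (hα : IsForm α) : IsForm (fmul g α) :=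
  ⟨fun q => (hα.isAlt q).const_mul (g q), hg.finDep.mul hα.finDep,
    fun w => hg.mul (hα.isSmooth w)⟩

theorem IsForm.const_smul {p : ℕ} (a : ℝ) {α : PreForm M n m p} (hα : IsForm α) :
    IsForm (a • α) := IsForm.fmul (isSmooth_const a) hα

theorem IsForm.neg {p : ℕ} {α : PreForm M n m p} (hα : IsForm α) : IsForm (-α) := by
  simpa using hα.const_smul (-1)

theorem IsForm.sub {p : ℕ} {α β : PreForm M n m p} (hα : IsForm α) (hβ : IsForm β) :
    IsForm (α - β) := by
  simpa [sub_eq_add_neg] using hα.add hβ.neg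

theorem isForm_sum {p : ℕ} {ι : Type*} (s : Finset ι) {α : ι → PreForm M n m p}
    (hα : ∀ i ∈ s, IsForm (α i)) : IsForm (∑ i ∈ s, α i) := by
  classical
  induction s using Finset.induction_on with
  | empty => simpa using isForm_zero
  | insert a s ha ih =>
    rw [Finset.sum_insert ha]
    exact (hα a (by simp)).add (ih fun i hi => hα i (by simp [hi]))

/-- A covector field with smooth coefficients. -/
structure IsCovector (l : Jet M n m → Tan n m → ℝ) : Prop where
  map_add : ∀ q v w, l q (v + w) = l q v + l q w
  map_smul : ∀ q (a : ℝ) w, l q (a • w) = a * l q w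
  finDep : FinDep (fun q (w : Fin 1 → Tan n m) => l q (w 0))
  isSmooth : ∀ w, IsSmooth (fun q => l q w)

/-- The wedge product of a covector field and a form. -/
def wedge {p : ℕ} (l : Jet M n m → Tan n m → ℝ) (γ : PreForm M n m p) : PreForm M n m (p + 1) :=
  fun q w => ∑ i : Fin (p + 1),
    (-1) ^ (i : ℕ) * (l q (w i) * γ q (fun j => w (i.succAbove j)))

theorem IsForm.wedge {p : ℕ} {l : Jet M n m → Tan n m → ℝ} (hl : IsCovector l)
    {γ : PreForm M n m p} (hγ : IsForm γ) : IsForm (wedge l γ) := by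
  refine ⟨fun q => ?_, ?_, fun w => ?_⟩
  · exact isAlt_alternatization (F := fun x w => l q x * γ q w)
      (fun x => (hγ.isAlt q).const_mul _) (fun x y w => by rw [hl.map_add]; ring)
      (fun a x w => by rw [hl.map_smul]; ring)
  · exact FinDep.sum fun i => (finDep_const _).mul
      ((hl.finDep.reindex fun _ => i).mul (hγ.finDep.reindex _))
  · exact isSmooth_sum _ fun i _ => ((hl.isSmooth _).mul (hγ.isSmooth _)).const_mul _

/-- The covector field `dxⁱ`. -/
def dx (i : Fin n) : Jet M n m → Tan n m → ℝ := fun _ w => w.1 i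

/-- The contact covector field `d_v u^a_I`. -/
def contact (c : JetIdx n m) : Jet M n m → Tan n m → ℝ := fun q w => (vert q w).2 c

theorem isCovector_dx (i : Fin n) : IsCovector (dx i : Jet M n m → Tan n m → ℝ) where
  map_add _ _ _ := rfl
  map_smul _ _ _ := rfl
  finDep := (finDep_fst 0).map fun z => z i
  isSmooth _ := isSmooth_const _

omit [TopologicalSpace M] [ChartedSpace (EuclideanSpace ℝ (Fin n)) M] in
theorem contact_apply (c : JetIdx n m) (q : Jet M n m) (w : Tan n m) :
    contact c q w = w.2 c - ∑ i, w.1 i * q.2 (c.succ i) := rfl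

theorem isCovector_contact (c : JetIdx n m) :
    IsCovector (contact c : Jet M n m → Tan n m → ℝ) where
  map_add q v w := by
    simp only [contact_apply, Prod.fst_add, Prod.snd_add, Pi.add_apply, PiLp.add_apply, add_mul,
      Finset.sum_add_distrib]
    ring
  map_smul q a w := by
    simp only [contact_apply, Prod.smul_fst, Prod.smul_snd, Pi.smul_apply, PiLp.smul_apply,
      smul_eq_mul, mul_assoc, mul_sub, Finset.mul_sum]
  finDep := ((finDep_snd 0 c).prodMk ((finDep_fst 0).prodMk
    (FinDep.pi fun i => finDep_coord (c.succ i)))).map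
      fun z => z.1 - ∑ i, z.2.1 i * z.2.2 i
  isSmooth w := by
    simp only [contact_apply, sub_eq_add_neg]
    exact (isSmooth_const _).add
      (isSmooth_sum _ fun i _ => (isSmooth_coord _).const_mul _).neg

/-- The contraction of a form with a vector field. -/
def contr {p : ℕ} (Y : Jet M n m → Tan n m) (α : PreForm M n m (p + 1)) : PreForm M n m p :=
  fun q w => α q (Fin.cons (Y q) w)

theorem IsForm.contr {p : ℕ} {α : PreForm M n m (p + 1)} (hα : IsForm α)
    {Y : Jet M n m → Tan n m} (h0 : FinDep (fun q (_ : Fin p → Tan n m) => (Y q).1))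
    (h1 : ∀ i, IsSmooth (fun q => (Y q).1 i)) (h2 : ∀ c, IsSmooth (fun q => (Y q).2 c)) :
    IsForm (contr Y α) := by
  refine ⟨fun q => (hα.isAlt q).cons (Y q), ?_, fun w => ?_⟩
  · refine hα.finDep.comp (Y := fun j q w => (Fin.cons (Y q) w : Fin (p + 1) → Tan n m) j) ?_ ?_
    · exact Fin.cases h0 fun j => finDep_fst j
    · exact Fin.cases (fun c => (h2 c).finDep) fun j c => finDep_snd j c
  · refine hα.isSmooth_apply (Y := fun j q => (Fin.cons (Y q) w : Fin (p + 1) → Tan n m) j) ?_ ?_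
    · exact Fin.cases h1 fun j i => isSmooth_const ((w j).1 i)
    · exact Fin.cases h2 fun j c => isSmooth_const ((w j).2 c)

-- Contraction is an antiderivation: the summand with index zero feeds `Y` to `l`, while in the
-- others `Y` stays in the first slot of `γ` and the index shift produces the sign.
omit [TopologicalSpace M] [ChartedSpace (EuclideanSpace ℝ (Fin n)) M] in
theorem contr_wedge {p : ℕ} (Y : Jet M n m → Tan n m) (l : Jet M n m → Tan n m → ℝ)
    (γ : PreForm M n m (p + 1)) :
    contr Y (wedge l γ) = fmul (fun q => l q (Y q)) γ - wedge l (contr Y γ) := by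
  funext q w
  simp only [contr, wedge, fmul, Pi.sub_apply]
  rw [Fin.sum_univ_succ]
  simp only [Fin.val_zero, pow_zero, one_mul, Fin.cons_zero, Fin.succAbove_zero, Fin.cons_succ,
    Fin.val_succ, pow_succ, sub_eq_add_neg, ← Finset.sum_neg_distrib]
  congr 1
  refine Finset.sum_congr rfl fun i _ => ?_
  have : (fun j => (Fin.cons (Y q) w : Fin (p + 1 + 1) → Tan n m) (i.succ.succAbove j)) =
      Fin.cons (Y q) (fun j => w (i.succAbove j)) := by
    funext j
    refine Fin.cases ?_ (fun j => ?_) j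
    · simp
    · simp [Fin.succ_succAbove_succ]
  rw [this]
  ring

end Forms

/-! ## The exterior differential -/

section ExtD

variable {M : Type*} [TopologicalSpace M] {n m : ℕ} [ChartedSpace (EuclideanSpace ℝ (Fin n)) M]
  {X : M → EuclideanSpace ℝ (Fin n)}

/-- The superfluous coordinates can be frozen at zero without changing `g`. -/
theorem IsSmooth.smoothWith {g : Jet M n m → ℝ} (hg : IsSmooth g) {S : Finset (JetIdx n m)}
    (h : ∀ x u u', (∀ c ∈ S, u c = u' c) → g (x, u) = g (x, u')) : SmoothWith S g := by
  obtain ⟨T, G, hG, hg⟩ := hg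
  refine ⟨fun z => G (z.1, fun c => extendZero S z.2 c), ?_, fun x u => ?_⟩
  · refine hG.comp (contMDiff_fst.prodMk ?_)
    have : ContMDiff 𝓘(ℝ, S → ℝ) 𝓘(ℝ, T → ℝ) ∞
        (fun y : S → ℝ => fun c : T => extendZero S y c) := by
      rw [contMDiff_iff_contDiff, contDiff_pi]
      intro c
      by_cases hc : (c : JetIdx n m) ∈ S
      · simp only [extendZero, hc, dite_true]
        fun_prop
      · simp only [extendZero, hc, dite_false]
        fun_prop
    exact this.comp contMDiff_snd
  · refine Eq.trans (h _ _ (extendZero S fun c : S => u c) ?_) (hg _ _)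
    exact fun c hc => (extendZero_apply (fun c : S => u c) ⟨c, hc⟩).symm

variable (hX : IsLocalDiffeomorph (𝓡 n) 𝓘(ℝ, EuclideanSpace ℝ (Fin n)) ∞ X)
include hX

theorem isCovector_dirDeriv {g : Jet M n m → ℝ} (hg : IsSmooth g) :
    IsCovector (dirDeriv X g) where
  map_add := dirDeriv_add_right hX hg
  map_smul := dirDeriv_smul_right hX hg
  isSmooth := IsSmooth.dirDeriv hX hg
  finDep := by
    obtain ⟨S, hS⟩ := hg
    exact ⟨S, fun x u u' w w' hu hw =>
      SmoothWith.dirDeriv_congr hX hS x hu (hw 0).1 (hw 0).2⟩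

theorem isAlt_dirDeriv {p : ℕ} {α : PreForm M n m p} (hα : IsForm α) (q : Jet M n m)
    (v : Tan n m) : IsAlt (fun w => dirDeriv X (fun q' => α q' w) q v) := by
  refine ⟨{ toFun := fun w => dirDeriv X (fun q' => α q' w) q v
            map_update_add' := ?_
            map_update_smul' := ?_
            map_eq_zero_of_eq' := ?_ }, fun _ => rfl⟩
  · intro inst w i a b
    rw [← dirDeriv_add hX (hα.isSmooth _) (hα.isSmooth _)]
    congr 1
    funext q'
    obtain ⟨A, hA⟩ := hα.isAlt q'
    simp only [hA, A.map_update_add]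
  · intro inst w i a b
    rw [smul_eq_mul, ← dirDeriv_const_mul hX a (hα.isSmooth _)]
    congr 1
    funext q'
    obtain ⟨A, hA⟩ := hα.isAlt q'
    simp only [hA, A.map_update_smul, smul_eq_mul]
  · intro w i j hij hne
    rw [← dirDeriv_const hX 0 q v]
    congr 1
    funext q'
    obtain ⟨A, hA⟩ := hα.isAlt q'
    rw [hA, A.map_eq_zero_of_eq w hij hne]

theorem IsForm.extD {p : ℕ} {α : PreForm M n m p} (hα : IsForm α) : IsForm (extD X α) := by
  refine ⟨fun q => ?_, ?_, fun w => ?_⟩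
  · exact isAlt_alternatization (F := fun v w => dirDeriv X (fun q' => α q' w) q v)
      (isAlt_dirDeriv hX hα q) (fun x y w => dirDeriv_add_right hX (hα.isSmooth w) q x y)
      (fun a x w => dirDeriv_smul_right hX (hα.isSmooth w) q a x)
  · refine FinDep.sum (F := fun (i : Fin (p + 1)) q w => (-1) ^ (i : ℕ) *
      dirDeriv X (fun q' => α q' (fun j => w (i.succAbove j))) q (w i))
      fun i => (finDep_const _).mul ?_
    obtain ⟨S, hS⟩ := hα.finDep
    refine ⟨S, fun x u u' w w' hu hw => ?_⟩
    have e : (fun q' => α q' fun j => w' (i.succAbove j)) =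
        fun q' => α q' fun j => w (i.succAbove j) :=
      funext fun q' => hS q'.1 q'.2 q'.2 _ _ (fun _ _ => rfl) fun j =>
        ⟨(hw _).1.symm, fun c hc => ((hw _).2 c hc).symm⟩
    simp only [e]
    exact SmoothWith.dirDeriv_congr hX ((hα.isSmooth _).smoothWith fun x u u' hu =>
      hS x u u' _ _ hu fun _ => ⟨rfl, fun _ _ => rfl⟩) x hu (hw i).1 (hw i).2
  · exact isSmooth_sum _ fun i _ => (IsSmooth.dirDeriv hX (hα.isSmooth _) _).const_mul _

theorem extD_add {p : ℕ} {α β : PreForm M n m p} (hα : IsForm α) (hβ : IsForm β) :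
    extD X (α + β) = extD X α + extD X β := by
  funext q w
  simp only [extD, Pi.add_apply, ← Finset.sum_add_distrib, ← mul_add]
  exact Finset.sum_congr rfl fun i _ => by rw [dirDeriv_add hX (hα.isSmooth _) (hβ.isSmooth _)]

theorem extD_zero {p : ℕ} : extD X (0 : PreForm M n m p) = 0 := by
  funext q w
  simp only [extD, Pi.zero_apply]
  exact Finset.sum_eq_zero fun i _ => by rw [dirDeriv_const hX, mul_zero]

theorem extD_fmul {p : ℕ} {g : Jet M n m → ℝ} (hg : IsSmooth g) {α : PreForm M n m p}
    (hα : IsForm α) : extD X (fmul g α) = wedge (dirDeriv X g) α + fmul g (extD X α) := by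
  funext q w
  simp only [extD, fmul, wedge, Pi.add_apply, Finset.mul_sum, ← Finset.sum_add_distrib]
  refine Finset.sum_congr rfl fun i _ => ?_
  rw [dirDeriv_mul hX hg (hα.isSmooth _)]
  ring

theorem extD_smul {p : ℕ} (a : ℝ) {α : PreForm M n m p} (hα : IsForm α) :
    extD X (a • α) = a • extD X α := by
  funext q w
  simp only [extD, Pi.smul_apply, smul_eq_mul, Finset.mul_sum]
  refine Finset.sum_congr rfl fun i _ => ?_
  rw [dirDeriv_const_mul hX a (hα.isSmooth _)]
  ring

theorem extD_neg {p : ℕ} {α : PreForm M n m p} (hα : IsForm α) :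
    extD X (-α) = -extD X α := by
  simpa using extD_smul hX (-1) hα

theorem extD_sub {p : ℕ} {α β : PreForm M n m p} (hα : IsForm α) (hβ : IsForm β) :
    extD X (α - β) = extD X α - extD X β := by
  rw [sub_eq_add_neg, extD_add hX hα hβ.neg, extD_neg hX hβ, sub_eq_add_neg]

theorem extD_sum {p : ℕ} {ι : Type*} (s : Finset ι) {α : ι → PreForm M n m p}
    (hα : ∀ i ∈ s, IsForm (α i)) : extD X (∑ i ∈ s, α i) = ∑ i ∈ s, extD X (α i) := by
  classical
  induction s using Finset.induction_on with
  | empty => simpa using extD_zero hX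
  | insert a s ha ih =>
    have h : ∀ i ∈ s, IsForm (α i) := fun i hi => hα i (by simp [hi])
    rw [Finset.sum_insert ha, Finset.sum_insert ha, extD_add hX (hα a (by simp)) (isForm_sum s h),
      ih h]

/-- This is the double alternation of the second derivatives, which are symmetric in the two
directions of differentiation. -/
theorem extD_extD {p : ℕ} {α : PreForm M n m p} (hα : IsForm α) : extD X (extD X α) = 0 := by
  funext q w
  have h := alternatization_symm_eq_zero
    (F := fun x y w => dirDeriv X (fun q' => dirDeriv X (fun q'' => α q'' w) q' y) q x) (p := p)
    (fun x y => ?_) (fun x x' y w => dirDeriv_add_right hX (IsSmooth.dirDeriv hX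
      (hα.isSmooth w) y) q x x') (fun a x y w => dirDeriv_smul_right hX (IsSmooth.dirDeriv hX
      (hα.isSmooth w) y) q a x) (fun x y w => dirDeriv_comm hX (hα.isSmooth w) q y x) w
  · simp only [Pi.zero_apply]
    rw [← h, extD]
    refine Finset.sum_congr rfl fun i _ => ?_
    congr 1
    simp only [extD]
    rw [dirDeriv_sum hX _ fun j _ => (IsSmooth.dirDeriv hX (hα.isSmooth _) _).const_mul _]
    exact Finset.sum_congr rfl fun j _ =>
      dirDeriv_const_mul hX _ (IsSmooth.dirDeriv hX (hα.isSmooth _) _) q _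
  · have hf : IsForm (fun q' w => dirDeriv X (fun q'' => α q'' w) q' y) := by
      refine ⟨fun q' => isAlt_dirDeriv hX hα q' y, ?_, fun w => IsSmooth.dirDeriv hX
        (hα.isSmooth w) y⟩
      obtain ⟨S, hS⟩ := hα.finDep
      refine ⟨S, fun x u u' w w' hu hw => ?_⟩
      have e : (fun q' => α q' w') = fun q' => α q' w :=
        funext fun q' => hS q'.1 q'.2 q'.2 _ _ (fun _ _ => rfl) fun j =>
          ⟨(hw _).1.symm, fun c hc => ((hw _).2 c hc).symm⟩
      simp only [e]
      exact SmoothWith.dirDeriv_congr hX ((hα.isSmooth _).smoothWith fun x u u' hu =>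
        hS x u u' _ _ hu fun _ => ⟨rfl, fun _ _ => rfl⟩) x hu rfl fun _ _ => rfl
    exact isAlt_dirDeriv hX hf q x

-- The sum of the two products is the double alternation of the symmetric expression `k x * l y + l
-- x * k y`.
omit hX in
theorem wedge_wedge {p : ℕ} {k l : Jet M n m → Tan n m → ℝ} (hk : IsCovector k)
    (hl : IsCovector l) {γ : PreForm M n m p} (hγ : IsForm γ) :
    wedge k (wedge l γ) = -wedge l (wedge k γ) := by
  funext q w
  rw [Pi.neg_apply, Pi.neg_apply, eq_neg_iff_add_eq_zero]
  rw [← alternatization_symm_eq_zero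
    (F := fun x y w => (k q x * l q y + l q x * k q y) * γ q w) (p := p)
    (fun x y => (hγ.isAlt q).const_mul _)
    (fun x x' y w => by rw [hk.map_add, hl.map_add]; ring)
    (fun a x y w => by rw [hk.map_smul, hl.map_smul]; ring)
    (fun x y w => by ring) w]
  simp only [wedge, ← Finset.sum_add_distrib, Finset.mul_sum]
  refine Finset.sum_congr rfl fun i _ => Finset.sum_congr rfl fun j _ => ?_
  ring

/-- The difference of the two sides is again a double alternation of a symmetric expression: the
second derivative of `g` is symmetric, and the two products of first derivatives are exchanged. -/
theorem extD_wedge_dirDeriv {p : ℕ} {g : Jet M n m → ℝ} (hg : IsSmooth g) {γ : PreForm M n m p}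
    (hγ : IsForm γ) :
    extD X (wedge (dirDeriv X g) γ) = -wedge (dirDeriv X g) (extD X γ) := by
  funext q w
  rw [Pi.neg_apply, Pi.neg_apply, eq_neg_iff_add_eq_zero]
  rw [← alternatization_symm_eq_zero
    (F := fun x y w => dirDeriv X g q y * dirDeriv X (fun q' => γ q' w) q x +
      dirDeriv X (fun q' => dirDeriv X g q' y) q x * γ q w +
      dirDeriv X g q x * dirDeriv X (fun q' => γ q' w) q y) (p := p)
    (fun x y => (((isAlt_dirDeriv hX hγ q x).const_mul _).add
      ((hγ.isAlt q).const_mul _)).add ((isAlt_dirDeriv hX hγ q y).const_mul _))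
    (fun x x' y w => by
      rw [dirDeriv_add_right hX (hγ.isSmooth w), dirDeriv_add_right hX hg,
        dirDeriv_add_right hX (IsSmooth.dirDeriv hX hg y)]
      ring)
    (fun a x y w => by
      rw [dirDeriv_smul_right hX (hγ.isSmooth w), dirDeriv_smul_right hX hg,
        dirDeriv_smul_right hX (IsSmooth.dirDeriv hX hg y)]
      ring)
    (fun x y w => by
      rw [dirDeriv_comm hX hg q y x]
      ring) w]
  simp only [wedge, extD]
  rw [← Finset.sum_add_distrib]
  refine Finset.sum_congr rfl fun i _ => ?_
  rw [dirDeriv_sum hX _ fun j _ =>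
    ((IsSmooth.dirDeriv hX hg _).mul (hγ.isSmooth _)).const_mul _, ← mul_add, Finset.mul_sum,
    ← Finset.sum_add_distrib]
  congr 1
  refine Finset.sum_congr rfl fun j _ => ?_
  rw [dirDeriv_const_mul hX _ ((IsSmooth.dirDeriv hX hg _).mul (hγ.isSmooth _)),
    dirDeriv_mul hX (IsSmooth.dirDeriv hX hg _) (hγ.isSmooth _)]
  ring

end ExtD

/-! ### Algebra of wedge products and function multiples -/

section WedgeAlgebra

variable {M : Type*} {n m p : ℕ}

theorem wedge_add_right (l : Jet M n m → Tan n m → ℝ) (α β : PreForm M n m p) :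
    wedge l (α + β) = wedge l α + wedge l β := by
  funext q w
  simp only [wedge, Pi.add_apply, mul_add, Finset.sum_add_distrib]

theorem wedge_fmul_right (l : Jet M n m → Tan n m → ℝ) (g : Jet M n m → ℝ)
    (α : PreForm M n m p) : wedge l (fmul g α) = fmul g (wedge l α) := by
  funext q w
  simp only [wedge, fmul, Finset.mul_sum]
  exact Finset.sum_congr rfl fun i _ => by ring

theorem wedge_smul_right (l : Jet M n m → Tan n m → ℝ) (a : ℝ)
    (α : PreForm M n m p) : wedge l (a • α) = a • wedge l α :=
  wedge_fmul_right l (fun _ => a) α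

theorem wedge_zero_right (l : Jet M n m → Tan n m → ℝ) :
    wedge l (0 : PreForm M n m p) = 0 := by
  funext q w
  simp [wedge]

theorem wedge_add_left (k l : Jet M n m → Tan n m → ℝ) (α : PreForm M n m p) :
    wedge (fun q w => k q w + l q w) α = wedge k α + wedge l α := by
  funext q w
  simp only [wedge, Pi.add_apply, mul_add, add_mul, Finset.sum_add_distrib]

theorem wedge_fmul_left (g : Jet M n m → ℝ) (l : Jet M n m → Tan n m → ℝ)
    (α : PreForm M n m p) : wedge (fun q w => g q * l q w) α = fmul g (wedge l α) := by
  funext q w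
  simp only [wedge, fmul, Finset.mul_sum]
  exact Finset.sum_congr rfl fun i _ => by ring

theorem wedge_sum_left {ι : Type*} (s : Finset ι) (l : ι → Jet M n m → Tan n m → ℝ)
    (α : PreForm M n m p) :
    wedge (fun q w => ∑ i ∈ s, l i q w) α = ∑ i ∈ s, wedge (l i) α := by
  funext q w
  simp only [wedge, Finset.sum_apply, Finset.sum_mul, Finset.mul_sum]
  rw [Finset.sum_comm]

theorem fmul_add (g : Jet M n m → ℝ) (α β : PreForm M n m p) :
    fmul g (α + β) = fmul g α + fmul g β := by
  funext q w
  simp only [fmul, Pi.add_apply, mul_add]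

theorem fmul_neg (g : Jet M n m → ℝ) (α : PreForm M n m p) : fmul g (-α) = -fmul g α := by
  funext q w
  simp only [fmul, Pi.neg_apply, mul_neg]

end WedgeAlgebra

/-! ## The bigrading -/

section Grading

variable {M : Type*} {n m p : ℕ}

/-- Rescaling of the vertical part of a tangent vector. -/
def vscale (t : ℝ) (q : Jet M n m) : Tan n m →ₗ[ℝ] Tan n m where
  toFun w := hor q w + t • vert q w
  map_add' v w := by
    refine Prod.ext ?_ (funext fun c => ?_)
    · simp [hor, vert]
    · simp only [hor, vert, Prod.fst_add, Prod.snd_add, Prod.snd_sub, Prod.smul_snd, Pi.add_apply,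
        Pi.sub_apply, Pi.smul_apply, smul_eq_mul, PiLp.add_apply, add_mul, Finset.sum_add_distrib]
      ring
  map_smul' a w := by
    refine Prod.ext ?_ (funext fun c => ?_)
    · simp [hor, vert]
    · simp only [hor, vert, Prod.smul_fst, Prod.snd_add, Prod.snd_sub, Prod.smul_snd, Pi.add_apply,
        Pi.sub_apply, Pi.smul_apply, smul_eq_mul, PiLp.smul_apply, mul_assoc, ← Finset.mul_sum,
        RingHom.id_apply]
      ring

theorem vscale_apply (t : ℝ) (q : Jet M n m) (w : Tan n m) :
    vscale t q w = hor q w + t • vert q w := rfl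

theorem vscale_fst (t : ℝ) (q : Jet M n m) (w : Tan n m) : (vscale t q w).1 = w.1 := by
  simp [vscale_apply, hor, vert]

theorem vscale_snd (t : ℝ) (q : Jet M n m) (w : Tan n m) (c : JetIdx n m) :
    (vscale t q w).2 c = t * w.2 c + (1 - t) * ∑ i, w.1 i * q.2 (c.succ i) := by
  simp only [vscale_apply, hor, vert, Prod.snd_add, Prod.snd_sub, Prod.smul_snd, Pi.add_apply,
    Pi.sub_apply, Pi.smul_apply, smul_eq_mul]
  ring

theorem vscale_vscale (s t : ℝ) (q : Jet M n m) (w : Tan n m) :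
    vscale s q (vscale t q w) = vscale (s * t) q w := by
  refine Prod.ext ?_ (funext fun c => ?_)
  · simp only [vscale_fst]
  · simp only [vscale_snd, vscale_fst]
    ring

theorem hor_eq_vscale (q : Jet M n m) (w : Tan n m) : hor q w = vscale 0 q w := by
  simp [vscale_apply]

theorem contact_vscale (c : JetIdx n m) (t : ℝ) (q : Jet M n m) (w : Tan n m) :
    contact c q (vscale t q w) = t * contact c q w := by
  simp only [contact, vert, hor, Prod.snd_sub, Pi.sub_apply, vscale_snd, vscale_fst]
  ring

/-- The pullback of a form by `vscale t`: multiplication by `t ^ v` on forms of vertical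
degree `v`. -/
def scale (t : ℝ) (α : PreForm M n m p) : PreForm M n m p :=
  fun q w => α q (fun j => vscale t q (w j))

theorem scale_wedge (t : ℝ) (l : Jet M n m → Tan n m → ℝ) (γ : PreForm M n m p) :
    scale t (wedge l γ) = wedge (fun q w => l q (vscale t q w)) (scale t γ) := rfl

theorem scale_wedge_contact (t : ℝ) (c : JetIdx n m) (γ : PreForm M n m p) :
    scale t (wedge (contact c) γ) = t • wedge (contact c) (scale t γ) := by
  rw [scale_wedge]
  simp only [contact_vscale]
  exact wedge_fmul_left (fun _ => t) _ _

theorem scale_wedge_dx (t : ℝ) (i : Fin n) (γ : PreForm M n m p) :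
    scale t (wedge (dx i) γ) = wedge (dx i) (scale t γ) := by
  rw [scale_wedge]
  simp only [dx, vscale_fst]
  rfl

/-- Multilinear expansion of `hor + t • vert` in every slot: a set `s` of vertical slots contributes
`t ^ s.card`. Components beyond the degree are zero, so any `N > p` will do. -/
theorem scale_eq_sum {α : PreForm M n m p} (hα : ∀ q, IsAlt (α q)) (t : ℝ) {N : ℕ}
    (hN : p < N) : scale t α = ∑ v ∈ Finset.range N, t ^ v • vcomp v α := by
  classical
  have hz : ∀ v, p < v → vcomp v α = 0 := fun v hv => by
    funext q w
    rw [vcomp, Finset.powersetCard_eq_empty.2 (by simpa using hv)]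
    simp
  have hs : ∑ v ∈ Finset.range N, t ^ v • vcomp v α =
      ∑ v ∈ Finset.range (p + 1), t ^ v • vcomp v α := by
    refine (Finset.sum_subset (Finset.range_mono hN) fun v _ hv => ?_).symm
    rw [hz v (by simpa using hv), smul_zero]
  rw [hs]
  funext q w
  obtain ⟨A, hA⟩ := hα q
  have h1 : scale t α q w = A ((fun j => t • vert q (w j)) + fun j => hor q (w j)) := by
    rw [scale, hA]
    congr 1
    funext j
    exact add_comm _ _
  have h2 := A.toMultilinearMap.map_add_univ (fun j => t • vert q (w j)) fun j => hor q (w j)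
  rw [h1]
  refine h2.trans ?_
  rw [← Finset.powerset_univ, Finset.sum_powerset, Finset.card_univ, Fintype.card_fin]
  simp only [Finset.sum_apply, Pi.smul_apply, smul_eq_mul, vcomp, Finset.mul_sum]
  refine Finset.sum_congr rfl fun v _ => Finset.sum_congr ?_ fun s hs => ?_
  · rfl
  · have h3 := A.toMultilinearMap.map_piecewise_smul (fun _ => t)
      (s.piecewise (fun j => vert q (w j)) fun j => hor q (w j)) s
    rw [Finset.prod_const, (Finset.mem_powersetCard.1 hs).2, smul_eq_mul] at h3
    have h4 : (s.piecewise (fun j => t • vert q (w j)) fun j => hor q (w j)) =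
        s.piecewise (fun i => t • (s.piecewise (fun j => vert q (w j)) fun j => hor q (w j)) i)
          (s.piecewise (fun j => vert q (w j)) fun j => hor q (w j)) := by
      funext j
      by_cases hj : j ∈ s <;> simp [hj]
    rw [h4, h3, hA]
    congr 2

theorem vcomp_eq_zero_of_lt (α : PreForm M n m p) {v : ℕ} (hv : p < v) : vcomp v α = 0 := by
  funext q w
  rw [vcomp, Finset.powersetCard_eq_empty.2 (by simpa using hv)]
  simp

/-- The vertical components are linear combinations of rescalings. -/
theorem exists_vcomp_eq_sum (p v : ℕ) : ∃ (N : ℕ) (a : Fin N → ℝ),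
    ∀ α : PreForm M n m p, (∀ q, IsAlt (α q)) →
      vcomp v α = ∑ k : Fin N, a k • scale ((k : ℕ) + 1 : ℝ) α := by
  obtain ⟨a, ha⟩ := exists_interpolation (max p v + 1) v (by omega)
  refine ⟨_, a, fun α hα => ?_⟩
  funext q w
  rw [← ha fun u => vcomp u α q w]
  simp only [Finset.sum_apply, Pi.smul_apply, smul_eq_mul]
  refine Finset.sum_congr rfl fun k _ => ?_
  rw [scale_eq_sum hα _ (show p < max p v + 1 by omega)]
  simp [Finset.sum_apply]

/-- `α` has vertical degree `v`. -/
def HasWeight (v : ℕ) (α : PreForm M n m p) : Prop :=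
  ∀ t : ℝ, t ≠ 0 → scale t α = t ^ v • α

/-- Compare the coefficients of the powers of `t` in the two expressions for `scale t α`. -/
theorem HasWeight.vcomp {α : PreForm M n m p} (hα : ∀ q, IsAlt (α q)) {v : ℕ}
    (h : HasWeight v α) (u : ℕ) : vcomp u α = if u = v then α else 0 := by
  funext q w
  have := coeff_eq_of_forall_ne_zero (N := max p (max u v) + 1)
    (a := fun u => JetPDE.vcomp u α q w)
    (b := fun u => (if u = v then α else 0) q w) (v := u) (fun t ht => ?_) (by omega)
  · exact this
  · have h1 := congrFun (congrFun (scale_eq_sum hα t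
      (show p < max p (max u v) + 1 by omega)) q) w
    rw [h t ht] at h1
    simp only [Finset.sum_apply, Pi.smul_apply, smul_eq_mul] at h1
    rw [← h1, Finset.sum_eq_single v]
    · simp
    · intro b _ hb
      simp [hb]
    · intro hv
      exact absurd (Finset.mem_range.2 (by omega)) hv

theorem isAlt_scale {α : PreForm M n m p} (hα : ∀ q, IsAlt (α q)) (t : ℝ) (q : Jet M n m) :
    IsAlt (scale t α q) := (hα q).comp_linear (vscale t q)

/-- Rescaling by `t` after `s` is rescaling by `s * t`; the claim compares coefficients of the
powers of `s`, with `t` fixed. -/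
theorem hasWeight_vcomp {α : PreForm M n m p} (hα : ∀ q, IsAlt (α q)) (v : ℕ) :
    HasWeight v (vcomp v α) := by
  intro t ht
  funext q w
  have h2 := fun s => congrFun (congrFun (scale_eq_sum hα s
      (show p < max p v + 1 by omega)) q) (fun j => vscale t q (w j))
  have h1 := fun s => congrFun (congrFun (scale_eq_sum hα (s * t)
      (show p < max p v + 1 by omega)) q) w
  simp only [Finset.sum_apply, Pi.smul_apply, smul_eq_mul] at h1 h2
  refine coeff_eq_of_forall_ne_zero (N := max p v + 1)
    (a := fun v => scale t (vcomp v α) q w) (b := fun v => t ^ v * vcomp v α q w) (v := v)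
    (fun s _ => ?_) (by omega)
  refine (h2 s).symm.trans ?_
  have h3 : scale s α q (fun j => vscale t q (w j)) = scale (s * t) α q w := by
    simp only [scale, vscale_vscale]
  rw [h3, h1]
  exact Finset.sum_congr rfl fun v _ => by rw [mul_pow]; ring

theorem vcomp_vcomp {α : PreForm M n m p} (hα : ∀ q, IsAlt (α q)) {u v : ℕ}
    (hv : ∀ q, IsAlt (vcomp v α q)) :
    vcomp u (vcomp v α) = if u = v then vcomp v α else 0 :=
  (hasWeight_vcomp hα v).vcomp hv u

theorem sum_vcomp {α : PreForm M n m p} (hα : ∀ q, IsAlt (α q)) {N : ℕ} (hN : p < N) :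
    ∑ v ∈ Finset.range N, vcomp v α = α := by
  have h := scale_eq_sum hα 1 hN
  simp only [one_pow, one_smul] at h
  rw [← h]
  funext q w
  simp [scale, vscale_apply, vert]

theorem vcomp_add (v : ℕ) (α β : PreForm M n m p) : vcomp v (α + β) = vcomp v α + vcomp v β := by
  funext q w
  simp only [vcomp, Pi.add_apply, Finset.sum_add_distrib]

theorem vcomp_fmul (v : ℕ) (g : Jet M n m → ℝ) (α : PreForm M n m p) :
    vcomp v (fmul g α) = fmul g (vcomp v α) := by
  funext q w
  simp only [vcomp, fmul, Finset.mul_sum]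

theorem vcomp_neg (v : ℕ) (α : PreForm M n m p) : vcomp v (-α) = -vcomp v α := by
  funext q w
  simp only [vcomp, Pi.neg_apply, Finset.sum_neg_distrib]

theorem vcomp_sub (v : ℕ) (α β : PreForm M n m p) : vcomp v (α - β) = vcomp v α - vcomp v β := by
  rw [sub_eq_add_neg, vcomp_add, vcomp_neg, sub_eq_add_neg]

theorem vcomp_zero (v : ℕ) : vcomp v (0 : PreForm M n m p) = 0 := by
  funext q w
  simp [vcomp]

theorem vcomp_sum {ι : Type*} (s : Finset ι) (v : ℕ) (α : ι → PreForm M n m p) :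
    vcomp v (∑ i ∈ s, α i) = ∑ i ∈ s, vcomp v (α i) := by
  funext q w
  simp only [vcomp, Finset.sum_apply]
  rw [Finset.sum_comm]

theorem HasWeight.add {v : ℕ} {α β : PreForm M n m p} (hα : HasWeight v α)
    (hβ : HasWeight v β) : HasWeight v (α + β) := fun t ht => by
  have : scale t (α + β) = scale t α + scale t β := rfl
  rw [this, hα t ht, hβ t ht, smul_add]

theorem hasWeight_zero (v : ℕ) : HasWeight v (0 : PreForm M n m p) := fun t _ => by
  rw [smul_zero]
  rfl

theorem HasWeight.fmul {v : ℕ} (g : Jet M n m → ℝ) {α : PreForm M n m p} (hα : HasWeight v α) :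
    HasWeight v (fmul g α) := fun t ht => by
  have : scale t (JetPDE.fmul g α) = JetPDE.fmul g (scale t α) := rfl
  rw [this, hα t ht]
  funext q w
  simp only [JetPDE.fmul, Pi.smul_apply, smul_eq_mul]
  ring

theorem HasWeight.const_smul {v : ℕ} (a : ℝ) {α : PreForm M n m p} (hα : HasWeight v α) :
    HasWeight v (a • α) := hα.fmul fun _ => a

theorem HasWeight.neg {v : ℕ} {α : PreForm M n m p} (hα : HasWeight v α) :
    HasWeight v (-α) := by
  simpa using hα.const_smul (-1)

theorem hasWeight_sum {ι : Type*} (s : Finset ι) {v : ℕ} {α : ι → PreForm M n m p}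
    (hα : ∀ i ∈ s, HasWeight v (α i)) : HasWeight v (∑ i ∈ s, α i) := by
  classical
  induction s using Finset.induction_on with
  | empty => simpa using hasWeight_zero v
  | insert a s ha ih =>
    rw [Finset.sum_insert ha]
    exact (hα a (by simp)).add (ih fun i hi => hα i (by simp [hi]))

theorem HasWeight.wedge_contact {v : ℕ} (c : JetIdx n m) {γ : PreForm M n m p}
    (hγ : HasWeight v γ) : HasWeight (v + 1) (wedge (contact c) γ) := fun t ht => by
  rw [scale_wedge_contact, hγ t ht, wedge_smul_right, smul_smul, pow_succ']

theorem HasWeight.wedge_dx {v : ℕ} (i : Fin n) {γ : PreForm M n m p}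
    (hγ : HasWeight v γ) : HasWeight v (wedge (dx i) γ) := fun t ht => by
  rw [scale_wedge_dx, hγ t ht, wedge_smul_right]

end Grading

/-! ### Vertical components of smooth forms -/

section Grading

variable {M : Type*} [TopologicalSpace M] {n m p : ℕ}
  [ChartedSpace (EuclideanSpace ℝ (Fin n)) M]

theorem IsForm.scale (t : ℝ) {α : PreForm M n m p} (hα : IsForm α) : IsForm (scale t α) := by
  refine ⟨isAlt_scale hα.isAlt t, ?_, fun w => ?_⟩
  · refine hα.finDep.comp (Y := fun j q w => vscale t q (w j)) (fun j => ?_) fun j c => ?_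
    · simp only [vscale_fst]
      exact finDep_fst j
    · simp only [vscale_snd]
      exact ((finDep_const _).mul (finDep_snd j c)).add ((finDep_const _).mul
        (FinDep.sum fun i => ((finDep_fst j).map fun z => z i).mul (finDep_coord _)))
  · refine hα.isSmooth_apply (Y := fun j q => vscale t q (w j)) (fun j i => ?_) fun j c => ?_
    · simp only [vscale_fst]
      exact isSmooth_const _
    · simp only [vscale_snd]
      exact (isSmooth_const _).add
        ((isSmooth_sum _ fun i _ => (isSmooth_coord _).const_mul _).const_mul _)

/-- A vertical component is a combination of rescalings, which are pullbacks along smooth bundle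
maps, so the sum over subsets of slots need not be examined. -/
theorem IsForm.vcomp (v : ℕ) {α : PreForm M n m p} (hα : IsForm α) : IsForm (vcomp v α) := by
  obtain ⟨N, a, ha⟩ := exists_vcomp_eq_sum (M := M) (n := n) (m := m) p v
  rw [ha α hα.isAlt]
  exact isForm_sum _ fun k _ => (hα.scale _).const_smul _

theorem IsForm.vcomp_vcomp {α : PreForm M n m p} (hα : IsForm α) (u v : ℕ) :
    JetPDE.vcomp u (JetPDE.vcomp v α) = if u = v then JetPDE.vcomp v α else 0 :=
  JetPDE.vcomp_vcomp hα.isAlt (hα.vcomp v).isAlt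

theorem IsForm.isBiform_vcomp (v : ℕ) {α : PreForm M n m p} (hα : IsForm α) :
    IsBiform v (JetPDE.vcomp v α) :=
  ⟨hα.vcomp v, by rw [hα.vcomp_vcomp, if_pos rfl]⟩

theorem IsBiform.hasWeight {v : ℕ} {α : PreForm M n m p} (hα : IsBiform v α) :
    HasWeight v α := by
  have := hasWeight_vcomp hα.1.isAlt v
  rwa [hα.2] at this

theorem HasWeight.isBiform {v : ℕ} {α : PreForm M n m p} (h : HasWeight v α) (hα : IsForm α) :
    IsBiform v α := ⟨hα, by rw [h.vcomp hα.isAlt, if_pos rfl]⟩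

theorem IsBiform.vcomp_eq {v : ℕ} {α : PreForm M n m p} (hα : IsBiform v α) (u : ℕ) :
    vcomp u α = if u = v then α else 0 := hα.hasWeight.vcomp hα.1.isAlt u

end Grading

/-! ### The moving frame of total and vertical derivatives -/

section Splitting

variable {M : Type*} {n m p : ℕ}

theorem vcomp_zero_apply (α : PreForm M n m p) (q : Jet M n m) (w : Fin p → Tan n m) :
    vcomp 0 α q w = α q (fun j => hor q (w j)) := by
  simp [vcomp]

/-- The vector field `Dᵢ`. -/
def totalVec (i : Fin n) (q : Jet M n m) : Tan n m :=
  (EuclideanSpace.single i 1, fun c => q.2 (c.succ i))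

/-- The constant vector field `∂/∂u^a_I`. -/
def vertVec (c : JetIdx n m) (_ : Jet M n m) : Tan n m := frame (Sum.inr c)

theorem vertVec_fst (c : JetIdx n m) (q : Jet M n m) : (vertVec c q).1 = 0 := rfl

open Classical in
theorem vertVec_snd (c c' : JetIdx n m) (q : Jet M n m) :
    (vertVec c q).2 c' = if c' = c then 1 else 0 := by
  simp [vertVec, frame, Pi.single_apply]

theorem hor_eq_sum (q : Jet M n m) (w : Tan n m) : hor q w = ∑ i, w.1 i • totalVec i q := by
  refine Prod.ext ?_ (funext fun c => ?_)
  · ext k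
    simp [hor, totalVec, Prod.fst_sum, Pi.single_apply]
  · simp [hor, totalVec, Prod.snd_sum]

theorem vscale_totalVec (t : ℝ) (i : Fin n) (q : Jet M n m) :
    vscale t q (totalVec i q) = totalVec i q := by
  refine Prod.ext (vscale_fst _ _ _) (funext fun c => ?_)
  rw [vscale_snd]
  simp [totalVec]
  ring

theorem vscale_vertVec (t : ℝ) (c : JetIdx n m) (q : Jet M n m) :
    vscale t q (vertVec c q) = t • vertVec c q := by
  refine Prod.ext ?_ (funext fun c' => ?_)
  · simp [vscale_fst, vertVec_fst]
  · rw [vscale_snd]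
    simp [vertVec_fst]

/-- Expansion of the first argument in the moving frame `Dᵢ, ∂/∂u^a_I`. -/
theorem exists_expansion {α : PreForm M n m (p + 1)} (hA : ∀ q, IsAlt (α q)) (hα : FinDep α) :
    ∃ S : Finset (JetIdx n m), ∀ q v w, α q (Fin.cons v w) =
      ∑ c ∈ S, contact c q v * α q (Fin.cons (vertVec c q) w) +
        ∑ i, v.1 i * α q (Fin.cons (totalVec i q) w) := by
  classical
  obtain ⟨S, hS⟩ := hα
  refine ⟨S, fun q v w => ?_⟩
  have e : α q (Fin.cons v w) = α q (Fin.cons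
      (∑ c ∈ S, contact c q v • vertVec c q + ∑ i, v.1 i • totalVec i q) w) := by
    refine hS q.1 q.2 q.2 _ _ (fun _ _ => rfl) (Fin.cases ⟨?_, fun c hc => ?_⟩ fun j =>
      ⟨rfl, fun c _ => rfl⟩)
    · simp only [Fin.cons_zero]
      ext k
      simp [Prod.fst_sum, vertVec_fst, totalVec, Pi.single_apply]
    · simp only [Fin.cons_zero, Prod.snd_add, Prod.snd_sum, Pi.add_apply, Finset.sum_apply,
        Prod.smul_snd, Pi.smul_apply, smul_eq_mul, vertVec_snd, totalVec]
      simp [hc, contact_apply]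
  obtain ⟨A, hA⟩ := hA q
  let L : Tan n m →ₗ[ℝ] ℝ :=
    { toFun := fun v => A.curryLeft v w
      map_add' := by simp
      map_smul' := by simp }
  have lin : ∀ v, α q (Fin.cons v w) = L v := fun v => hA _
  rw [e]
  simp only [lin, _root_.map_add, map_sum, map_smul, smul_eq_mul]

/-- Expanding the first slot in the moving frame inside `alternatization_cons` produces wedge
products with forms of lower degree. This drives the induction on the degree in
`splits_of_hasWeight`. -/
theorem exists_wedge_expansion {α : PreForm M n m (p + 1)} (hA : ∀ q, IsAlt (α q))
    (hα : FinDep α) : ∃ S : Finset (JetIdx n m), ((p : ℝ) + 1) • α =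
      ∑ c ∈ S, wedge (contact c) (contr (vertVec c) α) +
        ∑ i, wedge (dx i) (contr (totalVec i) α) := by
  obtain ⟨S, hS⟩ := exists_expansion hA hα
  refine ⟨S, ?_⟩
  funext q w
  simp only [Pi.smul_apply, smul_eq_mul, Pi.add_apply, Finset.sum_apply]
  rw [← alternatization_cons (hA q) w]
  have h := fun i : Fin (p + 1) => hS q (w i) fun j => w (i.succAbove j)
  simp only [h, wedge, contr, dx, mul_add, Finset.sum_add_distrib, Finset.mul_sum]
  congr 1 <;> exact Finset.sum_comm

theorem HasWeight.contr_totalVec {v : ℕ} {α : PreForm M n m (p + 1)} (h : HasWeight v α)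
    (i : Fin n) : HasWeight v (contr (totalVec i) α) := fun t ht => by
  funext q w
  have := congrFun (congrFun (h t ht) q) (Fin.cons (totalVec i q) w)
  simp only [Pi.smul_apply, smul_eq_mul] at this ⊢
  simp only [contr, ← this, scale]
  congr 1
  funext j
  refine Fin.cases ?_ (fun j => ?_) j
  · simp [vscale_totalVec]
  · simp

/-- Rescaling multiplies the contracted vertical vector by `t`, so one power of `t` cancels. This
cancellation is why weights are tested only at nonzero `t`. -/
theorem HasWeight.contr_vertVec {v : ℕ} {α : PreForm M n m (p + 1)} (hA : ∀ q, IsAlt (α q))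
    (h : HasWeight (v + 1) α) (c : JetIdx n m) : HasWeight v (contr (vertVec c) α) :=
  fun t ht => by
  funext q w
  have := congrFun (congrFun (h t ht) q) (Fin.cons (vertVec c q) w)
  obtain ⟨A, hA⟩ := hA q
  simp only [Pi.smul_apply, smul_eq_mul, scale] at this
  have e : α q (fun j => vscale t q ((Fin.cons (vertVec c q) w : Fin (p + 1) → Tan n m) j)) =
      t * α q (Fin.cons (vertVec c q) fun j => vscale t q (w j)) := by
    have e1 : (fun j => vscale t q ((Fin.cons (vertVec c q) w : Fin (p + 1) → Tan n m) j)) =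
        Fin.cons (t • vertVec c q) fun j => vscale t q (w j) := by
      funext j
      refine Fin.cases ?_ (fun j => ?_) j
      · simp [vscale_vertVec]
      · simp
    rw [e1, hA, hA]
    exact congrArg (fun B => B fun j => vscale t q (w j)) (A.curryLeft.map_smul t (vertVec c q))
  rw [e, pow_succ', mul_assoc] at this
  exact mul_left_cancel₀ ht this

/-- A form of weight zero depends only on the horizontal parts of its arguments, and a vertical
vector has none. -/
theorem HasWeight.contr_vertVec_eq_zero {α : PreForm M n m (p + 1)} (hA : ∀ q, IsAlt (α q))
    (h : HasWeight 0 α) (c : JetIdx n m) : contr (vertVec c) α = 0 := by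
  have e := h.vcomp hA 0
  rw [if_pos rfl] at e
  funext q w
  obtain ⟨A, hA⟩ := hA q
  rw [contr, ← e, vcomp_zero_apply, hA]
  exact A.map_coord_zero 0 (by rw [Fin.cons_zero, hor_eq_vscale, vscale_vertVec, zero_smul])

end Splitting

/-! ### Splitting of the differential into bidegrees (1,0) and (0,1) -/

section Splitting

variable {M : Type*} [TopologicalSpace M] {n m p : ℕ}
  [ChartedSpace (EuclideanSpace ℝ (Fin n)) M] {X : M → EuclideanSpace ℝ (Fin n)}

theorem isForm_contr_vertVec {α : PreForm M n m (p + 1)} (hα : IsForm α) (c : JetIdx n m) :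
    IsForm (contr (vertVec c) α) :=
  hα.contr (finDep_const _) (fun _ => isSmooth_const _) fun _ => isSmooth_const _

theorem isForm_contr_totalVec {α : PreForm M n m (p + 1)} (hα : IsForm α) (i : Fin n) :
    IsForm (contr (totalVec i) α) :=
  hα.contr (finDep_const _) (fun _ => isSmooth_const _) fun _ => isSmooth_coord _

variable (hX : IsLocalDiffeomorph (𝓡 n) 𝓘(ℝ, EuclideanSpace ℝ (Fin n)) ∞ X)
include hX

theorem dirDeriv_base_eq_dx (i : Fin n) :
    dirDeriv X (fun q : Jet M n m => X q.1 i) = dx i := by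
  funext q w
  exact dirDeriv_base hX i q w

omit hX in
theorem wedge_dirDeriv_coord (c : JetIdx n m) (γ : PreForm M n m p) :
    wedge (dirDeriv X fun q : Jet M n m => q.2 c) γ =
      wedge (contact c) γ + ∑ j, fmul (fun q => q.2 (c.succ j)) (wedge (dx j) γ) := by
  have e : (dirDeriv X fun q : Jet M n m => q.2 c) = fun q w => contact c q w +
      ∑ j, q.2 (c.succ j) * dx j q w := by
    funext q w
    rw [dirDeriv_coord, contact_apply]
    simp only [dx, mul_comm (q.2 _)]
    ring
  rw [e, wedge_add_left, wedge_sum_left]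
  simp only [wedge_fmul_left]

theorem extD_wedge_dx (i : Fin n) {γ : PreForm M n m p} (hγ : IsForm γ) :
    extD X (wedge (dx i) γ) = -wedge (dx i) (extD X γ) := by
  rw [← dirDeriv_base_eq_dx hX, extD_wedge_dirDeriv hX (isSmooth_base hX i) hγ]

/-- The contact form is `du_c - ∑ u_{c+j} dx^j`, with differential `-∑ du_{c+j} ∧ dx^j`; replacing
`du_{c+j}` by its contact form changes nothing. -/
theorem extD_wedge_contact (c : JetIdx n m) {γ : PreForm M n m p} (hγ : IsForm γ) :
    extD X (wedge (contact c) γ) =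
      -wedge (contact c) (extD X γ) - ∑ j, wedge (contact (c.succ j)) (wedge (dx j) γ) := by
  have hdx : ∀ j : Fin n, IsForm (wedge (dx j) γ) := fun j => IsForm.wedge (isCovector_dx j) hγ
  have hf : ∀ j : Fin n, IsForm (fmul (fun q => q.2 (c.succ j)) (wedge (dx j) γ)) := fun j =>
    IsForm.fmul (isSmooth_coord _) (hdx j)
  have e : wedge (contact c) γ = wedge (dirDeriv X fun q : Jet M n m => q.2 c) γ -
      ∑ j, fmul (fun q => q.2 (c.succ j)) (wedge (dx j) γ) := by
    rw [wedge_dirDeriv_coord, add_sub_cancel_right]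
  -- The coordinates `u_{c+j+k}` are symmetric in `j`, `k`, while the wedge product is
  -- antisymmetric, so the sum equals its own negative.
  have hz : ∑ j : Fin n, ∑ k : Fin n, fmul (fun q => q.2 ((c.succ j).succ k))
      (wedge (dx k) (wedge (dx j) γ)) = 0 := by
    have h : ∀ a : PreForm M n m (p + 1 + 1), a = -a → a = 0 := fun a ha => by
      funext q w
      have := congrFun (congrFun ha q) w
      simp only [Pi.neg_apply] at this
      simp only [Pi.zero_apply]
      linarith
    refine h _ ?_
    conv_lhs => rw [Finset.sum_comm]
    simp only [← Finset.sum_neg_distrib]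
    refine Finset.sum_congr rfl fun j _ => Finset.sum_congr rfl fun k _ => ?_
    have hs : (c.succ k).succ j = (c.succ j).succ k := by
      simp only [JetIdx.succ, add_right_comm]
    rw [hs, wedge_wedge (isCovector_dx j) (isCovector_dx k) hγ, fmul_neg]
  rw [e, extD_sub hX (IsForm.wedge (isCovector_dirDeriv hX (isSmooth_coord c)) hγ)
    (isForm_sum _ fun j _ => hf j), extD_wedge_dirDeriv hX (isSmooth_coord c) hγ,
    extD_sum hX _ fun j _ => hf j]
  simp only [extD_fmul hX (isSmooth_coord _) (hdx _), wedge_dirDeriv_coord, extD_wedge_dx hX _ hγ,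
    Finset.sum_add_distrib, hz, fmul_neg, Finset.sum_neg_distrib]
  abel

/-- `α` has vertical degree `v`, and its differential has parts of vertical degrees `v`, `v + 1`
only. -/
def Splits (X : M → EuclideanSpace ℝ (Fin n)) (v : ℕ) (α : PreForm M n m p) : Prop :=
  IsForm α ∧ ∃ A B, IsForm A ∧ IsForm B ∧ HasWeight v A ∧ HasWeight (v + 1) B ∧
    extD X α = A + B

theorem splits_zero (v : ℕ) : Splits X v (0 : PreForm M n m p) :=
  ⟨isForm_zero, 0, 0, isForm_zero, isForm_zero, hasWeight_zero _, hasWeight_zero _, by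
    rw [extD_zero hX, add_zero]⟩

theorem Splits.add {v : ℕ} {α β : PreForm M n m p} (hα : Splits X v α) (hβ : Splits X v β) :
    Splits X v (α + β) := by
  obtain ⟨hα, A, B, hA, hB, wA, wB, h⟩ := hα
  obtain ⟨hβ, A', B', hA', hB', wA', wB', h'⟩ := hβ
  refine ⟨hα.add hβ, A + A', B + B', hA.add hA', hB.add hB', wA.add wA', wB.add wB', ?_⟩
  rw [extD_add hX hα hβ, h, h']
  abel

theorem Splits.const_smul {v : ℕ} (a : ℝ) {α : PreForm M n m p} (hα : Splits X v α) :
    Splits X v (a • α) := by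
  obtain ⟨hα, A, B, hA, hB, wA, wB, h⟩ := hα
  refine ⟨hα.const_smul a, a • A, a • B, hA.const_smul a, hB.const_smul a, wA.const_smul a,
    wB.const_smul a, ?_⟩
  rw [extD_smul hX a hα, h, smul_add]

theorem splits_sum {ι : Type*} (s : Finset ι) {v : ℕ} {α : ι → PreForm M n m p}
    (hα : ∀ i ∈ s, Splits X v (α i)) : Splits X v (∑ i ∈ s, α i) := by
  classical
  induction s using Finset.induction_on with
  | empty => simpa using splits_zero hX v
  | insert a s ha ih =>
    rw [Finset.sum_insert ha]
    exact Splits.add hX (hα a (by simp)) (ih fun i hi => hα i (by simp [hi]))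

theorem Splits.wedge_dx {v : ℕ} {γ : PreForm M n m p} (hγ : Splits X v γ) (i : Fin n) :
    Splits X v (wedge (dx i) γ) := by
  obtain ⟨hγ, A, B, hA, hB, wA, wB, h⟩ := hγ
  refine ⟨IsForm.wedge (isCovector_dx i) hγ, -wedge (dx i) A, -wedge (dx i) B,
    (IsForm.wedge (isCovector_dx i) hA).neg, (IsForm.wedge (isCovector_dx i) hB).neg,
    (wA.wedge_dx i).neg, (wB.wedge_dx i).neg, ?_⟩
  rw [extD_wedge_dx hX i hγ, h, wedge_add_right, neg_add]

theorem Splits.wedge_contact {v : ℕ} {γ : PreForm M n m p} (hγ : Splits X v γ)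
    (wγ : HasWeight v γ) (c : JetIdx n m) : Splits X (v + 1) (wedge (contact c) γ) := by
  obtain ⟨hγ, A, B, hA, hB, wA, wB, h⟩ := hγ
  have hs : ∀ j : Fin n, IsForm (wedge (contact (c.succ j)) (wedge (dx j) γ)) := fun j =>
    IsForm.wedge (isCovector_contact _) (IsForm.wedge (isCovector_dx j) hγ)
  refine ⟨IsForm.wedge (isCovector_contact c) hγ,
    -wedge (contact c) A + -∑ j, wedge (contact (c.succ j)) (wedge (dx j) γ),
    -wedge (contact c) B, (IsForm.wedge (isCovector_contact c) hA).neg.add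
      (isForm_sum _ fun j _ => hs j).neg,
    (IsForm.wedge (isCovector_contact c) hB).neg,
    (wA.wedge_contact c).neg.add
      (hasWeight_sum _ fun j _ => (wγ.wedge_dx j).wedge_contact _).neg,
    (wB.wedge_contact c).neg, ?_⟩
  rw [extD_wedge_contact hX c hγ, h, wedge_add_right]
  abel

/-- By the moving frame expansion it suffices to treat products of `dx i` or a contact form with a
form of lower degree. The forms `dx i` are closed, and the differential of a contact form keeps
weight one, so no component outside the two bidegrees can arise. -/
theorem splits_of_hasWeight {v : ℕ} {α : PreForm M n m p} (hα : IsForm α) (h : HasWeight v α) :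
    Splits X v α := by
  induction p generalizing v with
  | zero =>
    rcases Nat.eq_zero_or_pos v with rfl | hv
    · have hd := IsForm.extD hX hα
      refine ⟨hα, vcomp 0 (extD X α), vcomp 1 (extD X α), hd.vcomp 0, hd.vcomp 1,
        hasWeight_vcomp hd.isAlt 0, hasWeight_vcomp hd.isAlt 1, ?_⟩
      have := sum_vcomp hd.isAlt (N := 2) (by norm_num)
      simpa [Finset.sum_range_succ] using this.symm
    -- Rescaling does nothing to a form without arguments, so positive weight gives `2 ^ v * α = α`
    -- with `2 ^ v > 1`.
    · have : α = 0 := by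
        funext q w
        have h2 := congrFun (congrFun (h 2 two_ne_zero) q) w
        have h3 : scale 2 α q w = α q w := congrArg (α q) (Subsingleton.elim _ _)
        rw [h3] at h2
        simp only [Pi.smul_apply, smul_eq_mul] at h2
        have h4 : (1 : ℝ) < 2 ^ v := one_lt_pow₀ one_lt_two hv.ne'
        have h5 : ((2 : ℝ) ^ v - 1) * α q w = 0 := by linarith
        exact (mul_eq_zero.1 h5).resolve_left (by linarith)
      rw [this]
      exact splits_zero hX v
  | succ p ih =>
    obtain ⟨S, hS⟩ := exists_wedge_expansion hα.isAlt hα.finDep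
    have hp : ((p : ℝ) + 1) ≠ 0 := by positivity
    have e : α = ((p : ℝ) + 1)⁻¹ • (∑ c ∈ S, wedge (contact c) (contr (vertVec c) α) +
        ∑ i, wedge (dx i) (contr (totalVec i) α)) := by
      rw [← hS, smul_smul, inv_mul_cancel₀ hp, one_smul]
    rw [e]
    refine Splits.const_smul hX _ (Splits.add hX (splits_sum hX _ fun c _ => ?_)
      (splits_sum hX _ fun i _ => ?_))
    · cases v with
      | zero =>
        rw [h.contr_vertVec_eq_zero hα.isAlt, wedge_zero_right]
        exact splits_zero hX 0
      | succ v =>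
        exact Splits.wedge_contact hX (ih (isForm_contr_vertVec hα c)
          (h.contr_vertVec hα.isAlt c)) (h.contr_vertVec hα.isAlt c) c
    · exact Splits.wedge_dx hX (ih (isForm_contr_totalVec hα i) (h.contr_totalVec i)) i

theorem IsBiform.vcomp_extD {v : ℕ} {α : PreForm M n m p} (hα : IsBiform v α) {u : ℕ}
    (h0 : u ≠ v) (h1 : u ≠ v + 1) : vcomp u (extD X α) = 0 := by
  obtain ⟨-, A, B, hA, hB, wA, wB, h⟩ := splits_of_hasWeight hX hα.1 hα.hasWeight
  rw [h, vcomp_add, wA.vcomp hA.isAlt, wB.vcomp hB.isAlt, if_neg h0, if_neg h1, add_zero]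

omit hX in
theorem isBiform_zero (v : ℕ) : IsBiform v (0 : PreForm M n m p) := ⟨isForm_zero, vcomp_zero v⟩

theorem IsBiform.dH_eq {v : ℕ} {α : PreForm M n m p} (hα : IsBiform v α) :
    dH X α = vcomp v (extD X α) := by
  rw [dH, Finset.sum_eq_single v]
  · rw [hα.2]
  · intro u _ hu
    rw [hα.vcomp_eq, if_neg hu, extD_zero hX, vcomp_zero]
  · intro hv
    rw [vcomp_eq_zero_of_lt α (by simpa using hv), extD_zero hX, vcomp_zero]

theorem IsBiform.dV_eq {v : ℕ} {α : PreForm M n m p} (hα : IsBiform v α) :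
    dV X α = vcomp (v + 1) (extD X α) := by
  rw [dV, Finset.sum_eq_single v]
  · rw [hα.2]
  · intro u _ hu
    rw [hα.vcomp_eq, if_neg hu, extD_zero hX, vcomp_zero]
  · intro hv
    rw [vcomp_eq_zero_of_lt α (by simpa using hv), extD_zero hX, vcomp_zero]

theorem IsBiform.extD_eq {v : ℕ} {α : PreForm M n m p} (hα : IsBiform v α) :
    extD X α = dH X α + dV X α := by
  obtain ⟨-, A, B, hA, hB, wA, wB, h⟩ := splits_of_hasWeight hX hα.1 hα.hasWeight
  rw [hα.dH_eq hX, hα.dV_eq hX, h, vcomp_add, vcomp_add, wA.vcomp hA.isAlt, wA.vcomp hA.isAlt,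
    wB.vcomp hB.isAlt, wB.vcomp hB.isAlt]
  simp

/-- The components of the differential of a form. -/
theorem IsForm.vcomp_extD {α : PreForm M n m p} (hα : IsForm α) (u : ℕ) :
    JetPDE.vcomp (u + 1) (JetPDE.extD X α) =
      dV X (JetPDE.vcomp u α) + dH X (JetPDE.vcomp (u + 1) α) := by
  have h := sum_vcomp hα.isAlt (N := p + u + 2) (by omega)
  have hb := fun v => hα.isBiform_vcomp v
  conv_lhs => rw [← h]
  rw [extD_sum hX _ fun v _ => hα.vcomp v, vcomp_sum, (hb u).dV_eq hX, (hb (u + 1)).dH_eq hX]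
  rw [← Finset.sum_subset (s₁ := {u, u + 1}), Finset.sum_pair (by omega)]
  · intro v hv
    simp only [Finset.mem_insert, Finset.mem_singleton] at hv
    simp only [Finset.mem_range]
    omega
  · intro v _ hv
    simp only [Finset.mem_insert, Finset.mem_singleton, not_or] at hv
    exact (hb v).vcomp_extD hX (by omega) (by omega)

end Splitting

/-! ## Forms on a subset of the jet bundle -/

section Pullback

variable {M : Type*} [TopologicalSpace M] {n m p : ℕ}
  [ChartedSpace (EuclideanSpace ℝ (Fin n)) M] {X : M → EuclideanSpace ℝ (Fin n)}
  {Z : Set (Jet M n m)}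

theorem IsCovector.map_sum {l : Jet M n m → Tan n m → ℝ} (hl : IsCovector l) {ι : Type*}
    (s : Finset ι) (q : Jet M n m) (w : ι → Tan n m) :
    l q (∑ i ∈ s, w i) = ∑ i ∈ s, l q (w i) := by
  let L : Tan n m →ₗ[ℝ] ℝ := ⟨⟨l q, hl.map_add q⟩, hl.map_smul q⟩
  exact _root_.map_sum L w s

theorem IsCovector.isSmooth_apply {l : Jet M n m → Tan n m → ℝ} (hl : IsCovector l)
    {Y : Jet M n m → Tan n m} (h1 : ∀ i, IsSmooth (fun q => (Y q).1 i))
    (h2 : ∀ c, IsSmooth (fun q => (Y q).2 c)) : IsSmooth (fun q => l q (Y q)) := by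
  -- Wedging with the constant function one turns the covector field into a one-form, for which
  -- smoothness of evaluation is known.
  have hone : IsForm (fun (_ : Jet M n m) (_ : Fin 0 → Tan n m) => (1 : ℝ)) :=
    ⟨fun _ => ⟨AlternatingMap.constOfIsEmpty ℝ _ _ 1, fun _ => rfl⟩, finDep_const 1,
      fun _ => isSmooth_const 1⟩
  have := (IsForm.wedge hl hone).isSmooth_apply (Y := fun _ => Y) (fun _ => h1) fun _ => h2
  simpa [wedge] using this

/-- The smooth functions vanishing on `Z` are preserved by the total derivatives. -/
def IsTotalDerivStable (X : M → EuclideanSpace ℝ (Fin n)) (Z : Set (Jet M n m)) : Prop :=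
  ∀ g : Jet M n m → ℝ, IsSmooth g → (∀ q ∈ Z, g q = 0) →
    ∀ i, ∀ q ∈ Z, totalDeriv X i g q = 0

theorem pullbackZero_zero : PullbackZero X Z (0 : PreForm M n m p) := by
  have := PullbackZero.smul (X := X) (Z := Z) (fun _ => 0) (0 : PreForm M n m p)
    (isSmooth_const 0) (fun _ _ => rfl) isForm_zero
  convert this using 1
  funext q w
  simp

theorem PullbackZero.fmul {h : Jet M n m → ℝ} (hh : IsSmooth h) {α : PreForm M n m p}
    (hα : PullbackZero X Z α) : PullbackZero X Z (fmul h α) := by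
  induction hα with
  | smul g β hg hZ hβ =>
    convert PullbackZero.smul (X := X) (Z := Z) (fun q => h q * g q) β (hh.mul hg)
      (fun q hq => by rw [hZ q hq, mul_zero]) hβ using 1
    funext q w
    simp only [JetPDE.fmul, mul_assoc]
  | diff g γ hg hZ hγ =>
    convert PullbackZero.diff (X := X) g (JetPDE.fmul h γ) hg hZ (IsForm.fmul hh hγ) using 1
    exact (wedge_fmul_right _ _ _).symm
  | add α β _ _ ihα ihβ =>
    rw [fmul_add]
    exact ihα.add _ _ ihβ

theorem PullbackZero.const_smul (a : ℝ) {α : PreForm M n m p}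
    (hα : PullbackZero X Z α) : PullbackZero X Z (a • α) := hα.fmul (isSmooth_const a)

theorem PullbackZero.neg {α : PreForm M n m p} (hα : PullbackZero X Z α) :
    PullbackZero X Z (-α) := by
  simpa using hα.const_smul (-1)

theorem pullbackZero_sum {ι : Type*} (s : Finset ι) {α : ι → PreForm M n m p}
    (hα : ∀ i ∈ s, PullbackZero X Z (α i)) : PullbackZero X Z (∑ i ∈ s, α i) := by
  classical
  induction s using Finset.induction_on with
  | empty => simpa using pullbackZero_zero
  | insert a s ha ih =>
    rw [Finset.sum_insert ha]
    exact (hα a (by simp)).add _ _ (ih fun i hi => hα i (by simp [hi]))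

variable (hX : IsLocalDiffeomorph (𝓡 n) 𝓘(ℝ, EuclideanSpace ℝ (Fin n)) ∞ X)
include hX

theorem IsSmooth.totalDeriv {g : Jet M n m → ℝ} (hg : IsSmooth g) (i : Fin n) :
    IsSmooth (totalDeriv X i g) :=
  (isCovector_dirDeriv hX hg).isSmooth_apply (Y := totalVec i) (fun _ => isSmooth_const _)
    fun _ => isSmooth_coord _

theorem dirDeriv_hor {g : Jet M n m → ℝ} (hg : IsSmooth g) (q : Jet M n m) (w : Tan n m) :
    dirDeriv X g q (hor q w) = ∑ i, totalDeriv X i g q * w.1 i := by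
  have hl := isCovector_dirDeriv hX hg
  rw [hor_eq_sum, hl.map_sum]
  refine Finset.sum_congr rfl fun i _ => ?_
  rw [hl.map_smul, mul_comm]
  rfl

theorem dirDeriv_eq_vert_add {g : Jet M n m → ℝ} (hg : IsSmooth g) (q : Jet M n m)
    (w : Tan n m) :
    dirDeriv X g q w = dirDeriv X g q (vert q w) + ∑ i, totalDeriv X i g q * w.1 i := by
  rw [← dirDeriv_hor hX hg, ← dirDeriv_add_right hX hg, vert, sub_add_cancel]

/-- The rescaling is `t • w + (1 - t) • hor w`, and `dg` of a horizontal part is `∑ D_i g dx^i`. -/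
theorem scale_wedge_dirDeriv (t : ℝ) {g : Jet M n m → ℝ} (hg : IsSmooth g)
    (γ : PreForm M n m p) : scale t (wedge (dirDeriv X g) γ) =
      t • wedge (dirDeriv X g) (scale t γ) +
        (1 - t) • ∑ i, fmul (totalDeriv X i g) (wedge (dx i) (scale t γ)) := by
  have e : (fun q w => dirDeriv X g q (vscale t q w)) = fun q w =>
      t * dirDeriv X g q w + (1 - t) * ∑ i, totalDeriv X i g q * dx i q w := by
    funext q w
    rw [vscale_apply, dirDeriv_add_right hX hg, dirDeriv_smul_right hX hg, dirDeriv_hor hX hg,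
      dirDeriv_eq_vert_add hX hg q w]
    simp only [dx]
    ring
  rw [scale_wedge, e, wedge_add_left, wedge_fmul_left (fun _ => t),
    wedge_fmul_left (fun _ => 1 - t), wedge_sum_left]
  simp only [wedge_fmul_left]
  rfl

/-- Rescaling `dg ∧ γ` creates terms with coefficients `D_i g`; they stay in the ideal exactly
because total derivatives preserve vanishing on `Z`. -/
theorem PullbackZero.scale (hZs : IsTotalDerivStable X Z) (t : ℝ) {α : PreForm M n m p}
    (hα : PullbackZero X Z α) : PullbackZero X Z (scale t α) := by
  induction hα with
  | smul g β hg hZ hβ => exact PullbackZero.smul g (JetPDE.scale t β) hg hZ (hβ.scale t)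
  | diff g γ hg hZ hγ =>
    refine Eq.mpr (congrArg _ (scale_wedge_dirDeriv hX t hg γ)) ?_
    exact ((PullbackZero.diff g _ hg hZ (hγ.scale t)).const_smul t).add _ _
      ((pullbackZero_sum _ fun i _ => PullbackZero.smul (JetPDE.totalDeriv X i g) _
        (IsSmooth.totalDeriv hX hg i) (hZs g hg hZ i)
        (IsForm.wedge (isCovector_dx i) (hγ.scale t))).const_smul _)
  | add α β _ _ ihα ihβ => exact ihα.add _ _ ihβ

theorem PullbackZero.isForm {α : PreForm M n m p} (hα : PullbackZero X Z α) : IsForm α := by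
  induction hα with
  | smul g β hg hZ hβ => exact IsForm.fmul hg hβ
  | diff g γ hg hZ hγ => exact IsForm.wedge (isCovector_dirDeriv hX hg) hγ
  | add α β _ _ ihα ihβ => exact ihα.add ihβ

theorem PullbackZero.vcomp (hZs : IsTotalDerivStable X Z) (v : ℕ) {α : PreForm M n m p}
    (hα : PullbackZero X Z α) : PullbackZero X Z (vcomp v α) := by
  obtain ⟨N, a, ha⟩ := exists_vcomp_eq_sum (M := M) (n := n) (m := m) p v
  rw [ha α (PullbackZero.isForm hX hα).isAlt]
  exact pullbackZero_sum _ fun k _ => (PullbackZero.scale hX hZs _ hα).const_smul _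

theorem PullbackZero.extD {α : PreForm M n m p} (hα : PullbackZero X Z α) :
    PullbackZero X Z (extD X α) := by
  induction hα with
  | smul g β hg hZ hβ =>
    refine Eq.mpr (congrArg _ (extD_fmul hX hg hβ)) ?_
    exact (PullbackZero.diff g β hg hZ hβ).add _ _
      (PullbackZero.smul g _ hg hZ (IsForm.extD hX hβ))
  | diff g γ hg hZ hγ =>
    refine Eq.mpr (congrArg _ (extD_wedge_dirDeriv hX hg hγ)) ?_
    exact (PullbackZero.diff g _ hg hZ (IsForm.extD hX hγ)).neg
  | add α β hα hβ ihα ihβ =>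
    rw [extD_add hX (PullbackZero.isForm hX hα) (PullbackZero.isForm hX hβ)]
    exact ihα.add _ _ ihβ

/-- A presymplectic current is exact on `Z` if the de Rham cohomology of `Z` vanishes. -/
theorem IsPresymplecticCurrent.exists_primitive (hZ : DeRhamTrivial X Z)
    {α : PreForm M n m (n + 1)} (hα : IsPresymplecticCurrent X Z α) :
    ∃ β : PreForm M n m n, IsForm β ∧ PullbackEq X Z α (JetPDE.extD X β) := by
  obtain ⟨hb, hH, hV⟩ := hα
  refine hZ n α hb.1 ?_
  rw [hb.extD_eq hX]
  exact hH.add _ _ hV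

theorem dH_zero : dH X (0 : PreForm M n m p) = 0 := by
  rw [(isBiform_zero 0).dH_eq hX, extD_zero hX, vcomp_zero]

/-- If the vertical cohomology vanishes, the components of a primitive of vertical degree at
least two can be removed. -/
theorem exists_primitive_of_verticallyTrivial (hZs : IsTotalDerivStable X Z)
    (hV : VerticallyTrivial X Z) {α : PreForm M n m (n + 1)} (hα : IsBiform 2 α)
    {β : PreForm M n m n} (hβ : IsForm β) (h : PullbackEq X Z α (JetPDE.extD X β)) (j : ℕ) :
    ∃ β' : PreForm M n m n, IsForm β' ∧ PullbackEq X Z α (JetPDE.extD X β') ∧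
      ∀ u, 2 ≤ u → n < u + j → JetPDE.vcomp u β' = 0 := by
  induction j with
  | zero => exact ⟨β, hβ, h, fun u _ hu => vcomp_eq_zero_of_lt β hu⟩
  | succ j ih =>
    obtain ⟨β, hβ, h, hz⟩ := ih
    by_cases hj : n < 2 + j
    · exact ⟨β, hβ, h, fun u h2 _ => hz u h2 (by omega)⟩
    -- Here `v + 2` is the highest vertical degree not yet cleared.
    · obtain ⟨v, hv⟩ : ∃ v, n = v + 2 + j := ⟨n - 2 - j, by omega⟩
      -- In vertical degree `v + 3` neither `α` nor `β` has a part, so what remains says that the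
      -- top component of `β` is `d_v`-closed on `Z`.
      have h1 := PullbackZero.vcomp hX hZs (v + 2 + 1) h
      rw [vcomp_sub, hα.vcomp_eq, if_neg (by omega), hβ.vcomp_extD hX, hz (v + 2 + 1) (by omega)
        (by omega), dH_zero hX, add_zero, zero_sub] at h1
      have h2 := h1.neg
      rw [neg_neg] at h2
      have hbv := hβ.isBiform_vcomp (v + 2)
      -- The form `η` is `dκ`, where `d_v κ` agrees with the top component on `Z`. It has no part
      -- above degree `v + 2`, so subtracting it cannot restore a cleared component.
      obtain ⟨κ, hκ, hκ'⟩ : ∃ κ : PreForm M n m (n - 1), IsBiform (v + 1) κ ∧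
          ∃ η : PreForm M n m n, IsForm η ∧ JetPDE.extD X η = 0 ∧
            PullbackZero X Z (JetPDE.vcomp (v + 2) β - JetPDE.vcomp (v + 2) η) ∧
            ∀ u, v + 2 < u → JetPDE.vcomp u η = 0 := by
        obtain ⟨k, rfl⟩ : ∃ k, n = k + 1 := ⟨n - 1, by omega⟩
        obtain ⟨κ, hκ, hκ'⟩ := hV k (v + 1) _ hbv h2
        refine ⟨κ, hκ, JetPDE.extD X κ, IsForm.extD hX hκ.1, extD_extD hX hκ.1, ?_, fun u hu =>
          hκ.vcomp_extD hX (by omega) (by omega)⟩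
        rw [← hκ.dV_eq hX]
        exact hκ'
      obtain ⟨η, hη, hdη, hηZ, hηu⟩ := hκ'
      have hμ : IsForm (JetPDE.vcomp (v + 2) β - JetPDE.vcomp (v + 2) η) :=
        hbv.1.sub (hη.vcomp _)
      -- Subtracting the exact `η` does not affect `dβ`; the remaining top component vanishes only
      -- on `Z`, so it is subtracted too, which changes `dβ` by an element of the ideal.
      refine ⟨β - η - (JetPDE.vcomp (v + 2) β - JetPDE.vcomp (v + 2) η), (hβ.sub hη).sub hμ, ?_,
        fun u hu2 hu => ?_⟩
      · rw [extD_sub hX (hβ.sub hη) hμ, extD_sub hX hβ hη, hdη, sub_zero]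
        have := PullbackZero.add _ _ h (PullbackZero.extD hX hηZ)
        rw [PullbackEq, ← sub_add]
        exact this
      · rw [vcomp_sub, vcomp_sub, vcomp_sub, hβ.vcomp_vcomp, hη.vcomp_vcomp]
        rcases eq_or_ne u (v + 2) with rfl | hne
        · simp
        · rw [if_neg hne, if_neg hne, hz u hu2 (by omega), hηu u (by omega)]
          simp

end Pullback

/-! ## Integration by parts -/

section Volume

variable {M : Type*} [TopologicalSpace M] {n m : ℕ}
  [ChartedSpace (EuclideanSpace ℝ (Fin n)) M] {X : M → EuclideanSpace ℝ (Fin n)}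
  {Z : Set (Jet M n m)}

/-- The volume form `dx¹ ∧ ⋯ ∧ dxⁿ`. -/
def vol : PreForm M n m n := fun _ w => Matrix.det (Matrix.of fun j k : Fin n => (w j).1 k)

/-- The horizontal components of a tangent vector. -/
def horComp : Tan n m →ₗ[ℝ] (Fin n → ℝ) where
  toFun w := fun k => w.1 k
  map_add' _ _ := rfl
  map_smul' _ _ := rfl

theorem isForm_vol : IsForm (vol : PreForm M n m n) := by
  refine ⟨fun q => ⟨Matrix.detRowAlternating.compLinearMap horComp, fun w => rfl⟩, ?_,
    fun w => isSmooth_const _⟩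
  exact (FinDep.pi fun j => finDep_fst j).map
    fun z => Matrix.det (Matrix.of fun j k : Fin n => z j k)

omit [TopologicalSpace M] [ChartedSpace (EuclideanSpace ℝ (Fin n)) M] in
theorem hasWeight_vol : HasWeight 0 (vol : PreForm M n m n) := fun t _ => by
  funext q w
  simp only [scale, vol, vscale_fst, pow_zero, one_smul]

-- This is an alternating function of `n + 1` vectors of `ℝⁿ`, and these are linearly dependent.
omit [TopologicalSpace M] [ChartedSpace (EuclideanSpace ℝ (Fin n)) M] in
theorem wedge_dx_vol (i : Fin n) : wedge (dx i) (vol : PreForm M n m n) = 0 := by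
  funext q w
  obtain ⟨A, hA⟩ := isAlt_alternatization (V := Fin n → ℝ) (p := n)
    (F := fun x y => x i * Matrix.det (Matrix.of y))
    (fun x => IsAlt.const_mul _ ⟨Matrix.detRowAlternating, fun _ => rfl⟩)
    (fun x y w => by simp [add_mul]) (fun a x w => by simp [mul_assoc])
  refine (hA fun j => horComp (w j)).trans (A.map_linearDependent _ fun h => ?_)
  have := h.fintype_card_le_finrank
  simp at this

variable (hX : IsLocalDiffeomorph (𝓡 n) 𝓘(ℝ, EuclideanSpace ℝ (Fin n)) ∞ X)
include hX

theorem HasWeight.wedge_vert {p v : ℕ} {g : Jet M n m → ℝ} (hg : IsSmooth g)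
    {γ : PreForm M n m p} (hγ : HasWeight v γ) :
    HasWeight (v + 1) (wedge (fun q w => dirDeriv X g q (vert q w)) γ) := fun t ht => by
  have e : ∀ (q : Jet M n m) (w : Tan n m), vert q (vscale t q w) = t • vert q w := fun q w => by
    refine Prod.ext ?_ (funext fun c => contact_vscale c t q w)
    simp [vert, hor, vscale_fst]
  rw [scale_wedge, hγ t ht]
  simp only [e, dirDeriv_smul_right hX hg]
  rw [wedge_fmul_left (fun _ => t), wedge_smul_right, pow_succ', mul_smul]
  rfl

/-- Integration by parts of the forms `g d_v u^a_{I+i} ∧ dx¹ ∧ ⋯ ∧ dxⁿ`. -/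
theorem exists_integration_by_parts (c : JetIdx n m) (i : Fin n) :
    ∃ δ : PreForm M n m n, IsBiform 1 δ ∧ ∀ g : Jet M n m → ℝ, IsSmooth g →
      dH X (fmul g δ) = -fmul (totalDeriv X i g) (wedge (contact c) vol) -
        fmul g (wedge (contact (c.succ i)) vol) := by
  cases n with
  | zero => exact i.elim0
  | succ n =>
    have hv : IsForm (contr (totalVec i) (vol : PreForm M (n + 1) m (n + 1))) :=
      isForm_contr_totalVec isForm_vol i
    have wv : HasWeight 0 (contr (totalVec i) (vol : PreForm M (n + 1) m (n + 1))) :=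
      hasWeight_vol.contr_totalVec i
    have dv : extD X (contr (totalVec i) (vol : PreForm M (n + 1) m (n + 1))) = 0 := by
      funext q w
      refine Finset.sum_eq_zero fun j _ => ?_
      have e : (fun q' => contr (totalVec i) (vol : PreForm M (n + 1) m (n + 1)) q'
          fun k => w (j.succAbove k)) = fun _ =>
          contr (totalVec i) (vol : PreForm M (n + 1) m (n + 1)) q fun k => w (j.succAbove k) := by
        funext q'
        simp only [contr, vol]
        congr 2
        funext a
        refine Fin.cases rfl (fun a => rfl) a
      rw [e, dirDeriv_const hX, mul_zero]
    -- Contract `dx j ∧ vol = 0` with `D_i`.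
    have hdx : ∀ j, wedge (dx j) (contr (totalVec i) (vol : PreForm M (n + 1) m (n + 1))) =
        if j = i then vol else 0 := by
      intro j
      have h := contr_wedge (totalVec i) (dx j) (vol : PreForm M (n + 1) m (n + 1))
      rw [wedge_dx_vol] at h
      have h0 : contr (totalVec i) (0 : PreForm M (n + 1) m (n + 1 + 1)) = 0 := rfl
      rw [h0, eq_comm, sub_eq_zero] at h
      rw [← h]
      funext q w
      by_cases hj : j = i <;> simp [fmul, dx, totalVec, hj]
    have hδ : IsForm (wedge (contact c) (contr (totalVec i)
        (vol : PreForm M (n + 1) m (n + 1)))) := IsForm.wedge (isCovector_contact c) hv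
    have wδ := wv.wedge_contact c
    refine ⟨_, wδ.isBiform hδ, fun g hg => ?_⟩
    -- Split `dg` into its vertical part, which leads to weight two and is dropped by `d_h`, and `∑
    -- D_j g dx^j`, of which only `j = i` survives against the contracted volume form.
    have e1 : wedge (dirDeriv X g) (wedge (contact c) (contr (totalVec i) vol)) =
        wedge (fun q w => dirDeriv X g q (vert q w))
          (wedge (contact c) (contr (totalVec i) vol)) -
        fmul (totalDeriv X i g) (wedge (contact c) vol) := by
      have e2 : dirDeriv X g = fun q w => dirDeriv X g q (vert q w) +
          ∑ j, totalDeriv X j g q * dx j q w := by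
        funext q w
        exact dirDeriv_eq_vert_add hX hg q w
      conv_lhs => rw [e2, wedge_add_left, wedge_sum_left]
      rw [sub_eq_add_neg]
      congr 1
      rw [Finset.sum_eq_single i]
      · rw [wedge_fmul_left, wedge_wedge (isCovector_dx i) (isCovector_contact c) hv, hdx,
          if_pos rfl, fmul_neg]
      · intro j _ hj
        rw [wedge_fmul_left, wedge_wedge (isCovector_dx j) (isCovector_contact c) hv, hdx,
          if_neg hj, wedge_zero_right]
        funext q w
        simp [fmul]
      · simp
    have e3 : extD X (wedge (contact c) (contr (totalVec i) vol)) =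
        -wedge (contact (c.succ i)) vol := by
      rw [extD_wedge_contact hX c hv, dv, wedge_zero_right, neg_zero, zero_sub]
      congr 1
      rw [Finset.sum_eq_single i]
      · rw [hdx, if_pos rfl]
      · intro j _ hj
        rw [hdx, if_neg hj, wedge_zero_right]
      · simp
    have hc : ∀ c' : JetIdx (n + 1) m, IsForm (wedge (contact c') vol : PreForm M (n + 1) m _) :=
      fun c' => IsForm.wedge (isCovector_contact c') isForm_vol
    have wB := HasWeight.wedge_vert hX hg wδ
    have hB : IsForm (wedge (fun q w => dirDeriv X g q (vert q w))
          (wedge (contact c) (contr (totalVec i) vol))) := by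
      have := (IsForm.wedge (isCovector_dirDeriv hX hg) hδ).add
        (IsForm.fmul (IsSmooth.totalDeriv hX hg i) (hc c))
      rwa [e1, sub_add_cancel] at this
    rw [((wδ.fmul g).isBiform (IsForm.fmul hg hδ)).dH_eq hX, extD_fmul hX hg hδ, e1, e3,
      vcomp_add, vcomp_sub, wB.vcomp hB.isAlt, if_neg (by norm_num), fmul_neg, vcomp_neg,
      vcomp_fmul, vcomp_fmul, (hasWeight_vol.wedge_contact c).vcomp (hc c).isAlt,
      (hasWeight_vol.wedge_contact _).vcomp (hc _).isAlt]
    simp [sub_eq_add_neg]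

end Volume

/-! ## Source forms -/

section Source

variable {M : Type*} [TopologicalSpace M] {n m : ℕ}
  [ChartedSpace (EuclideanSpace ℝ (Fin n)) M] {X : M → EuclideanSpace ℝ (Fin n)}
  {Z : Set (Jet M n m)}

-- Exactly one slot is vertical; moving it to the front gives the sign.
omit [TopologicalSpace M] [ChartedSpace (EuclideanSpace ℝ (Fin n)) M] in
theorem vcomp_one_apply {p : ℕ} {α : PreForm M n m (p + 1)} {q : Jet M n m} (hα : IsAlt (α q))
    (w : Fin (p + 1) → Tan n m) :
    vcomp 1 α q w = ∑ i : Fin (p + 1), (-1) ^ (i : ℕ) *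
      α q (Fin.cons (vert q (w i)) fun j => hor q (w (i.succAbove j))) := by
  obtain ⟨A, hA⟩ := hα
  rw [vcomp, Finset.powersetCard_one, Finset.sum_map]
  refine Finset.sum_congr rfl fun i _ => ?_
  have e : (fun j => if j ∈ ({i} : Finset (Fin (p + 1))) then vert q (w j) else hor q (w j)) =
      i.insertNth (α := fun _ => Tan n m) (vert q (w i))
        fun j => hor q (w (i.succAbove j)) := by
    funext j
    refine i.succAboveCases ?_ (fun j => ?_) j
    · simp
    · simp [Fin.succAbove_ne]
  have h := A.map_insertNth i (vert q (w i)) fun j => hor q (w (i.succAbove j))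
  simp only [Function.Embedding.coeFn_mk]
  rw [e, hA, h, hA, zsmul_eq_mul]
  push_cast
  rfl

-- With `v` fixed, this is a top-degree alternating form on the span of the `n` total derivatives,
-- hence a multiple of the determinant.
omit [TopologicalSpace M] [ChartedSpace (EuclideanSpace ℝ (Fin n)) M] in
theorem apply_cons_hor {α : PreForm M n m (n + 1)} {q : Jet M n m} (hα : IsAlt (α q))
    (v : Tan n m) (w : Fin n → Tan n m) :
    α q (Fin.cons v fun j => hor q (w j)) =
      vol q w * α q (Fin.cons v fun j => totalVec j q) := by
  classical
  obtain ⟨A, hA⟩ := hα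
  let T : (Fin n → ℝ) →ₗ[ℝ] Tan n m :=
    { toFun := fun y => ∑ k, y k • totalVec k q
      map_add' := fun x y => by simp [add_smul, Finset.sum_add_distrib]
      map_smul' := fun a x => by simp [mul_smul, Finset.smul_sum] }
  have h := congrArg (fun B => B fun j => horComp (w j))
    (AlternatingMap.eq_smul_basis_det (Pi.basisFun ℝ (Fin n)) ((A.curryLeft v).compLinearMap T))
  simp only [AlternatingMap.smul_apply, smul_eq_mul, Pi.basisFun_det] at h
  have h1 : α q (Fin.cons v fun j => hor q (w j)) =
      ((A.curryLeft v).compLinearMap T) fun j => horComp (w j) := by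
    rw [hA]
    simp only [hor_eq_sum]
    rfl
  have h2 : α q (Fin.cons v fun j => totalVec j q) =
      ((A.curryLeft v).compLinearMap T) (Pi.basisFun ℝ (Fin n)) := by
    rw [hA]
    have : (fun j => totalVec j q) = fun j => T (Pi.basisFun ℝ (Fin n) j) := by
      funext j
      simp [T, Pi.single_apply]
    rw [this]
    rfl
  rw [h1, h2, h, mul_comm]
  rfl

/-- The component of bidegree `(n, 1)` of an `(n + 1)`-form. -/
theorem exists_vcomp_one_eq {α : PreForm M n m (n + 1)} (hα : IsForm α) :
    ∃ (S : Finset (JetIdx n m)) (b : JetIdx n m → Jet M n m → ℝ), (∀ c, IsSmooth (b c)) ∧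
      vcomp 1 α = ∑ c ∈ S, fmul (b c) (wedge (contact c) vol) := by
  obtain ⟨S, hS⟩ := exists_expansion hα.isAlt hα.finDep
  refine ⟨S, fun c q => α q (Fin.cons (vertVec c q) fun j => totalVec j q), fun c => ?_, ?_⟩
  · refine hα.isSmooth_apply (Y := fun j q => (Fin.cons (vertVec c q)
      (fun j => totalVec j q) : Fin (n + 1) → Tan n m) j) ?_ ?_
    · exact Fin.cases (fun i => isSmooth_const (0 : ℝ)) fun j i =>
        isSmooth_const ((EuclideanSpace.single j (1 : ℝ) : EuclideanSpace ℝ (Fin n)) i)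
    · exact Fin.cases (fun c' => isSmooth_const ((frame (Sum.inr c)).2 c')) fun j c' =>
        isSmooth_coord (c'.succ j)
  · funext q w
    rw [vcomp_one_apply (hα.isAlt q)]
    have h : ∀ i : Fin (n + 1),
        α q (Fin.cons (vert q (w i)) fun j => hor q (w (i.succAbove j))) =
        ∑ c ∈ S, contact c q (w i) * (vol q (fun j => w (i.succAbove j)) *
          α q (Fin.cons (vertVec c q) fun j => totalVec j q)) := by
      intro i
      have hc : ∀ c, contact c q (vert q (w i)) = contact c q (w i) := fun c => by
        simp [contact, vert, hor]
      rw [hS]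
      simp only [hc, apply_cons_hor (hα.isAlt q)]
      simp [vert, hor]
    simp only [h, Finset.sum_apply, fmul, wedge, Finset.mul_sum]
    rw [Finset.sum_comm]
    refine Finset.sum_congr rfl fun c _ => Finset.sum_congr rfl fun i _ => ?_
    ring

-- The source form has `d_v u^a` behind the volume form, the wedge product has it in front; the
-- factor `(-1) ^ n` accounts for the difference.
omit [TopologicalSpace M] [ChartedSpace (EuclideanSpace ℝ (Fin n)) M] in
theorem sourceForm_eq (e : Fin m → Jet M n m → ℝ) :
    sourceForm e = ∑ a, fmul (fun q => (-1) ^ n * e a q) (wedge (contact (0, a)) vol) := by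
  funext q w
  simp only [sourceForm, Finset.sum_apply, fmul, wedge, Finset.mul_sum]
  refine Finset.sum_congr rfl fun a _ => Finset.sum_congr rfl fun i _ => ?_
  simp only [contact, vol, pow_add]
  ring

omit [TopologicalSpace M] [ChartedSpace (EuclideanSpace ℝ (Fin n)) M] in
theorem sourceForm_add (e e' : Fin m → Jet M n m → ℝ) :
    sourceForm (fun a q => e a q + e' a q) = sourceForm e + sourceForm e' := by
  rw [sourceForm_eq, sourceForm_eq, sourceForm_eq, ← Finset.sum_add_distrib]
  refine Finset.sum_congr rfl fun a _ => ?_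
  funext q w
  simp only [fmul, Pi.add_apply]
  ring

omit [TopologicalSpace M] [ChartedSpace (EuclideanSpace ℝ (Fin n)) M] in
theorem sourceForm_zero : sourceForm (fun (_ : Fin m) (_ : Jet M n m) => (0 : ℝ)) = 0 := by
  funext q w
  simp [sourceForm]

theorem IsBiform.add {p v : ℕ} {α β : PreForm M n m p} (hα : IsBiform v α)
    (hβ : IsBiform v β) : IsBiform v (α + β) :=
  ⟨hα.1.add hβ.1, by rw [vcomp_add, hα.2, hβ.2]⟩

theorem IsBiform.neg {p v : ℕ} {α : PreForm M n m p} (hα : IsBiform v α) :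
    IsBiform v (-α) := ⟨hα.1.neg, by rw [vcomp_neg, hα.2]⟩

theorem IsBiform.fmul {p v : ℕ} {g : Jet M n m → ℝ} (hg : IsSmooth g) {α : PreForm M n m p}
    (hα : IsBiform v α) : IsBiform v (fmul g α) :=
  ⟨IsForm.fmul hg hα.1, by rw [vcomp_fmul, hα.2]⟩

/-- `α` is the sum of a variation, of a source form vanishing on `Z`, and of the horizontal
differential of a form vanishing on `Z`. -/
def HasSourceDecomp (X : M → EuclideanSpace ℝ (Fin n)) (Z : Set (Jet M n m))
    (α : PreForm M n m (n + 1)) : Prop :=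
  ∃ (L : PreForm M n m n) (e : Fin m → Jet M n m → ℝ) (θ : PreForm M n m n),
    IsBiform 0 L ∧ (∀ a, IsSmooth (e a)) ∧ (∀ a, ∀ q ∈ Z, e a q = 0) ∧ IsBiform 1 θ ∧
      PullbackZero X Z θ ∧ α = dV X L + sourceForm e - dH X θ

variable (hX : IsLocalDiffeomorph (𝓡 n) 𝓘(ℝ, EuclideanSpace ℝ (Fin n)) ∞ X)
include hX

theorem IsBiform.dH_add {p v : ℕ} {α β : PreForm M n m p} (hα : IsBiform v α)
    (hβ : IsBiform v β) : dH X (α + β) = dH X α + dH X β := by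
  rw [(hα.add hβ).dH_eq hX, hα.dH_eq hX, hβ.dH_eq hX, extD_add hX hα.1 hβ.1, vcomp_add]

theorem IsBiform.dV_add {p v : ℕ} {α β : PreForm M n m p} (hα : IsBiform v α)
    (hβ : IsBiform v β) : dV X (α + β) = dV X α + dV X β := by
  rw [(hα.add hβ).dV_eq hX, hα.dV_eq hX, hβ.dV_eq hX, extD_add hX hα.1 hβ.1, vcomp_add]

theorem IsBiform.dH_neg {p v : ℕ} {α : PreForm M n m p} (hα : IsBiform v α) :
    dH X (-α) = -dH X α := by
  rw [hα.neg.dH_eq hX, hα.dH_eq hX, extD_neg hX hα.1, vcomp_neg]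

theorem IsBiform.dV_neg {p v : ℕ} {α : PreForm M n m p} (hα : IsBiform v α) :
    dV X (-α) = -dV X α := by
  rw [hα.neg.dV_eq hX, hα.dV_eq hX, extD_neg hX hα.1, vcomp_neg]

theorem dV_zero {p : ℕ} : dV X (0 : PreForm M n m p) = 0 := by
  rw [(isBiform_zero 0).dV_eq hX, extD_zero hX, vcomp_zero]

theorem HasSourceDecomp.add {α β : PreForm M n m (n + 1)} (hα : HasSourceDecomp X Z α)
    (hβ : HasSourceDecomp X Z β) : HasSourceDecomp X Z (α + β) := by
  obtain ⟨L, e, θ, hL, he, heZ, hθ, hθZ, rfl⟩ := hα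
  obtain ⟨L', e', θ', hL', he', heZ', hθ', hθZ', rfl⟩ := hβ
  refine ⟨L + L', fun a q => e a q + e' a q, θ + θ', hL.add hL', fun a => (he a).add (he' a),
    fun a q hq => by simp only [heZ a q hq, heZ' a q hq, add_zero], hθ.add hθ', hθZ.add _ _ hθZ', ?_⟩
  rw [hL.dV_add hX hL', hθ.dH_add hX hθ', sourceForm_add]
  abel

theorem hasSourceDecomp_zero : HasSourceDecomp X Z (0 : PreForm M n m (n + 1)) :=
  ⟨0, fun _ _ => 0, 0, isBiform_zero 0, fun _ => isSmooth_const 0, fun _ _ _ => rfl,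
    isBiform_zero 1, pullbackZero_zero, by
      rw [dV_zero hX, dH_zero hX, sourceForm_zero, add_zero, sub_zero]⟩

theorem hasSourceDecomp_sum {ι : Type*} (s : Finset ι) {α : ι → PreForm M n m (n + 1)}
    (hα : ∀ i ∈ s, HasSourceDecomp X Z (α i)) : HasSourceDecomp X Z (∑ i ∈ s, α i) := by
  classical
  induction s using Finset.induction_on with
  | empty => simpa using hasSourceDecomp_zero hX
  | insert a s ha ih =>
    rw [Finset.sum_insert ha]
    exact HasSourceDecomp.add hX (hα a (by simp)) (ih fun i hi => hα i (by simp [hi]))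

/-- Repeated integration by parts. -/
theorem hasSourceDecomp_wedge_contact (hZs : IsTotalDerivStable X Z) (N : ℕ) (c : JetIdx n m)
    (hc : ∑ i, c.1 i = N) {g : Jet M n m → ℝ} (hg : IsSmooth g) (hgZ : ∀ q ∈ Z, g q = 0) :
    HasSourceDecomp X Z (fmul g (wedge (contact c) vol)) := by
  classical
  induction N generalizing c g with
  | zero =>
    obtain ⟨I, a⟩ := c
    obtain rfl : I = 0 := funext fun i => (Finset.sum_eq_zero_iff.1 hc) i (Finset.mem_univ i)
    -- At order zero the form already is a source form; `(-1) ^ n` compensates the sign in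
    -- `sourceForm_eq`.
    refine ⟨0, fun b q => if b = a then (-1) ^ n * g q else 0, 0, isBiform_zero 0, fun b => ?_,
      fun b q hq => by simp only [hgZ q hq, mul_zero, ite_self], isBiform_zero 1, pullbackZero_zero, ?_⟩
    · by_cases hb : b = a
      · simpa only [hb, if_true] using hg.const_mul _
      · simpa only [hb, if_false] using isSmooth_const 0
    · rw [dV_zero hX, dH_zero hX, zero_add, sub_zero, sourceForm_eq, Finset.sum_eq_single a]
      · simp only [if_true, ← mul_assoc, ← mul_pow, neg_mul_neg, one_mul, one_pow]
      · intro b _ hb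
        funext q w
        simp [hb, fmul]
      · simp
  | succ N ih =>
    obtain ⟨i, hi⟩ : ∃ i, c.1 i ≠ 0 := by
      by_contra! h
      simp [h] at hc
    let c' : JetIdx n m := (c.1 - Pi.single i 1, c.2)
    have hcc : c'.succ i = c := by
      refine Prod.ext (funext fun j => ?_) rfl
      by_cases hj : j = i
      · subst hj
        simp only [JetIdx.succ, c', Pi.add_apply, Pi.sub_apply, Pi.single_eq_same]
        omega
      · simp [JetIdx.succ, c', hj]
    have hc' : ∑ i, c'.1 i = N := by
      rw [← hcc] at hc
      simp only [JetIdx.succ, Pi.add_apply, Finset.sum_add_distrib, Finset.sum_pi_single',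
        Finset.mem_univ, if_true] at hc
      omega
    -- Moving one derivative off the contact form replaces `g` by `-D_i g`, which still vanishes on
    -- `Z`, so the induction hypothesis applies at lower order. The boundary form `g δ` vanishes on
    -- `Z` as well.
    obtain ⟨δ, hδ, h⟩ := exists_integration_by_parts hX c' i
    have hD := ih c' hc' (IsSmooth.totalDeriv hX hg i).neg
      fun q hq => by rw [hZs g hg hgZ i q hq, neg_zero]
    have hθ : HasSourceDecomp X Z (-dH X (fmul g δ)) :=
      ⟨0, fun _ _ => 0, fmul g δ, isBiform_zero 0, fun _ => isSmooth_const 0, fun _ _ _ => rfl,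
        hδ.fmul hg, PullbackZero.smul g δ hg hgZ hδ.1, by
          rw [dV_zero hX, sourceForm_zero, add_zero, zero_sub]⟩
    have := HasSourceDecomp.add hX hθ hD
    rw [h g hg, hcc] at this
    convert this using 1
    funext q w
    simp only [fmul, Pi.add_apply, Pi.neg_apply, Pi.sub_apply]
    ring

/-- The `(n,1)` part is a combination of contact forms wedged with the volume form, and each
coefficient retains the factor `g`. -/
theorem hasSourceDecomp_fmul (hZs : IsTotalDerivStable X Z) {g : Jet M n m → ℝ}
    (hg : IsSmooth g) (hgZ : ∀ q ∈ Z, g q = 0) {β : PreForm M n m (n + 1)} (hβ : IsForm β) :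
    HasSourceDecomp X Z (vcomp 1 (fmul g β)) := by
  obtain ⟨S, b, hb, h⟩ := exists_vcomp_one_eq hβ
  have e : vcomp 1 (fmul g β) =
      ∑ c ∈ S, fmul (fun q => g q * b c q) (wedge (contact c) vol) := by
    rw [vcomp_fmul, h]
    funext q w
    simp only [fmul, Finset.sum_apply, Finset.mul_sum, mul_assoc]
  rw [e]
  exact hasSourceDecomp_sum hX _ fun c _ => hasSourceDecomp_wedge_contact hX hZs _ c rfl
    (hg.mul (hb c)) fun q hq => by rw [hgZ q hq, zero_mul]

/-- By the Leibniz rule `dg ∧ γ = d(g γ) - g dγ`. The `(n,1)` part of `d(g γ)` is a variation plus a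
horizontal differential, both of components of `g γ`, and `-g dγ` is covered by the previous case.
-/
theorem hasSourceDecomp_diff (hZs : IsTotalDerivStable X Z) {g : Jet M n m → ℝ}
    (hg : IsSmooth g) (hgZ : ∀ q ∈ Z, g q = 0) {γ : PreForm M n m n} (hγ : IsForm γ) :
    HasSourceDecomp X Z (vcomp 1 (diffWedge X g γ)) := by
  have hf := IsForm.fmul hg hγ
  have e : diffWedge X g γ = extD X (fmul g γ) + fmul (fun q => -g q) (extD X γ) := by
    rw [extD_fmul hX hg hγ]
    funext q w
    simp only [fmul, wedge, diffWedge, Pi.add_apply]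
    ring
  have hz := PullbackZero.vcomp hX hZs 1 (PullbackZero.smul (X := X) g γ hg hgZ hγ)
  rw [e, vcomp_add, hf.vcomp_extD hX 0]
  refine HasSourceDecomp.add hX ?_ (hasSourceDecomp_fmul hX hZs hg.neg
    (fun q hq => by rw [hgZ q hq, neg_zero]) (IsForm.extD hX hγ))
  refine ⟨vcomp 0 (fmul g γ), fun _ _ => 0, -vcomp 1 (fmul g γ), hf.isBiform_vcomp 0,
    fun _ => isSmooth_const 0, fun _ _ _ => rfl, (hf.isBiform_vcomp 1).neg, hz.neg, ?_⟩
  rw [(hf.isBiform_vcomp 1).dH_neg hX, sourceForm_zero, add_zero, sub_neg_eq_add]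

/-- Every `(n + 1)`-form vanishing on `Z` has a component of bidegree `(n, 1)` which is a
variation up to source forms and horizontal differentials vanishing on `Z`. -/
theorem PullbackZero.hasSourceDecomp (hZs : IsTotalDerivStable X Z)
    {α : PreForm M n m (n + 1)} (hα : PullbackZero X Z α) :
    HasSourceDecomp X Z (JetPDE.vcomp 1 α) := by
  -- The degree is an index of `PullbackZero`, so the induction needs it as a variable with an
  -- equation.
  suffices h : ∀ {p : ℕ} {α : PreForm M n m p}, PullbackZero X Z α → ∀ hp : p = n + 1,
      HasSourceDecomp X Z (JetPDE.vcomp 1 (hp ▸ α)) from h hα rfl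
  intro p α hα hp
  induction hα with
  | smul g β hg hZ hβ =>
    subst hp
    exact hasSourceDecomp_fmul hX hZs hg hZ hβ
  | @diff p g γ hg hZ hγ =>
    obtain rfl : p = n := by omega
    exact hasSourceDecomp_diff hX hZs hg hZ hγ
  | add α β _ _ ihα ihβ =>
    subst hp
    have := HasSourceDecomp.add hX (ihα rfl) (ihβ rfl)
    rwa [← vcomp_add] at this

end Source

/-! ## Jet prolongations -/

section Jets

variable {M : Type*} [TopologicalSpace M] {n m : ℕ}
  [ChartedSpace (EuclideanSpace ℝ (Fin n)) M] {X : M → EuclideanSpace ℝ (Fin n)} {U : Set M}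

theorem CoordChart.contDiffAt_comp_symm {Φ : OpenPartialHomeomorph M (EuclideanSpace ℝ (Fin n))}
    (hΦ : CoordChart X Φ) {x : M} (hx : x ∈ Φ.source) {h : M → ℝ}
    (hh : ContMDiffAt (𝓡 n) 𝓘(ℝ, ℝ) ∞ h x) : ContDiffAt ℝ ∞ (h ∘ Φ.symm) (Φ x) := by
  rw [← contMDiffAt_iff_contDiffAt]
  refine ContMDiffAt.comp (Φ x) ?_ (hΦ.contMDiffAt_symm (Φ.map_source hx))
  rwa [Φ.left_inv hx]

theorem CoordChart.partialDeriv_eventuallyEq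
    {Φ : OpenPartialHomeomorph M (EuclideanSpace ℝ (Fin n))} (hΦ : CoordChart X Φ)
    (hU : IsOpen U) {h : M → ℝ} (hh : ContMDiffOn (𝓡 n) 𝓘(ℝ, ℝ) ∞ h U) (i : Fin n) {x : M}
    (hxU : x ∈ U) (hx : x ∈ Φ.source) :
    partialDeriv X i h =ᶠ[nhds x]
      fun y => fderiv ℝ (h ∘ Φ.symm) (Φ y) (EuclideanSpace.single i 1) := by
  filter_upwards [hU.mem_nhds hxU, Φ.open_source.mem_nhds hx] with y hyU hy
  exact hΦ.baseDeriv_eq hy ((hh.contMDiffAt (hU.mem_nhds hyU)).mdifferentiableAt (by simp)) _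

theorem partialDeriv_congr {h h' : M → ℝ} (hU : IsOpen U) (e : Set.EqOn h h' U) (i : Fin n) :
    Set.EqOn (partialDeriv X i h) (partialDeriv X i h') U := by
  intro x hx
  have := Filter.EventuallyEq.mfderiv_eq (I := 𝓡 n) (I' := 𝓘(ℝ, ℝ))
    (Filter.eventuallyEq_of_mem (hU.mem_nhds hx) e)
  simp only [partialDeriv, baseDeriv]
  rw [this]
  rfl

theorem iterate_partialDeriv_congr {h h' : M → ℝ} (hU : IsOpen U) (e : Set.EqOn h h' U)
    (i : Fin n) (k : ℕ) :
    Set.EqOn ((partialDeriv X i)^[k] h) ((partialDeriv X i)^[k] h') U := by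
  induction k with
  | zero => exact e
  | succ k ih =>
    simp only [Function.iterate_succ_apply']
    exact partialDeriv_congr hU ih i

/-- The iterated partial derivatives along a list of directions, with multiplicities `I`. -/
def listDeriv (X : M → EuclideanSpace ℝ (Fin n)) (l : List (Fin n)) (I : Fin n → ℕ) (h : M → ℝ) :
    M → ℝ := l.foldr (fun i h => (partialDeriv X i)^[I i] h) h

theorem listDeriv_cons (j : Fin n) (l : List (Fin n)) (I : Fin n → ℕ) (h : M → ℝ) :
    listDeriv X (j :: l) I h = (partialDeriv X j)^[I j] (listDeriv X l I h) := rfl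

theorem listDeriv_add_single {l : List (Fin n)} {i : Fin n} (hi : i ∉ l) (I : Fin n → ℕ)
    (h : M → ℝ) : listDeriv X l (I + Pi.single i 1) h = listDeriv X l I h := by
  induction l with
  | nil => rfl
  | cons j l ih =>
    rw [List.mem_cons, not_or] at hi
    rw [listDeriv_cons, listDeriv_cons, ih hi.2, Pi.add_apply, Pi.single_eq_of_ne (Ne.symm hi.1),
      add_zero]

variable (hX : IsLocalDiffeomorph (𝓡 n) 𝓘(ℝ, EuclideanSpace ℝ (Fin n)) ∞ X) (hU : IsOpen U)
include hX hU

theorem contMDiffOn_partialDeriv {h : M → ℝ} (hh : ContMDiffOn (𝓡 n) 𝓘(ℝ, ℝ) ∞ h U)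
    (i : Fin n) : ContMDiffOn (𝓡 n) 𝓘(ℝ, ℝ) ∞ (partialDeriv X i h) U := by
  intro x hxU
  obtain ⟨Φ, hΦ, hx⟩ := exists_coordChart hX x
  have hH := hΦ.contDiffAt_comp_symm hx (hh.contMDiffAt (hU.mem_nhds hxU))
  have h1 : ContDiffAt ℝ ∞ (fun z => fderiv ℝ (h ∘ Φ.symm) z (EuclideanSpace.single i 1)) (Φ x) :=
    (hH.fderiv_right (m := ∞) (by simp)).clm_apply contDiffAt_const
  exact (((contMDiffAt_iff_contDiffAt.2 h1).comp x (hΦ.contMDiffAt hx)).congr_of_eventuallyEq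
    (hΦ.partialDeriv_eventuallyEq hU hh i hxU hx)).contMDiffWithinAt

theorem partialDeriv_comm {h : M → ℝ} (hh : ContMDiffOn (𝓡 n) 𝓘(ℝ, ℝ) ∞ h U) (i j : Fin n) :
    Set.EqOn (partialDeriv X i (partialDeriv X j h)) (partialDeriv X j (partialDeriv X i h)) U := by
  intro x hxU
  obtain ⟨Φ, hΦ, hx⟩ := exists_coordChart hX x
  have hH := hΦ.contDiffAt_comp_symm hx (hh.contMDiffAt (hU.mem_nhds hxU))
  have hd : DifferentiableAt ℝ (fderiv ℝ (h ∘ Φ.symm)) (Φ x) :=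
    (hH.fderiv_right (m := ∞) (by simp)).differentiableAt (by simp)
  have main : ∀ i j : Fin n, partialDeriv X i (partialDeriv X j h) x =
      fderiv ℝ (fderiv ℝ (h ∘ Φ.symm)) (Φ x) (EuclideanSpace.single i 1)
        (EuclideanSpace.single j 1) := by
    intro i j
    have h1 := contMDiffOn_partialDeriv hX hU hh j
    rw [(hΦ.partialDeriv_eventuallyEq hU h1 i hxU hx).self_of_nhds]
    have e : partialDeriv X j h ∘ Φ.symm =ᶠ[nhds (Φ x)]
        fun z => fderiv ℝ (h ∘ Φ.symm) z (EuclideanSpace.single j 1) := by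
      have h2 := hΦ.partialDeriv_eventuallyEq hU hh j hxU hx
      have h3 := (Φ.continuousAt_symm (Φ.map_source hx)).tendsto
      rw [Φ.left_inv hx] at h3
      filter_upwards [h3.eventually h2, Φ.open_target.mem_nhds (Φ.map_source hx)] with z hz hz'
      rw [Function.comp, hz, Φ.right_inv hz']
    simp only
    rw [e.fderiv_eq, fderiv_clm_apply hd (differentiableAt_const _)]
    simp
  rw [main, main]
  exact (hH.isSymmSndFDerivAt (by simpa using ENat.LEInfty.out)).eq _ _

theorem contMDiffOn_iterate_partialDeriv {h : M → ℝ} (hh : ContMDiffOn (𝓡 n) 𝓘(ℝ, ℝ) ∞ h U)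
    (i : Fin n) (k : ℕ) : ContMDiffOn (𝓡 n) 𝓘(ℝ, ℝ) ∞ ((partialDeriv X i)^[k] h) U := by
  induction k with
  | zero => exact hh
  | succ k ih =>
    rw [Function.iterate_succ_apply']
    exact contMDiffOn_partialDeriv hX hU ih i

theorem contMDiffOn_listDeriv {h : M → ℝ} (hh : ContMDiffOn (𝓡 n) 𝓘(ℝ, ℝ) ∞ h U)
    (l : List (Fin n)) (I : Fin n → ℕ) :
    ContMDiffOn (𝓡 n) 𝓘(ℝ, ℝ) ∞ (listDeriv X l I h) U := by
  induction l with
  | nil => exact hh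
  | cons j l ih => exact contMDiffOn_iterate_partialDeriv hX hU ih j (I j)

theorem partialDeriv_iterate_comm {h : M → ℝ} (hh : ContMDiffOn (𝓡 n) 𝓘(ℝ, ℝ) ∞ h U)
    (i j : Fin n) (k : ℕ) :
    Set.EqOn (partialDeriv X i ((partialDeriv X j)^[k] h))
      ((partialDeriv X j)^[k] (partialDeriv X i h)) U := by
  induction k with
  | zero => exact fun x _ => rfl
  | succ k ih =>
    simp only [Function.iterate_succ_apply']
    exact (partialDeriv_comm hX hU (contMDiffOn_iterate_partialDeriv hX hU hh j k) i j).trans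
      (partialDeriv_congr hU ih j)

/-- The new derivative commutes past the blocks of other directions until it meets its own block,
which occurs only once. -/
theorem partialDeriv_listDeriv {h : M → ℝ} (hh : ContMDiffOn (𝓡 n) 𝓘(ℝ, ℝ) ∞ h U)
    {l : List (Fin n)} (hl : l.Nodup) {i : Fin n} (hi : i ∈ l) (I : Fin n → ℕ) :
    Set.EqOn (partialDeriv X i (listDeriv X l I h)) (listDeriv X l (I + Pi.single i 1) h) U := by
  induction l with
  | nil => simp at hi
  | cons j l ih =>
    rw [List.nodup_cons] at hl
    simp only [listDeriv_cons]
    by_cases hij : i = j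
    · subst hij
      rw [listDeriv_add_single hl.1, Pi.add_apply, Pi.single_eq_same, Function.iterate_succ_apply']
      exact fun x _ => rfl
    · rw [Pi.add_apply, Pi.single_eq_of_ne (Ne.symm hij), add_zero]
      exact (partialDeriv_iterate_comm hX hU (contMDiffOn_listDeriv hX hU hh l I) i j _).trans
        (iterate_partialDeriv_congr hU (ih hl.2 ((List.mem_cons.1 hi).resolve_left hij)) j _)

variable {φ : M → Fin m → ℝ} (hφ : ContMDiffOn (𝓡 n) 𝓘(ℝ, Fin m → ℝ) ∞ φ U)
include hφ

omit hX hU in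
theorem contMDiffOn_component (a : Fin m) : ContMDiffOn (𝓡 n) 𝓘(ℝ, ℝ) ∞ (fun y => φ y a) U := by
  have : ContMDiff 𝓘(ℝ, Fin m → ℝ) 𝓘(ℝ, ℝ) ∞ (fun y : Fin m → ℝ => y a) := by
    rw [contMDiff_iff_contDiff]
    fun_prop
  exact this.comp_contMDiffOn hφ

/-- The chain rule along the jet prolongation of a function. -/
theorem partialDeriv_comp_jetProlong {g : Jet M n m → ℝ} (hg : IsSmooth g) (i : Fin n) {x : M}
    (hxU : x ∈ U) : partialDeriv X i (fun y => g (jetProlong X φ y)) x =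
      totalDeriv X i g (jetProlong X φ x) := by
  obtain ⟨S, G, hG, hg⟩ := hg
  obtain ⟨Φ, hΦ, hx⟩ := exists_coordChart hX x
  let v : M → S → ℝ := fun y c => (jetProlong X φ y).2 c
  have hv : ∀ c : S, ContMDiffOn (𝓡 n) 𝓘(ℝ, ℝ) ∞ (fun y => v y c) U := fun c =>
    contMDiffOn_listDeriv hX hU (contMDiffOn_component hφ _) _ _
  have hv' : ContMDiffOn (𝓡 n) 𝓘(ℝ, S → ℝ) ∞ v U := contMDiffOn_pi_space.2 hv
  have hgφ : (fun y => g (jetProlong X φ y)) = fun y => G (y, v y) := funext fun y => hg _ _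
  have hm : ContMDiffAt (𝓡 n) 𝓘(ℝ, ℝ) ∞ (fun y => G (y, v y)) x :=
    (hG _).comp x (contMDiffAt_id.prodMk (hv'.contMDiffAt (hU.mem_nhds hxU)))
  rw [hgφ, partialDeriv, hΦ.baseDeriv_eq hx (hm.mdifferentiableAt (by simp)), totalDeriv]
  refine Eq.trans ?_ (hΦ.dirDeriv_eq hG hg hx _ _).symm
  have hL : HasFDerivAt (locRep Φ G) (fderiv ℝ (locRep Φ G) (Φ x, v x))
      (Φ x, fun c => ((fun y => v y c) ∘ Φ.symm) (Φ x)) := by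
    have := ((hΦ.contDiffAt_locRep hG (z := (Φ x, v x)) (Φ.map_source hx)).differentiableAt
      (by simp)).hasFDerivAt
    simpa [Φ.left_inv hx] using this
  have hc : ∀ c : S, HasFDerivAt ((fun y => v y c) ∘ Φ.symm)
      (fderiv ℝ ((fun y => v y c) ∘ Φ.symm) (Φ x)) (Φ x) := fun c =>
    ((hΦ.contDiffAt_comp_symm hx ((hv c).contMDiffAt (hU.mem_nhds hxU))).differentiableAt
      (by simp)).hasFDerivAt
  have hcomp := hL.comp (Φ x) ((hasFDerivAt_id (Φ x)).prodMk (hasFDerivAt_pi.2 hc))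
  have := congrArg (fun l => l (EuclideanSpace.single i 1)) hcomp.fderiv
  refine Eq.trans this ?_
  simp only [ContinuousLinearMap.comp_apply]
  congr 1
  refine Prod.ext rfl (funext fun c => ?_)
  refine Eq.trans (hΦ.baseDeriv_eq hx (((hv c).contMDiffAt
    (hU.mem_nhds hxU)).mdifferentiableAt (by simp)) _).symm ?_
  -- Along the prolongation the coordinate `u^a_I` has `i`-th derivative `u^a_{I+i}`, the
  -- coefficient in `D_i`.
  exact partialDeriv_listDeriv hX hU (contMDiffOn_component hφ _) (List.nodup_finRange n)
    (List.mem_finRange i) c.1.1 hxU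

omit hU hφ in
theorem IsSmooth.iterTotalDeriv {g : Jet M n m → ℝ} (hg : IsSmooth g) (l : List (Fin n)) :
    IsSmooth (iterTotalDeriv X l g) := by
  induction l with
  | nil => exact hg
  | cons i l ih => exact IsSmooth.totalDeriv hX ih i

/-- By the chain rule each further total derivative is a partial derivative of a function that
vanishes on the open set `U`. -/
theorem iterTotalDeriv_jetProlong_eq_zero {g : Jet M n m → ℝ} (hg : IsSmooth g)
    (h0 : ∀ x ∈ U, g (jetProlong X φ x) = 0) (l : List (Fin n)) :
    ∀ x ∈ U, iterTotalDeriv X l g (jetProlong X φ x) = 0 := by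
  induction l with
  | nil => exact h0
  | cons i l ih =>
    intro x hx
    have h1 := partialDeriv_comp_jetProlong hX hU hφ (IsSmooth.iterTotalDeriv hX hg l) i hx
    refine h1.symm.trans ?_
    rw [partialDeriv_congr hU (h' := fun _ => 0) (fun y hy => ih y hy) i hx]
    simp [partialDeriv, baseDeriv]
    rfl

end Jets

/-! ### Total derivatives and infinite prolongations -/

section Prolongation

variable {M : Type*} [TopologicalSpace M] {n m r : ℕ}
  [ChartedSpace (EuclideanSpace ℝ (Fin n)) M] {X : M → EuclideanSpace ℝ (Fin n)}
  (hX : IsLocalDiffeomorph (𝓡 n) 𝓘(ℝ, EuclideanSpace ℝ (Fin n)) ∞ X)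
include hX

/-- Regularity gives `g = ∑ c D_I f`. By the Leibniz rule every term of `D_i g` contains `D_I f` or
`D_i D_I f`, and both vanish on the prolongation. -/
theorem IsRegularProlong.isTotalDerivStable {f : Fin r → Jet M n m → ℝ}
    (hf : ∀ A, IsSmooth (f A)) (h : IsRegularProlong X f) :
    IsTotalDerivStable X (infProlong X f) := by
  intro g hg hgZ i q hq
  obtain ⟨T, c, hc, hgc⟩ := h g hg hgZ
  have hs : ∀ t : List (Fin n) × Fin r, IsSmooth (iterTotalDeriv X t.1 (f t.2)) := fun t =>
    IsSmooth.iterTotalDeriv hX (hf t.2) t.1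
  have e : g = fun q => ∑ t ∈ T, c t q * iterTotalDeriv X t.1 (f t.2) q := funext hgc
  rw [e, totalDeriv, dirDeriv_sum hX _ fun t _ => (hc t).mul (hs t)]
  refine Finset.sum_eq_zero fun t _ => ?_
  have h0 : iterTotalDeriv X t.1 (f t.2) q = 0 := hq t.1 t.2
  have h1 : dirDeriv X (iterTotalDeriv X t.1 (f t.2)) q
      (EuclideanSpace.single i 1, fun c => q.2 (c.succ i)) = 0 := hq (i :: t.1) t.2
  rw [dirDeriv_mul hX (hc t) (hs t), h0, h1, mul_zero, mul_zero, add_zero]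

theorem IsTotalDerivStable.subset_infProlong {Z : Set (Jet M n m)}
    (hZ : IsTotalDerivStable X Z) {e : Fin r → Jet M n m → ℝ} (he : ∀ a, IsSmooth (e a))
    (heZ : ∀ a, ∀ q ∈ Z, e a q = 0) : Z ⊆ infProlong X e := by
  intro q hq l a
  induction l generalizing q with
  | nil => exact heZ a q hq
  | cons i l ih =>
    exact hZ _ (IsSmooth.iterTotalDeriv hX (he a) l) (fun q hq => ih hq) i q hq

end Prolongation

end JetPDE

end

/-! ### Construction of the Lagrangian -/

theorem mainTheorem1 {M : Type*} [TopologicalSpace M] [T2Space M] [SecondCountableTopology M]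
    {n m r : ℕ} [ChartedSpace (EuclideanSpace ℝ (Fin n)) M] [IsManifold (𝓡 n) ∞ M]
    (X : M → EuclideanSpace ℝ (Fin n))
    (hX : IsLocalDiffeomorph (𝓡 n) 𝓘(ℝ, EuclideanSpace ℝ (Fin n)) ∞ X)
    (k : ℕ) (f : Fin r → JetPDE.Jet M n m → ℝ)
    (hf : JetPDE.IsRegularSystem k f) (hf_inf : JetPDE.IsRegularProlong X f)
    (hE : JetPDE.DeRhamTrivial X (JetPDE.infProlong X f))
    (hJ : JetPDE.DeRhamTrivial X (Set.univ : Set (JetPDE.Jet M n m)))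
    (wHat : JetPDE.PreForm M n m (n + 1))
    (hw : JetPDE.IsPresymplecticCurrent X (JetPDE.infProlong X f) wHat) :
    ∃ (L : JetPDE.PreForm M n m n) (e : Fin m → JetPDE.Jet M n m → ℝ)
      (θ σ : JetPDE.PreForm M n m n) (w : JetPDE.PreForm M n m (n + 1)),
      JetPDE.IsFirstVariation X L e θ ∧
      JetPDE.IsBiform 2 σ ∧
      w = JetPDE.dV X θ + JetPDE.dH X σ ∧
      JetPDE.PullbackEq X (JetPDE.infProlong X f) w wHat ∧
      (JetPDE.VerticallyTrivial X (JetPDE.infProlong X f) → σ = 0) ∧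
      JetPDE.infProlong X f ⊆ JetPDE.infProlong X e ∧
      ∀ (U : Set M) (φ : M → Fin m → ℝ), IsOpen U → ContMDiffOn (𝓡 n) 𝓘(ℝ, Fin m → ℝ) ∞ φ U →
        (∀ x ∈ U, ∀ A, f A (JetPDE.jetProlong X φ x) = 0) →
        ∀ x ∈ U, ∀ a, e a (JetPDE.jetProlong X φ x) = 0 := by
  open JetPDE in
  have hZ := hf_inf.isTotalDerivStable hX fun A => (hf.1 A).1
  obtain ⟨β, hβ, hωβ, hVT⟩ : ∃ β : PreForm M n m n, IsForm β ∧
      PullbackEq X (infProlong X f) wHat (extD X β) ∧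
      (VerticallyTrivial X (infProlong X f) → vcomp 2 β = 0) := by
    obtain ⟨β, hβ, h⟩ := hw.exists_primitive hX hE
    by_cases hV : VerticallyTrivial X (infProlong X f)
    · obtain ⟨β', hβ', h', h2⟩ :=
        exists_primitive_of_verticallyTrivial hX hZ hV hw.1 hβ h n
      rcases Nat.eq_zero_or_pos n with rfl | hn
      · exact ⟨β', hβ', h', fun _ => vcomp_eq_zero_of_lt β' (by norm_num)⟩
      · exact ⟨β', hβ', h', fun _ => h2 2 le_rfl (by omega)⟩
    · exact ⟨β, hβ, h, fun h => absurd h hV⟩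
  -- The ideal element `dβ - wHat` is decomposed in vertical degree one, where `wHat` has no part;
  -- there it equals `d_v β_0 + d_h β_1`.
  obtain ⟨L, e, θ, hL, he, heZ, hθ, hθZ, h⟩ := PullbackZero.hasSourceDecomp hX hZ hωβ.neg
  have b0 := hβ.isBiform_vcomp 0
  have b1 := hβ.isBiform_vcomp 1
  have b2 := hβ.isBiform_vcomp 2
  rw [vcomp_neg, vcomp_sub, hw.1.vcomp_eq, if_neg (by norm_num), hβ.vcomp_extD hX 0, zero_sub,
    neg_neg] at h
  have hsub := hZ.subset_infProlong hX he heZ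
  refine ⟨vcomp 0 β + -L, e, vcomp 1 β + θ, vcomp 2 β, _, ⟨b0.add hL.neg, he, b1.add hθ, ?_⟩, b2,
    rfl, ?_, hVT, hsub, fun U φ hU hφ hφf x hx a => heZ a _ fun l A => ?_⟩
  · rw [b0.dV_add hX hL.neg, hL.dV_neg hX, b1.dH_add hX hθ, ← sub_eq_add_neg,
      sub_eq_iff_eq_add, ← sub_eq_zero]
    rw [← sub_eq_zero] at h
    rw [← h]
    abel
  -- In vertical degree two the ideal element is `d_v β_1 + d_h β_2 - wHat`. The correction `d_v θ`
  -- may be added because `θ` lies in the ideal.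
  · have h2 := PullbackZero.vcomp hX hZ 2 hωβ.neg
    rw [vcomp_neg, vcomp_sub, hw.1.vcomp_eq, if_pos rfl, hβ.vcomp_extD hX 1, neg_sub] at h2
    have h3 := PullbackZero.vcomp hX hZ 2 (PullbackZero.extD hX hθZ)
    rw [← hθ.dV_eq hX] at h3
    rw [b1.dV_add hX hθ]
    refine Eq.mp (congrArg (PullbackZero X _) ?_) (h2.add _ _ h3)
    abel
  · exact iterTotalDeriv_jetProlong_eq_zero hX hU hφ (hf.1 A).1
      (fun y hy => hφf y hy A) l x hx
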